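/- Let $G$ be a finite simple undirected graph with $n$ vertices. For integers $q,k,i\ge 0$, a proper $(q,k,i)$-coloring of $G$ is a map $h$ that assigns to every vertex a $k$-element subset of $[q]=\{1,\dots,q\}$ such that $|h(u)\cap h(v)|\le i$ for every edge $uv$. A set $S\subseteq V(G)$ is a feedback vertex set if $G[V(G)\setminus S]$ is acyclic. Theorem. There is an algorithm (a single random access machine program) that, given $q,k,i$, the adjacency matrix of $G$ and a feedback vertex set $S$ of $G$, computes the number of proper $(q,k,i)$-colorings of $G$. For $n\ge 1$ and $i\le k\le q$ it takes $$O\Big(\tbinom{q}{k}^{|S|+2}\,n^{O(1)}\Big)$$ time, and if moreover $q\ge 2$, then in the same run it uses $$O\Big(\tbinom{q}{k}\,n^2\log q\Big)$$ bits of space. The constants hidden in $O(\cdot)$ depend only on $k$, and the exponent $O(1)$ of $n$ is an absolute constant. Here time is the number of operations on machine words of length $w=\lfloor\log_2(n+q)\rfloor+1$, an instruction (constant assignment, addition, truncated subtraction, multiplication, integer division or remainder, load, store) or test that handles numbers and memory addresses of total bit length $b$ being charged $(\lfloor b/w\rfloor+1)^2$ such operations. Space is the largest number of bits in use at any moment,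 each register and memory cell in use, including those holding the input, being charged one bit more than the length of its content. -/

import Mathlib

/-! ### Colorings and feedback vertex sets -/

/-- The family of all `k`-element subsets of a set of `q` colors. -/
abbrev ColorSet (q k : ℕ) : Type := {C : Finset (Fin q) // C.card = k}

/-- A coloring by `k`-subsets of `q` colors is proper if adjacent vertices share at most `i`
colors. -/
def IsProperColoring {V : Type*} (G : SimpleGraph V) {q k : ℕ} (i : ℕ)
    (h : V → ColorSet q k) : Prop :=
  ∀ u v : V, G.Adj u v → ((h u).1 ∩ (h v).1).card ≤ i

/-- The number of proper `(q,k,i)`-colorings of `G`. -/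
noncomputable def numProperColorings {V : Type*} (G : SimpleGraph V) (q k i : ℕ) : ℕ :=
  Nat.card {h : V → ColorSet q k // IsProperColoring G i h}

/-- `S` is a feedback vertex set: deleting `S` leaves an acyclic graph. -/
def IsFeedbackVertexSet {V : Type*} (G : SimpleGraph V) (S : Finset V) : Prop :=
  (G.induce {v : V | v ∉ S}).IsAcyclic

/-! ### Random access machines

Programs for a random access machine with registers and an indirectly addressed memory, all holding
natural numbers, written in structured form.  Time is counted in operations on machine words of
`w` bits: an instruction that handles numbers occupying several words is charged for a
quadratic-time multi-word operation.  Space is counted in bits. -/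

/-- A memory state of the machine. -/
structure RamState where
  reg : ℕ → ℕ
  mem : ℕ → ℕ

/-- Elementary instructions; `x`, `y`, `z` and `a` are register names. -/
inductive RamInstr where
  /-- `x := c` -/
  | const (x c : ℕ)
  /-- `x := y + z` -/
  | add (x y z : ℕ)
  /-- `x := y - z`, truncated at `0` -/
  | sub (x y z : ℕ)
  /-- `x := y * z` -/
  | mul (x y z : ℕ)
  /-- `x := y / z`, integer quotient, `0` if `z` holds `0` -/
  | div (x y z : ℕ)
  /-- `x := y % z`, remainder, `y` if `z` holds `0` -/
  | mod (x y z : ℕ)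
  /-- `x := mem[a]` -/
  | load (x a : ℕ)
  /-- `mem[a] := y` -/
  | store (a y : ℕ)

/-- Write `m` to the register `x`. -/
def RamState.setReg (σ : RamState) (x m : ℕ) : RamState :=
  { σ with reg := Function.update σ.reg x m }

/-- Write `m` to the memory cell with address `a`. -/
def RamState.setMem (σ : RamState) (a m : ℕ) : RamState :=
  { σ with mem := Function.update σ.mem a m }

/-- The effect of an instruction. -/
def RamInstr.effect : RamInstr → RamState → RamState
  | const x c, σ => σ.setReg x c
  | add x y z, σ => σ.setReg x (σ.reg y + σ.reg z)
  | sub x y z, σ => σ.setReg x (σ.reg y - σ.reg z)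
  | mul x y z, σ => σ.setReg x (σ.reg y * σ.reg z)
  | div x y z, σ => σ.setReg x (σ.reg y / σ.reg z)
  | mod x y z, σ => σ.setReg x (σ.reg y % σ.reg z)
  | load x a, σ => σ.setReg x (σ.mem (σ.reg a))
  | store a y, σ => σ.setMem (σ.reg a) (σ.reg y)

/-- The total bit length of the operands, memory addresses and results of an instruction. -/
def RamInstr.bits : RamInstr → RamState → ℕ
  | const _ c, _ => c.size
  | add _ y z, σ => (σ.reg y).size + (σ.reg z).size + (σ.reg y + σ.reg z).size
  | sub _ y z, σ => (σ.reg y).size + (σ.reg z).size + (σ.reg y - σ.reg z).size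
  | mul _ y z, σ => (σ.reg y).size + (σ.reg z).size + (σ.reg y * σ.reg z).size
  | div _ y z, σ => (σ.reg y).size + (σ.reg z).size + (σ.reg y / σ.reg z).size
  | mod _ y z, σ => (σ.reg y).size + (σ.reg z).size + (σ.reg y % σ.reg z).size
  | load _ a, σ => (σ.reg a).size + (σ.mem (σ.reg a)).size
  | store a y, σ => (σ.reg a).size + (σ.reg y).size

/-- The number of `w`-bit word operations charged for handling numbers of `b` bits in total. -/
def wordCost (w b : ℕ) : ℕ := (b / w + 1) ^ 2

/-- The state can be written down with `s` bits: `r` registers and the first `m` memory cells are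
in use (everything else is zero), and each of them, even if it holds zero, is charged one bit more
than the length of its content. -/
def RamState.FitsIn (σ : RamState) (s : ℕ) : Prop :=
  ∃ r m : ℕ, (∀ x, r ≤ x → σ.reg x = 0) ∧ (∀ a, m ≤ a → σ.mem a = 0) ∧
    ∑ x ∈ Finset.range r, ((σ.reg x).size + 1) + ∑ a ∈ Finset.range m, ((σ.mem a).size + 1) ≤ s

/-- Programs. -/
inductive RamProg where
  | instr (I : RamInstr)
  | seq (P Q : RamProg)
  /-- if register `x` is nonzero then `P` else `Q` -/
  | ite (x : ℕ) (P Q : RamProg)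
  /-- while register `x` is nonzero do `P` -/
  | loop (x : ℕ) (P : RamProg)

/-- `Runs w s P σ t τ`: started in the state `σ`, the program `P` halts in the state `τ`, after
exactly `t` operations on `w`-bit words, and every state it goes through, including `σ` and `τ`,
fits in `s` bits. -/
inductive Runs (w s : ℕ) : RamProg → RamState → ℕ → RamState → Prop
  | instr (I : RamInstr) (σ : RamState) (h₀ : σ.FitsIn s) (h₁ : (I.effect σ).FitsIn s) :
      Runs w s (.instr I) σ (wordCost w (I.bits σ)) (I.effect σ)
  | seq {P Q : RamProg} {σ σ' τ : RamState} {t t' : ℕ}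
      (hP : Runs w s P σ t σ') (hQ : Runs w s Q σ' t' τ) :
      Runs w s (.seq P Q) σ (t + t') τ
  | ite_then {x : ℕ} {P Q : RamProg} {σ τ : RamState} {t : ℕ}
      (hx : σ.reg x ≠ 0) (hP : Runs w s P σ t τ) :
      Runs w s (.ite x P Q) σ (wordCost w (σ.reg x).size + t) τ
  | ite_else {x : ℕ} {P Q : RamProg} {σ τ : RamState} {t : ℕ}
      (hx : σ.reg x = 0) (hQ : Runs w s Q σ t τ) :
      Runs w s (.ite x P Q) σ (wordCost w (σ.reg x).size + t) τ
  | loop_done {x : ℕ} {P : RamProg} {σ : RamState} (hx : σ.reg x = 0) (h₀ : σ.FitsIn s) :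
      Runs w s (.loop x P) σ (wordCost w (σ.reg x).size) σ
  | loop_step {x : ℕ} {P : RamProg} {σ σ' τ : RamState} {t t' : ℕ}
      (hx : σ.reg x ≠ 0) (hP : Runs w s P σ t σ') (hL : Runs w s (.loop x P) σ' t' τ) :
      Runs w s (.loop x P) σ (wordCost w (σ.reg x).size + t + t') τ

open Classical in
/-- The input: `q`, `k`, `i` and the number `n` of vertices in the registers `0`, `1`, `2`, `3`, the
adjacency matrix of the graph, row by row, in the memory cells `0, …, n * n - 1`, the indicator of
the set `S` in the cells `n * n, …, n * n + n - 1`, and zeros everywhere else. -/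
noncomputable def countingInput (q k i : ℕ) {n : ℕ} (G : SimpleGraph (Fin n))
    (S : Finset (Fin n)) : RamState where
  reg x := if x = 0 then q else if x = 1 then k else if x = 2 then i else if x = 3 then n else 0
  mem a := if (∃ u v : Fin n, G.Adj u v ∧ a = (u : ℕ) * n + v) ∨ (∃ v ∈ S, a = n * n + (v : ℕ))
    then 1 else 0

/-! Write `B` for the number of color sets and put `M = B ^ n + 1`. A number `x < B ^ |S|`, read in
base `B`, prescribes a coloring of `S`. For each `x` the program counts the proper colorings
extending it, and it adds up the results. There are at most `B ^ n` colorings, so it is enough to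
compute modulo `M`; this keeps all numbers at `O_k(n log q)` bits without any analysis of
intermediate values.

For a fixed `x`, every vertex carries weights on the color sets: on `S` the indicator of the
prescribed one, elsewhere `1`. The wanted number is the sum, over the colorings proper on the set
`A` of active vertices, of the products of the weights (`colorSum`). A vertex `v` of `A` is
eliminated by multiplying the weight of each active neighbor at `c` by the message of `v`, the sum
of its weights over the `c'` compatible with `c`. This preserves the sum as soon as summing over the
color of `v` commutes with the product over its active neighbors (`colorSum_passWeights`), which
happens in two cases: `v` has exactly one active neighbor, or it has some and its weights are
orthogonal idempotents (`IsPinned`). The vertices of `S` are pinned and stay pinned while others are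
eliminated (`IsPinned.mul_message`), so they go first, whatever their degrees. All remaining active
edges lie in a forest, so there is a leaf to eliminate as long as there is an edge
(`exists_card_nbrsIn_eq_one`). Without active edges the sum is a product of sums over single
vertices (`colorSum_of_isolated`).

Passing one message costs `B ^ 2` comparisons of color sets. With `n` rounds over `n` vertices and
`n` possible neighbors each, `O_k(B ^ (|S| + 2) n ^ 3)` instructions suffice, each costing `O_k(n ^
2)` because a number fills `O_k(n)` words. The color sets are listed by testing all `q ^ k` digit
strings, and `q ^ k = O_k(B)`. The `n B` weights dominate the space. The program is verified in a
Hoare logic (`Ends`) that also tracks instruction counts, number sizes and memory. -/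

/-! ### A program logic for the machine -/

/-- Resource parameters of a run: word length `w`, `40` registers, every number below `2 ^ L`, the
memory cells below `lo` holding bits and never written to, the cells from `hi` on empty. -/
structure RunBounds where
  w : ℕ
  L : ℕ
  lo : ℕ
  hi : ℕ
  two_le : 2 ≤ L
  lo_le : lo ≤ hi

namespace RunBounds

/-- Strict upper bound for all numbers. -/
def U (E : RunBounds) : ℕ := 2 ^ E.L

/-- Space in bits. -/
def space (E : RunBounds) : ℕ := 40 * (E.L + 1) + (2 * E.lo + (E.hi - E.lo) * (E.L + 1))

/-- Upper bound for the charge of one instruction or test. -/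
def unit (E : RunBounds) : ℕ := wordCost E.w (3 * E.L)

/-- The state respects the bounds. -/
structure Within (E : RunBounds) (σ : RamState) : Prop where
  reg_zero : ∀ x, 40 ≤ x → σ.reg x = 0
  reg_lt : ∀ x, σ.reg x < E.U
  mem_le : ∀ a < E.lo, σ.mem a ≤ 1
  mem_lt : ∀ a, σ.mem a < E.U
  mem_zero : ∀ a, E.hi ≤ a → σ.mem a = 0

theorem four_le_U (E : RunBounds) : 4 ≤ E.U := by
  calc 4 = 2 ^ 2 := rfl
    _ ≤ E.U := Nat.pow_le_pow_right (by norm_num) E.two_le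

theorem size_le {E : RunBounds} {m : ℕ} (h : m < E.U) : m.size ≤ E.L := Nat.size_le.2 h

/-- The input cells hold bits and cost at most two bits of space each. Charging all of them `L + 1`
bits would give order `n ^ 3 log q`, too much when there are few color sets. -/
theorem Within.fitsIn {E : RunBounds} {σ : RamState} (h : E.Within σ) : σ.FitsIn E.space := by
  refine ⟨40, E.hi, h.reg_zero, h.mem_zero, ?_⟩
  have h₁ : ∑ x ∈ Finset.range 40, ((σ.reg x).size + 1) ≤ 40 * (E.L + 1) := by
    calc _ ≤ ∑ x ∈ Finset.range 40, (E.L + 1) :=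
          Finset.sum_le_sum fun x _ => Nat.add_le_add_right (size_le (h.reg_lt x)) 1
      _ = _ := by simp
  have h₂ : ∑ a ∈ Finset.range E.lo, ((σ.mem a).size + 1) ≤ 2 * E.lo := by
    calc _ ≤ ∑ x ∈ Finset.range E.lo, 2 := by
          refine Finset.sum_le_sum fun x hx => ?_
          have : (σ.mem x).size ≤ 1 :=
            Nat.size_le.2 (by have := h.mem_le x (Finset.mem_range.1 hx); omega)
          omega
      _ = _ := by simp [mul_comm]
  have h₃ : ∑ a ∈ Finset.Ico E.lo E.hi, ((σ.mem a).size + 1) ≤ (E.hi - E.lo) * (E.L + 1) := by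
    calc _ ≤ ∑ x ∈ Finset.Ico E.lo E.hi, (E.L + 1) :=
          Finset.sum_le_sum fun x _ => Nat.add_le_add_right (size_le (h.mem_lt x)) 1
      _ = _ := by simp
  rw [← Finset.sum_range_add_sum_Ico _ E.lo_le, space]
  omega

theorem wordCost_mono {w a b : ℕ} (h : a ≤ b) : wordCost w a ≤ wordCost w b :=
  Nat.pow_le_pow_left (Nat.add_le_add_right (Nat.div_le_div_right h) 1) 2

theorem test_le {E : RunBounds} {m : ℕ} (h : m < E.U) : wordCost E.w m.size ≤ E.unit :=
  wordCost_mono (by have := size_le h; omega)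

/-- The side conditions under which an instruction respects the bounds. -/
def Legal (E : RunBounds) : RamInstr → RamState → Prop
  | .const x c, _ => x < 40 ∧ c < 4
  | .add x y z, σ => x < 40 ∧ σ.reg y + σ.reg z < E.U
  | .sub x _ _, _ => x < 40
  | .mul x y z, σ => x < 40 ∧ σ.reg y * σ.reg z < E.U
  | .div x _ _, _ => x < 40
  | .mod x _ _, _ => x < 40
  | .load x _, _ => x < 40
  | .store a _, σ => E.lo ≤ σ.reg a ∧ σ.reg a < E.hi

theorem Within.setReg {E : RunBounds} {σ : RamState} (h : E.Within σ) {x m : ℕ} (hx : x < 40)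
    (hm : m < E.U) : E.Within (σ.setReg x m) where
  reg_zero y hy := by
    have : y ≠ x := by omega
    simpa [RamState.setReg, Function.update, this] using h.reg_zero y hy
  reg_lt y := by
    by_cases hy : y = x
    · simpa [RamState.setReg, hy] using hm
    · simpa [RamState.setReg, hy] using h.reg_lt y
  mem_le := h.mem_le
  mem_lt := h.mem_lt
  mem_zero := h.mem_zero

theorem Within.setMem {E : RunBounds} {σ : RamState} (h : E.Within σ) {a m : ℕ} (h₁ : E.lo ≤ a)
    (h₂ : a < E.hi) (hm : m < E.U) : E.Within (σ.setMem a m) where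
  reg_zero := h.reg_zero
  reg_lt := h.reg_lt
  mem_le b hb := by
    have : b ≠ a := by omega
    simpa [RamState.setMem, Function.update, this] using h.mem_le b hb
  mem_lt b := by
    by_cases hb : b = a
    · simpa [RamState.setMem, hb] using hm
    · simpa [RamState.setMem, hb] using h.mem_lt b
  mem_zero b hb := by
    have : b ≠ a := by omega
    simpa [RamState.setMem, Function.update, this] using h.mem_zero b hb

theorem Within.effect {E : RunBounds} {σ : RamState} (h : E.Within σ) {I : RamInstr}
    (hI : E.Legal I σ) : E.Within (I.effect σ) := by
  cases I with
  | const x c => exact h.setReg hI.1 (hI.2.trans_le E.four_le_U)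
  | add x y z => exact h.setReg hI.1 hI.2
  | sub x y z => exact h.setReg hI ((Nat.sub_le _ _).trans_lt (h.reg_lt y))
  | mul x y z => exact h.setReg hI.1 hI.2
  | div x y z => exact h.setReg hI ((Nat.div_le_self _ _).trans_lt (h.reg_lt y))
  | mod x y z => exact h.setReg hI ((Nat.mod_le _ _).trans_lt (h.reg_lt y))
  | load x a => exact h.setReg hI (h.mem_lt _)
  | store a y => exact h.setMem hI.1 hI.2 (h.reg_lt y)

theorem Within.bits_le {E : RunBounds} {σ : RamState} (h : E.Within σ) {I : RamInstr}
    (hI : E.Legal I σ) : wordCost E.w (I.bits σ) ≤ E.unit := by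
  refine wordCost_mono ?_
  have hr := fun x => size_le (h.reg_lt x)
  have hm := fun x => size_le (h.mem_lt x)
  cases I with
  | const x c => have := size_le (hI.2.trans_le E.four_le_U); simp only [RamInstr.bits]; omega
  | add x y z =>
    have := size_le hI.2
    have := hr y; have := hr z; simp only [RamInstr.bits]; omega
  | sub x y z =>
    have := size_le ((Nat.sub_le _ (σ.reg z)).trans_lt (h.reg_lt y))
    have := hr y; have := hr z; simp only [RamInstr.bits]; omega
  | mul x y z =>
    have := size_le hI.2
    have := hr y; have := hr z; simp only [RamInstr.bits]; omega
  | div x y z =>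
    have := size_le ((Nat.div_le_self _ (σ.reg z)).trans_lt (h.reg_lt y))
    have := hr y; have := hr z; simp only [RamInstr.bits]; omega
  | mod x y z =>
    have := size_le ((Nat.mod_le _ (σ.reg z)).trans_lt (h.reg_lt y))
    have := hr y; have := hr z; simp only [RamInstr.bits]; omega
  | load x a => have := hr a; have := hm (σ.reg a); simp only [RamInstr.bits]; omega
  | store a y => have := hr a; have := hr y; simp only [RamInstr.bits]; omega

/-- Started in `σ`, the program halts after at most `N` instructions and tests, within the bounds,
in a state satisfying `Q`. -/
def Ends (E : RunBounds) (P : RamProg) (σ : RamState) (N : ℕ) (Q : RamState → Prop) : Prop :=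
  ∃ t τ, Runs E.w E.space P σ t τ ∧ t ≤ E.unit * N ∧ E.Within τ ∧ Q τ

/-! ### Proof rules for composed programs -/

variable {E : RunBounds} {σ : RamState}

theorem Ends.mono {P : RamProg} {N N' : ℕ} {Q Q' : RamState → Prop} (h : E.Ends P σ N Q)
    (hN : N ≤ N') (hQ : ∀ τ, E.Within τ → Q τ → Q' τ) : E.Ends P σ N' Q' := by
  obtain ⟨t, τ, h₁, h₂, h₃, h₄⟩ := h
  exact ⟨t, τ, h₁, h₂.trans (Nat.mul_le_mul_left _ hN), h₃, hQ τ h₃ h₄⟩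

theorem Ends.seq {P P' : RamProg} {N N' : ℕ} {Q Q' : RamState → Prop} (h : E.Ends P σ N Q)
    (h' : ∀ τ, E.Within τ → Q τ → E.Ends P' τ N' Q') : E.Ends (.seq P P') σ (N + N') Q' := by
  obtain ⟨t, τ, h₁, h₂, h₃, h₄⟩ := h
  obtain ⟨t', τ', h₁', h₂', h₃', h₄'⟩ := h' τ h₃ h₄
  exact ⟨t + t', τ', h₁.seq h₁', by rw [mul_add]; omega, h₃', h₄'⟩

theorem Ends.ite {P P' : RamProg} {x N : ℕ} {Q : RamState → Prop} (hσ : E.Within σ)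
    (h : σ.reg x ≠ 0 → E.Ends P σ N Q) (h' : σ.reg x = 0 → E.Ends P' σ N Q) :
    E.Ends (.ite x P P') σ (N + 1) Q := by
  have ht := test_le (hσ.reg_lt x)
  by_cases hx : σ.reg x = 0
  · obtain ⟨t, τ, h₁, h₂, h₃, h₄⟩ := h' hx
    exact ⟨_, τ, .ite_else hx h₁, by rw [mul_add, mul_one]; omega, h₃, h₄⟩
  · obtain ⟨t, τ, h₁, h₂, h₃, h₄⟩ := h hx
    exact ⟨_, τ, .ite_then hx h₁, by rw [mul_add, mul_one]; omega, h₃, h₄⟩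

theorem Ends.instr {I : RamInstr} {Q : RamState → Prop} (hσ : E.Within σ) (hI : E.Legal I σ)
    (hQ : E.Within (I.effect σ) → Q (I.effect σ)) : E.Ends (.instr I) σ 1 Q :=
  ⟨_, _, .instr I σ hσ.fitsIn (hσ.effect hI).fitsIn, by simpa using hσ.bits_le hI, hσ.effect hI,
    hQ (hσ.effect hI)⟩

/-- Straight-line code. -/
def block (I : RamInstr) : List RamInstr → RamProg
  | [] => .instr I
  | J :: l => .seq (.instr I) (block J l)

/-- The effect of straight-line code. -/
def exec : List RamInstr → RamState → RamState
  | [], σ => σ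
  | I :: l, σ => exec l (I.effect σ)

/-- All instructions of straight-line code respect the bounds. -/
def LegalAll (E : RunBounds) : List RamInstr → RamState → Prop
  | [], _ => True
  | I :: l, σ => E.Legal I σ ∧ E.LegalAll l (I.effect σ)

theorem Ends.block {I : RamInstr} {l : List RamInstr} {Q : RamState → Prop} (hσ : E.Within σ)
    (h : E.LegalAll (I :: l) σ) (hQ : E.Within (exec (I :: l) σ) → Q (exec (I :: l) σ)) :
    E.Ends (block I l) σ (l.length + 1) Q := by
  induction l generalizing I σ with
  | nil => exact Ends.instr hσ h.1 hQ
  | cons J l ih =>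
    have := (Ends.instr (Q := fun τ => τ = I.effect σ) hσ h.1 fun _ => rfl).seq
      (fun τ hτ hQ' => ih (σ := τ) (I := J) hτ (hQ' ▸ h.2) (hQ' ▸ hQ))
    exact this.mono (by simp; omega) fun _ _ h => h

theorem Ends.block_seq {I : RamInstr} {l : List RamInstr} {P : RamProg} {N : ℕ}
    {Q : RamState → Prop} (hσ : E.Within σ) (h : E.LegalAll (I :: l) σ)
    (hP : E.Within (exec (I :: l) σ) → E.Ends P (exec (I :: l) σ) N Q) :
    E.Ends (.seq (RunBounds.block I l) P) σ (l.length + 1 + N) Q :=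
  (Ends.block (Q := fun τ => τ = exec (I :: l) σ) hσ h fun _ => rfl).seq
    fun _ hτ hQ => hQ ▸ hP (hQ ▸ hτ)

/-- Loop rule for a counter running down to zero. -/
theorem Ends.loop {P : RamProg} {x N : ℕ} (Inv : ℕ → RamState → Prop) (m : ℕ)
    (hP : ∀ j < m, ∀ σ, E.Within σ → Inv (j + 1) σ → σ.reg x = j + 1 →
      E.Ends P σ N fun τ => Inv j τ ∧ τ.reg x = j) (hσ : E.Within σ) (h : Inv m σ)
    (hx : σ.reg x = m) :
    E.Ends (.loop x P) σ (m * (N + 1) + 1) fun τ => Inv 0 τ ∧ τ.reg x = 0 := by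
  -- `Inv j` describes the state when `j` rounds are left; most loops below treat indices downwards,
  -- so that `j` separates the untreated from the treated ones.
  induction m generalizing σ with
  | zero =>
    have ht := test_le (hσ.reg_lt x)
    exact ⟨_, σ, .loop_done hx hσ.fitsIn, by simpa using ht, hσ, h, hx⟩
  | succ m ih =>
    have ht := test_le (hσ.reg_lt x)
    obtain ⟨t, τ, h₁, h₂, h₃, h₄, h₅⟩ := hP m (Nat.lt_succ_self m) σ hσ h hx
    obtain ⟨t', τ', h₁', h₂', h₃', h₄'⟩ := ih (fun j hj => hP j (hj.trans (Nat.lt_succ_self m)))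
      h₃ h₄ h₅
    refine ⟨_, τ', .loop_step (by omega) h₁ h₁', ?_, h₃', h₄'⟩
    have : E.unit * ((m + 1) * (N + 1) + 1)
        = E.unit + E.unit * N + E.unit * (m * (N + 1) + 1) := by ring
    omega

end RunBounds

/-! ### Reading after writing, and the frame relation -/

@[simp] theorem RamState.reg_setReg (σ : RamState) (x m y : ℕ) :
    (σ.setReg x m).reg y = if y = x then m else σ.reg y := by
  simp [RamState.setReg, Function.update_apply]

@[simp] theorem RamState.mem_setReg (σ : RamState) (x m : ℕ) : (σ.setReg x m).mem = σ.mem := rfl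

@[simp] theorem RamState.reg_setMem (σ : RamState) (a m : ℕ) : (σ.setMem a m).reg = σ.reg := rfl

@[simp] theorem RamState.mem_setMem (σ : RamState) (a m b : ℕ) :
    (σ.setMem a m).mem b = if b = a then m else σ.mem b := by
  simp [RamState.setMem, Function.update_apply]

/-- The registers below `b` hold the same numbers. -/
def RamState.Agree (b : ℕ) (σ τ : RamState) : Prop := ∀ x < b, τ.reg x = σ.reg x

/-- Registers `0` to `10` are global. In the counting phase the others are assigned by nesting
depth: a subroutine writes only above its arguments, so a single number describes its frame. -/
theorem RamState.Agree.trans {b : ℕ} {σ τ ρ : RamState} (h : σ.Agree b τ) (h' : τ.Agree b ρ) :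
    σ.Agree b ρ := fun x hx => (h' x hx).trans (h x hx)

theorem RamState.Agree.mono {b b' : ℕ} {σ τ : RamState} (h : σ.Agree b τ) (hb : b' ≤ b) :
    σ.Agree b' τ := fun x hx => h x (hx.trans_le hb)

theorem RamState.Agree.refl (b : ℕ) (σ : RamState) : σ.Agree b σ := fun _ _ => rfl

-- With these unfolded, `simp` executes straight-line code symbolically and leaves arithmetic goals.
attribute [simp] RunBounds.exec RunBounds.LegalAll RunBounds.Legal RamInstr.effect

open RamInstr RunBounds

/-! ### The counting program and its configuration -/

/-- The data of a run of the counting program: parameters, the number `B` of color sets, their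
list `tbl` and the content `inp` of the input cells, together with the size bounds. -/
structure CountSetup extends RunBounds where
  q : ℕ
  k : ℕ
  i : ℕ
  n : ℕ
  B : ℕ
  tbl : ℕ → ℕ
  inp : ℕ → ℕ
  lo_eq : lo = n * n + n
  -- Memory layout: the input, `n` flags, `B` codes of color sets, and `n` rows of `B` weights.
  hi_eq : hi = n * n + n + n + B + n * B
  hi_lt : hi + n + 4 < 2 ^ L
  i_lt : i + 4 < 2 ^ L
  q_lt : q + 4 < 2 ^ L
  k_lt : k < 2 ^ L
  pow_lt : q ^ k < 2 ^ L
  -- A product of two numbers up to the modulus has to fit before it is reduced.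
  sq_lt : 4 * ((B ^ n + 1) * (B ^ n + 1)) < 2 ^ L
  inp_le : ∀ a, inp a ≤ 1

namespace CountSetup

/-- The modulus for all computations. -/
def M (X : CountSetup) : ℕ := X.B ^ X.n + 1

/-- Address of the flags of the vertices that have not been eliminated. -/
def flagBase (X : CountSetup) : ℕ := X.n * X.n + X.n

/-- Address of the list of color sets. -/
def tblBase (X : CountSetup) : ℕ := X.n * X.n + X.n + X.n

/-- Address of the weights. -/
def wtBase (X : CountSetup) : ℕ := X.n * X.n + X.n + X.n + X.B

theorem M_pos (X : CountSetup) : 1 ≤ X.M := Nat.le_add_left _ _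

/-- The contents of the global registers and of the constant part of the memory. -/
structure Cfg (X : CountSetup) (σ : RamState) : Prop where
  r0 : σ.reg 0 = X.q
  r1 : σ.reg 1 = X.k
  r2 : σ.reg 2 = X.i
  r3 : σ.reg 3 = X.n
  r4 : σ.reg 4 = 1
  r5 : σ.reg 5 = X.n * X.n + X.n
  r6 : σ.reg 6 = X.n * X.n
  r7 : σ.reg 7 = X.tblBase
  r8 : σ.reg 8 = X.B
  r9 : σ.reg 9 = X.wtBase
  r10 : σ.reg 10 = X.M
  inp : ∀ a < X.n * X.n + X.n, σ.mem a = X.inp a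
  tbl : ∀ j < X.B, σ.mem (X.tblBase + j) = X.tbl j

/-- The cells that may differ are the flags and the weights, the only ones the counting phase writes
to. -/
theorem Cfg.of_agree {X : CountSetup} {σ τ : RamState} (h : X.Cfg σ) (ha : σ.Agree 11 τ)
    (hm : ∀ a, a < X.flagBase ∨ X.tblBase ≤ a ∧ a < X.wtBase → τ.mem a = σ.mem a) : X.Cfg τ where
  r0 := (ha 0 (by norm_num)).trans h.r0
  r1 := (ha 1 (by norm_num)).trans h.r1
  r2 := (ha 2 (by norm_num)).trans h.r2
  r3 := (ha 3 (by norm_num)).trans h.r3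
  r4 := (ha 4 (by norm_num)).trans h.r4
  r5 := (ha 5 (by norm_num)).trans h.r5
  r6 := (ha 6 (by norm_num)).trans h.r6
  r7 := (ha 7 (by norm_num)).trans h.r7
  r8 := (ha 8 (by norm_num)).trans h.r8
  r9 := (ha 9 (by norm_num)).trans h.r9
  r10 := (ha 10 (by norm_num)).trans h.r10
  inp a h' := (hm a (Or.inl h')).trans (h.inp a h')
  tbl j hj := (hm _ (Or.inr ⟨Nat.le_add_right _ _, by simpa [tblBase, wtBase] using hj⟩)).trans
    (h.tbl j hj)

theorem Cfg.of_mem_eq {X : CountSetup} {σ τ : RamState} (h : X.Cfg σ) (ha : σ.Agree 11 τ)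
    (hm : τ.mem = σ.mem) : X.Cfg τ := h.of_agree ha fun a _ => by rw [hm]

end CountSetup

/-! ### Comparing two color sets -/

/-- The number of pairs of equal base `q` digits among the first `k` digits of `x` and `y`. -/
def commonDigits (q k x y : ℕ) : ℕ :=
  ∑ j ∈ Finset.range k, ∑ l ∈ Finset.range k, if x / q ^ j % q = y / q ^ l % q then 1 else 0

/-- Register `27` becomes nonzero if the color sets with the codes in the registers `23` and `26`
share at most `i` colors, and zero otherwise. -/
def compatProg : RamProg :=
  -- Register `4` holds `1`, so division by it copies a register.
  .seq (block (add 27 2 4) [div 28 23 4, div 29 1 4]) <|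
  .loop 29 <|
  .seq (block (sub 29 29 4) [mod 30 28 0, div 28 28 0, div 31 26 4, div 32 1 4]) <|
  .loop 32 <|
  -- With truncated subtraction, `1 - (a - b) - (b - a)` is the indicator of `a = b`.
  block (sub 32 32 4) [mod 33 31 0, div 31 31 0, sub 34 30 33, sub 33 33 30, sub 34 4 34,
    sub 34 34 33, sub 27 27 34]

namespace CountSetup

variable {X : CountSetup} {σ : RamState}

theorem ends_compatProg (hσ : X.Within σ) (hc : X.Cfg σ) :
    X.Ends compatProg σ (20 * (X.k + 1) ^ 2) fun τ => σ.Agree 27 τ ∧ τ.mem = σ.mem ∧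
      τ.reg 27 = X.i + 1 - commonDigits X.q X.k (σ.reg 23) (σ.reg 26) := by
  have r0 := hc.r0; have r1 := hc.r1; have r2 := hc.r2; have r4 := hc.r4
  have hU := X.i_lt
  refine Ends.mono (Ends.block_seq hσ ?_ fun hτ => Ends.loop
    -- Digits are peeled off from the lowest: `k - j` of them have been compared with all digits of
    -- the other code, and each match has lowered the allowance `i + 1` by one, down to zero at
    -- worst.
    (fun j τ => σ.Agree 27 τ ∧ τ.mem = σ.mem ∧ j ≤ X.k ∧ τ.reg 28 = σ.reg 23 / X.q ^ (X.k - j) ∧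
      τ.reg 27 = X.i + 1 - ∑ s ∈ Finset.range (X.k - j), ∑ l ∈ Finset.range X.k,
        if σ.reg 23 / X.q ^ s % X.q = σ.reg 26 / X.q ^ l % X.q then 1 else 0) X.k
    ?_ hτ ?_ ?_) ?_ ?_ (N := _ + (X.k * (5 + (X.k * 9 + 1) + 1) + 1))
  · simp [r2, r4, U]; omega
  · rintro j hj ρ hρ ⟨ha, hm, hjk, h28, h27⟩ h29
    refine Ends.mono (Ends.block_seq hρ ?_ fun hτ => Ends.loop
      (fun l τ => σ.Agree 27 τ ∧ τ.mem = σ.mem ∧ τ.reg 28 = σ.reg 23 / X.q ^ (X.k - j) ∧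
        τ.reg 29 = j ∧ τ.reg 30 = σ.reg 23 / X.q ^ (X.k - (j + 1)) % X.q ∧ l ≤ X.k ∧
        τ.reg 31 = σ.reg 26 / X.q ^ (X.k - l) ∧
        τ.reg 27 = ρ.reg 27 - ∑ l ∈ Finset.range (X.k - l),
          if σ.reg 23 / X.q ^ (X.k - (j + 1)) % X.q = σ.reg 26 / X.q ^ l % X.q then 1 else 0) X.k
      ?_ hτ ?_ ?_) (le_of_eq ?_) ?_ (N := 5 + (X.k * (8 + 1) + 1))
    · simp
    · rintro l hl θ hθ ⟨ga, gm, g28, g29, g30, glk, g31, g27⟩ g32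
      refine Ends.block hθ ?_ ?_
      · simp
      · have e : X.k - l = X.k - (l + 1) + 1 := by omega
        have g0 : θ.reg 0 = X.q := (ga 0 (by norm_num)).trans r0
        have g4 : θ.reg 4 = 1 := (ga 4 (by norm_num)).trans r4
        intro _
        refine ⟨⟨?_, ?_, ?_, ?_, ?_, by omega, ?_, ?_⟩, ?_⟩
        · intro x hx
          have : x ≠ 32 ∧ x ≠ 33 ∧ x ≠ 31 ∧ x ≠ 34 ∧ x ≠ 27 := by omega
          simp [this, ga x hx]
        · simp [gm]
        · simp [g28]
        · simp [g29]
        · simp [g30]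
        · simp [g31, g0, e, pow_succ, Nat.div_div_eq_div_mul]
        · simp only [exec, effect, RamState.reg_setReg]
          simp only [Nat.reduceEqDiff, if_true, if_false, g30, g31, g0, g4, g27]
          rw [e, Finset.sum_range_succ]
          split_ifs with hd <;> omega
        · simp [g32, g4]
    · have h0 : ρ.reg 0 = X.q := (ha 0 (by norm_num)).trans r0
      have h1 : ρ.reg 1 = X.k := (ha 1 (by norm_num)).trans r1
      have h4 : ρ.reg 4 = 1 := (ha 4 (by norm_num)).trans r4
      have h26 : ρ.reg 26 = σ.reg 26 := ha 26 (by norm_num)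
      have e : X.k - j = X.k - (j + 1) + 1 := by omega
      refine ⟨?_, ?_, ?_, ?_, ?_, le_rfl, ?_, ?_⟩
      · intro x hx
        have : x ≠ 28 ∧ x ≠ 29 ∧ x ≠ 30 ∧ x ≠ 31 ∧ x ≠ 32 := by omega
        simp [this, ha x hx]
      · simp [hm]
      · simp [h28, h0, e, pow_succ, Nat.div_div_eq_div_mul]
      · simp [h29, h4]
      · simp [h28, h0]
      · simp [h26, h4]
      · simp
    · have h1 : ρ.reg 1 = X.k := (ha 1 (by norm_num)).trans r1
      have h4 : ρ.reg 4 = 1 := (ha 4 (by norm_num)).trans r4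
      simp [h1, h4]
    · simp
    · rintro τ hτ ⟨⟨ga, gm, g28, g29, g30, -, g31, g27⟩, g32⟩
      have e : X.k - j = X.k - (j + 1) + 1 := by omega
      refine ⟨⟨ga, gm, by omega, g28, ?_⟩, g29⟩
      rw [g27, h27, Nat.sub_sub, e, Finset.sum_range_succ, Nat.sub_zero]
  · refine ⟨?_, ?_, le_rfl, ?_, ?_⟩
    · intro x hx
      have : x ≠ 27 ∧ x ≠ 28 ∧ x ≠ 29 := by omega
      simp [this]
    · simp
    · simp [r4]
    · simp [r4, r2]
  · simp [r1, r4]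
  · simp only [List.length_cons, List.length_nil]; nlinarith
  · rintro τ hτ ⟨⟨ga, gm, -, -, g27⟩, -⟩
    exact ⟨ga, gm, by simpa [commonDigits] using g27⟩

end CountSetup

/-! ### Sending messages along edges -/

/-- Register `24` becomes the sum, modulo register `10`, of the weights in the row with address
`20` over all color sets compatible with the one in register `23`. -/
def messageProg : RamProg :=
  .seq (block (const 24 0) [div 25 8 4]) <|
  .loop 25 <|
  .seq (block (sub 25 25 4) [add 26 7 25, load 26 26]) <|
  .seq compatProg <|
  .ite 27 (block (add 28 20 25) [load 28 28, add 24 24 28, mod 24 24 10]) (.instr (const 28 0))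

/-- Multiply the weights of the vertex in register `18` by the messages from the vertex in
register `14`. -/
def absorbProg : RamProg :=
  .seq (block (mul 20 14 8) [add 20 20 9, mul 21 18 8, add 21 21 9, div 22 8 4]) <|
  .loop 22 <|
  .seq (block (sub 22 22 4) [add 23 7 22, load 23 23]) <|
  .seq messageProg <|
  block (add 28 21 22) [load 29 28, mul 29 29 24, mod 29 29 10, store 28 29]

namespace CountSetup

variable {X : CountSetup} {σ : RamState}

/-- The color sets with the given codes share at most `i` colors. -/
def Compat (X : CountSetup) (x y : ℕ) : Prop := commonDigits X.q X.k x y ≤ X.i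

instance (X : CountSetup) (x y : ℕ) : Decidable (X.Compat x y) :=
  inferInstanceAs (Decidable (_ ≤ _))

/-- The weight of the color set number `c` at the vertex `v`. -/
def wt (X : CountSetup) (σ : RamState) (v c : ℕ) : ZMod X.M :=
  (σ.mem (X.wtBase + v * X.B + c) : ZMod X.M)

/-- The message from the vertex `v` for a neighbor whose color set has code `x`. -/
def message (X : CountSetup) (σ : RamState) (v x : ℕ) : ZMod X.M :=
  ∑ c ∈ Finset.range X.B, if X.Compat x (X.tbl c) then X.wt σ v c else 0

/-- All weights are at most the modulus. -/
def WtLe (X : CountSetup) (σ : RamState) : Prop := ∀ a, X.wtBase ≤ a → σ.mem a ≤ X.M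

theorem row_le (X : CountSetup) {v : ℕ} (hv : v < X.n) : v * X.B + X.B ≤ X.n * X.B := by
  have := Nat.mul_le_mul_right X.B (Nat.succ_le_of_lt hv)
  rwa [Nat.succ_mul] at this

theorem row_disjoint (X : CountSetup) {u v : ℕ} (h : u ≠ v) :
    u * X.B + X.B ≤ v * X.B ∨ v * X.B + X.B ≤ u * X.B := by
  rcases Nat.lt_or_gt_of_ne h with h | h
  · left
    have := Nat.mul_le_mul_right X.B (Nat.succ_le_of_lt h)
    rwa [Nat.succ_mul] at this
  · right
    have := Nat.mul_le_mul_right X.B (Nat.succ_le_of_lt h)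
    rwa [Nat.succ_mul] at this

theorem hi_eq' (X : CountSetup) : X.hi = X.wtBase + X.n * X.B := X.hi_eq

theorem lo_le_wtBase (X : CountSetup) : X.lo ≤ X.wtBase := by
  rw [X.lo_eq, wtBase]; omega

theorem hi_lt_U (X : CountSetup) : X.hi + X.n + 4 < X.U := X.hi_lt

theorem sq_lt_U (X : CountSetup) : 4 * (X.M * X.M) < X.U := X.sq_lt

theorem two_mul_M_lt_U (X : CountSetup) : 4 * X.M < X.U :=
  (Nat.mul_le_mul_left 4 (Nat.le_mul_of_pos_left _ X.M_pos)).trans_lt X.sq_lt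

theorem ends_messageProg (hσ : X.Within σ) (hc : X.Cfg σ) (hw : X.WtLe σ) {v : ℕ}
    (hv : v < X.n) (h20 : σ.reg 20 = X.wtBase + v * X.B) :
    X.Ends messageProg σ (32 * (X.k + 1) ^ 2 * (X.B + 1)) fun τ => σ.Agree 24 τ ∧
      τ.mem = σ.mem ∧ τ.reg 24 ≤ X.M ∧ (τ.reg 24 : ZMod X.M) = X.message σ v (σ.reg 23) := by
  have r4 := hc.r4; have r7 := hc.r7; have r8 := hc.r8; have r10 := hc.r10
  have hrow := X.row_le hv
  have hU := X.hi_lt_U; rw [X.hi_eq'] at hU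
  have hM := X.two_mul_M_lt_U
  have hM1 := X.M_pos
  have htb : X.tblBase + X.B = X.wtBase := rfl
  refine Ends.mono (Ends.block_seq hσ ?_ fun hτ => Ends.loop
    (fun j τ => σ.Agree 24 τ ∧ τ.mem = σ.mem ∧ j ≤ X.B ∧ τ.reg 24 ≤ X.M ∧
      (τ.reg 24 : ZMod X.M) = ∑ c ∈ Finset.Ico j X.B,
        if X.Compat (σ.reg 23) (X.tbl c) then X.wt σ v c else 0) X.B
    ?_ hτ ?_ ?_) ?_ ?_ (N := 2 + (X.B * (3 + (20 * (X.k + 1) ^ 2 + (4 + 1)) + 1) + 1))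
  · simp
  · rintro j hj ρ hρ ⟨ha, hm, hjB, hle, hsum⟩ h25
    have cρ : X.Cfg ρ := hc.of_mem_eq (ha.mono (by norm_num)) hm
    refine Ends.block_seq hρ ?_ fun hθ => ?_
    · simp [cρ.r4, cρ.r7, h25]; omega
    · set θ := exec [sub 25 25 4, add 26 7 25, load 26 26] ρ with hθd
      have ga : ρ.Agree 25 θ := by
        intro x hx
        have : x ≠ 25 ∧ x ≠ 26 := by omega
        simp [hθd, this]
      have gm : θ.mem = ρ.mem := by simp [hθd]
      have g25 : θ.reg 25 = j := by simp [hθd, cρ.r4, h25]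
      have g26 : θ.reg 26 = X.tbl j := by
        simp [hθd, cρ.r4, cρ.r7, h25, cρ.tbl j hj]
      refine Ends.seq (ends_compatProg hθ (cρ.of_mem_eq (ga.mono (by norm_num)) gm)) ?_
      rintro φ hφ ⟨fa, fm, f27⟩
      have fa' : σ.Agree 24 φ := ha.trans ((ga.mono (by norm_num)).trans (fa.mono (by norm_num)))
      have fm' : φ.mem = σ.mem := fm.trans (gm.trans hm)
      have cφ : X.Cfg φ := hc.of_mem_eq (fa'.mono (by norm_num)) fm'
      have f25 : φ.reg 25 = j := (fa 25 (by norm_num)).trans g25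
      have f24 : φ.reg 24 = ρ.reg 24 := (fa 24 (by norm_num)).trans (ga 24 (by norm_num))
      have f20 : φ.reg 20 = X.wtBase + v * X.B := (fa' 20 (by norm_num)).trans h20
      have g23 : θ.reg 23 = σ.reg 23 := (ga 23 (by norm_num)).trans (ha 23 (by norm_num))
      rw [g26, g23] at f27
      have hmem : σ.mem (X.wtBase + v * X.B + j) ≤ X.M := hw _ (by omega)
      have hsplit := Finset.sum_eq_sum_Ico_succ_bot hj
        (fun c => if X.Compat (σ.reg 23) (X.tbl c) then X.wt σ v c else 0)
      refine Ends.ite hφ (fun h => ?_) fun h => ?_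
      · have hcomp : X.Compat (σ.reg 23) (X.tbl j) := by unfold Compat; omega
        refine Ends.block hφ ?_ fun _ => ?_
        · simp [f20, f25, f24, fm']; omega
        · refine ⟨⟨?_, ?_, by omega, ?_, ?_⟩, ?_⟩
          · intro x hx
            have : x ≠ 28 ∧ x ≠ 24 := by omega
            simp [this, fa' x hx]
          · simp [fm']
          · simp [cφ.r10]
            exact (Nat.mod_lt _ hM1).le
          · rw [hsplit, ← hsum, if_pos hcomp]
            simp [cφ.r10, f20, f25, f24, fm', wt, add_comm]
          · simp [f25]
      · have hcomp : ¬ X.Compat (σ.reg 23) (X.tbl j) := by unfold Compat; omega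
        refine Ends.mono (Ends.instr hφ (by simp) fun _ => ?_) (by norm_num) fun _ _ h => h
        refine ⟨⟨?_, ?_, by omega, ?_, ?_⟩, ?_⟩
        · intro x hx
          have : x ≠ 28 ∧ x ≠ 24 := by omega
          simp [this, fa' x hx]
        · simp [fm']
        · simpa [f24] using hle
        · simp [f24, hsplit, hsum, hcomp]
        · simp [f25]
  · refine ⟨?_, ?_, le_rfl, ?_, ?_⟩
    · intro x hx
      have : x ≠ 24 ∧ x ≠ 25 := by omega
      simp [this]
    · simp
    · simp
    · simp
  · simp [r4, r8]
  · have : 1 ≤ (X.k + 1) ^ 2 := Nat.one_le_pow _ _ (Nat.succ_pos _)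
    nlinarith [Nat.mul_le_mul_left X.B this]
  · rintro τ hτ ⟨⟨ga, gm, -, g, g24⟩, -⟩
    exact ⟨ga, gm, g, by rw [g24, message, Finset.range_eq_Ico]⟩

/-- The row of `u` is overwritten while the row of `v` is read. As `u ≠ v`, these are disjoint, so
all messages can be taken in the initial state. -/
theorem ends_absorbProg (hσ : X.Within σ) (hc : X.Cfg σ) (hw : X.WtLe σ) {u v : ℕ}
    (hu : u < X.n) (hv : v < X.n) (huv : u ≠ v) (h14 : σ.reg 14 = v) (h18 : σ.reg 18 = u) :
    X.Ends absorbProg σ (50 * (X.k + 1) ^ 2 * (X.B + 1) ^ 2) fun τ => σ.Agree 20 τ ∧ X.WtLe τ ∧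
      (∀ a, a < X.wtBase + u * X.B ∨ X.wtBase + u * X.B + X.B ≤ a → τ.mem a = σ.mem a) ∧
      ∀ c < X.B, X.wt τ u c = X.wt σ u c * X.message σ v (X.tbl c) := by
  have r4 := hc.r4; have r7 := hc.r7; have r8 := hc.r8; have r9 := hc.r9; have r10 := hc.r10
  have hrow := X.row_le hv
  have hrow' := X.row_le hu
  have hdis := X.row_disjoint huv
  have hhi := X.hi_eq'
  have hlo := X.lo_le_wtBase
  have hU := X.hi_lt_U
  have hM := X.sq_lt_U
  have hM1 := X.M_pos
  have htb : X.tblBase + X.B = X.wtBase := rfl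
  refine Ends.mono (Ends.block_seq hσ ?_ fun hτ => Ends.loop
    (fun j τ => σ.Agree 20 τ ∧ τ.reg 20 = X.wtBase + v * X.B ∧ τ.reg 21 = X.wtBase + u * X.B ∧
      j ≤ X.B ∧ X.WtLe τ ∧
      (∀ a, a < X.wtBase + u * X.B + j ∨ X.wtBase + u * X.B + X.B ≤ a → τ.mem a = σ.mem a) ∧
      ∀ c, j ≤ c → c < X.B → X.wt τ u c = X.wt σ u c * X.message σ v (X.tbl c)) X.B
    ?_ hτ ?_ ?_) ?_ ?_ (N := 5 + (X.B * (3 + (32 * (X.k + 1) ^ 2 * (X.B + 1) + 5) + 1) + 1))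
  · simp [r8, r9, h14, h18]; omega
  · rintro j hj ρ hρ ⟨ha, h20, h21, hjB, hle, hm, hmul⟩ h22
    have cρ : X.Cfg ρ := hc.of_agree (ha.mono (by norm_num)) fun a h => hm a (Or.inl (by
      have : X.flagBase ≤ X.wtBase := by simp [flagBase, wtBase]; omega
      omega))
    refine Ends.block_seq hρ ?_ fun hθ => ?_
    · simp [cρ.r4, cρ.r7, h22]; omega
    · set θ := exec [sub 22 22 4, add 23 7 22, load 23 23] ρ with hθd
      have ga : ρ.Agree 22 θ := by
        intro x hx
        have : x ≠ 22 ∧ x ≠ 23 := by omega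
        simp [hθd, this]
      have gm : θ.mem = ρ.mem := by simp [hθd]
      have g22 : θ.reg 22 = j := by simp [hθd, cρ.r4, h22]
      have g23 : θ.reg 23 = X.tbl j := by
        simp [hθd, cρ.r4, cρ.r7, h22, cρ.tbl j hj]
      refine Ends.seq (ends_messageProg hθ (cρ.of_mem_eq (ga.mono (by norm_num)) gm)
        (fun a h => by rw [gm]; exact hle a h) hv ((ga 20 (by norm_num)).trans h20)) ?_
      rintro φ hφ ⟨fa, fm, f24, f24'⟩
      have fa' : σ.Agree 20 φ := ha.trans ((ga.mono (by norm_num)).trans (fa.mono (by norm_num)))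
      have fm' : φ.mem = ρ.mem := fm.trans gm
      have cφ : X.Cfg φ := cρ.of_mem_eq ((ga.mono (by norm_num)).trans (fa.mono (by norm_num))) fm'
      have f22 : φ.reg 22 = j := (fa 22 (by norm_num)).trans g22
      have f20 : φ.reg 20 = X.wtBase + v * X.B :=
        (fa 20 (by norm_num)).trans ((ga 20 (by norm_num)).trans h20)
      have f21 : φ.reg 21 = X.wtBase + u * X.B :=
        (fa 21 (by norm_num)).trans ((ga 21 (by norm_num)).trans h21)
      have hmsg : X.message θ v (X.tbl j) = X.message σ v (X.tbl j) := by
        refine Finset.sum_congr rfl fun c hc => ?_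
        have := Finset.mem_range.1 hc
        rw [wt, wt, gm, hm _ (by omega)]
      rw [g23, hmsg] at f24'
      have hmem : ρ.mem (X.wtBase + u * X.B + j) ≤ X.M := hle _ (by omega)
      have hmm := Nat.mul_le_mul hmem f24
      have hmod := Nat.mod_lt (ρ.mem (X.wtBase + u * X.B + j) * φ.reg 24) hM1
      refine Ends.block hφ ?_ fun _ => ?_
      · simp [f21, f22, fm']; omega
      · refine ⟨⟨?_, ?_, ?_, by omega, ?_, ?_, ?_⟩, ?_⟩
        · intro x hx
          have : x ≠ 28 ∧ x ≠ 29 := by omega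
          simp [this, fa' x hx]
        · simp [f20]
        · simp [f21]
        · intro a hA
          simp only [exec, effect, RamState.reg_setReg, RamState.mem_setReg, RamState.mem_setMem]
          simp [f21, f22, fm', cφ.r10]
          split_ifs
          · omega
          · exact hle a hA
        · intro a hA
          have : a ≠ X.wtBase + u * X.B + j := by omega
          simp [f21, f22, fm', this, hm a (by omega)]
        · intro c hc₁ hc₂
          simp only [wt]
          rcases Nat.eq_or_lt_of_le hc₁ with rfl | hc₁
          · simp [f21, f22, fm', cφ.r10, f24', hm (X.wtBase + u * X.B + j) (by omega)]
          · have : X.wtBase + u * X.B + c ≠ X.wtBase + u * X.B + j := by omega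
            simpa [f21, f22, fm', this, wt, hc₁.ne'] using hmul c hc₁ hc₂
        · simp [f22]
  · refine ⟨?_, ?_, ?_, le_rfl, ?_, ?_, ?_⟩
    · intro x hx
      have : x ≠ 20 ∧ x ≠ 21 ∧ x ≠ 22 := by omega
      simp [this]
    · simp [h14, r8, r9]; ring
    · simp [h18, r8, r9]; ring
    · simpa [WtLe] using hw
    · simp
    · intro c h h'; omega
  · simp [r4, r8]
  · have h1 : 1 ≤ (X.k + 1) ^ 2 := Nat.one_le_pow _ _ (Nat.succ_pos _)
    generalize (X.k + 1) ^ 2 = K at h1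
    obtain ⟨K, rfl⟩ := Nat.exists_eq_add_of_le h1
    ring_nf
    nlinarith [Nat.zero_le X.B, Nat.zero_le K, Nat.zero_le (K * X.B)]
  · rintro τ hτ ⟨⟨ga, -, -, -, g, gm, gw⟩, -⟩
    exact ⟨ga, g, gm, fun c hc => gw c (Nat.zero_le _) hc⟩

end CountSetup

/-! ### Weighted sums over colorings -/

section ColorSum

open Classical in
/-- The neighbors of `v` in `A`. -/
noncomputable def nbrsIn {V : Type*} (G : SimpleGraph V) (A : Finset V) (v : V) : Finset V :=
  A.filter fun u => G.Adj v u

open Classical in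
/-- The sum over all colorings that are proper on `A` of the products of the weights. -/
noncomputable def colorSum {V C R : Type*} [Fintype V] [DecidableEq V] [Fintype C] [CommRing R]
    (G : SimpleGraph V) (r : C → C → Prop) (A : Finset V) (g : V → C → R) : R :=
  ∑ h : V → C, (∏ v, g v (h v)) * if ∀ u ∈ A, ∀ w ∈ A, G.Adj u w → r (h u) (h w) then 1 else 0

open Classical in
/-- The weights after the elimination of `v`: its neighbors in `A` are multiplied by the messages
from `v`, and `v` itself gets the weights `e`. -/
noncomputable def passWeights {V C R : Type*} [DecidableEq V] [Fintype C] [CommRing R]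
    (G : SimpleGraph V) (r : C → C → Prop) (A : Finset V) (e : C → R) (g : V → C → R) (v : V) :
    V → C → R := fun u c =>
  if u = v then e c
  else if u ∈ nbrsIn G A v then g u c * ∑ c', if r c c' then g v c' else 0
  else g u c

/-- Weights that are a multiple of an indicator by an idempotent. -/
def IsPinned {C R : Type*} [DecidableEq C] [CommRing R] (f : C → R) : Prop :=
  ∀ c c', f c * f c' = if c = c' then f c else 0

variable {V C R : Type*} [Fintype C] [CommRing R] {G : SimpleGraph V}
  {r : C → C → Prop} {A : Finset V} {g : V → C → R} {e : C → R} {v : V}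

theorem mem_nbrsIn {u : V} : u ∈ nbrsIn G A v ↔ u ∈ A ∧ G.Adj v u := by
  simp [nbrsIn]

theorem notMem_nbrsIn_self : v ∉ nbrsIn G A v := fun h => (mem_nbrsIn.1 h).2.ne rfl

/-- Colorings are grouped into classes of those that differ only at `v`. -/
theorem sum_eq_of_sum_update [Fintype V] [DecidableEq V] (v : V) (F F' : (V → C) → R)
    (h : ∀ x : V → C, ∑ c, F (Function.update x v c) = ∑ c, F' (Function.update x v c)) :
    ∑ x, F x = ∑ x, F' x := by
  have key : ∀ F : (V → C) → R, ∑ x, F x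
      = ∑ y : {j // j ≠ v} → C, ∑ c, F ((Equiv.funSplitAt v C).symm (c, y)) := by
    intro F
    rw [← (Equiv.funSplitAt v C).symm.sum_comp, Fintype.sum_prod_type_right]
  rw [key, key]
  refine Finset.sum_congr rfl fun y _ => ?_
  -- A class is written as the updates of one coloring, which requires some value at `v`.
  by_cases hC : Nonempty C
  · obtain ⟨c₀⟩ := hC
    have hu : ∀ c, (Equiv.funSplitAt v C).symm (c, y)
        = Function.update ((Equiv.funSplitAt v C).symm (c₀, y)) v c := by
      intro c
      ext w
      by_cases hw : w = v
      · subst hw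
        rw [Function.update_self]
        exact dif_pos rfl
      · rw [Function.update_of_ne hw]
        have h : ∀ c, (Equiv.funSplitAt v C).symm (c, y) w = y ⟨w, hw⟩ := fun c => dif_neg hw
        rw [h, h]
    have h' : ∀ F : (V → C) → R, ∑ c, F ((Equiv.funSplitAt v C).symm (c, y))
        = ∑ c, F (Function.update ((Equiv.funSplitAt v C).symm (c₀, y)) v c) := fun F =>
      Finset.sum_congr rfl fun c _ => congrArg F (hu c)
    rw [h', h']
    exact h _
  · have : IsEmpty C := not_nonempty_iff.1 hC
    simp

/-- Eliminating a vertex keeps the sum over colorings. -/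
theorem colorSum_passWeights [Fintype V] [DecidableEq V] (hr : ∀ c c', r c c' → r c' c) (hv : v ∈ A)
    (he : ∑ c, e c = 1)
    (hsplit : ∀ a : V → C → R, ∑ c, g v c * ∏ u ∈ nbrsIn G A v, a u c
      = ∏ u ∈ nbrsIn G A v, ∑ c, g v c * a u c) :
    colorSum G r (A.erase v) (passWeights G r A e g v) = colorSum G r A g := by
  classical
  -- With the colors off `v` fixed, both sides share the factor `rest` and the condition `P`. On the
  -- left remain the sum of `e`, which is `1`, and the messages; on the right remains the sum over
  -- the colors of `v` compatible with all its active neighbors.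
  refine sum_eq_of_sum_update v _ _ fun x => ?_
  set N := nbrsIn G A v with hN
  set rest : R := ∏ u ∈ Finset.univ.erase v, g u (x u) with hrest
  set P : Prop := ∀ u ∈ A.erase v, ∀ w ∈ A.erase v, G.Adj u w → r (x u) (x w) with hP
  have hne : ∀ u ∈ N, u ≠ v := fun u hu h => notMem_nbrsIn_self (h ▸ hu)
  have hx : ∀ c, ∀ u ∈ A.erase v, Function.update x v c u = x u := fun c u hu => by
    simp [Finset.ne_of_mem_erase hu]
  have h₁ : ∀ c, (∀ u ∈ A.erase v, ∀ w ∈ A.erase v, G.Adj u w →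
      r (Function.update x v c u) (Function.update x v c w)) ↔ P := fun c =>
    forall₂_congr fun u hu => forall₂_congr fun w hw => by rw [hx c u hu, hx c w hw]
  have h₂ : ∀ c, (∀ u ∈ A, ∀ w ∈ A, G.Adj u w →
      r (Function.update x v c u) (Function.update x v c w)) ↔ (∀ u ∈ N, r (x u) c) ∧ P := by
    intro c
    constructor
    · intro h
      refine ⟨fun u hu => ?_, (h₁ c).1 fun u hu w hw =>
        h u (Finset.mem_of_mem_erase hu) w (Finset.mem_of_mem_erase hw)⟩
      have := h u (mem_nbrsIn.1 hu).1 v hv (mem_nbrsIn.1 hu).2.symm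
      simpa [hne u hu] using this
    · rintro ⟨h, h'⟩ u hu w hw huw
      by_cases huv : u = v
      · subst huv
        have hwN : w ∈ N := mem_nbrsIn.2 ⟨hw, huw⟩
        simpa [hne w hwN] using hr _ _ (h w hwN)
      · by_cases hwv : w = v
        · subst hwv
          have huN : u ∈ N := mem_nbrsIn.2 ⟨hu, huw.symm⟩
          simpa [huv] using h u huN
        · simpa [huv, hwv] using h' u (by simp [huv, hu]) w (by simp [hwv, hw]) huw
  have h₃ : ∀ c, ∏ u, passWeights G r A e g v u (Function.update x v c u)
      = e c * (rest * ∏ u ∈ N, ∑ c', if r (x u) c' then g v c' else 0) := by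
    intro c
    rw [← Finset.mul_prod_erase _ _ (Finset.mem_univ v)]
    congr 1
    · simp [passWeights]
    · have hsub : N ⊆ Finset.univ.erase v := fun u hu => by simp [hne u hu]
      have h : ∏ u ∈ N, ∑ c', (if r (x u) c' then g v c' else 0)
          = ∏ u ∈ Finset.univ.erase v,
            if u ∈ N then ∑ c', (if r (x u) c' then g v c' else 0) else 1 := by
        rw [Finset.prod_ite_mem, Finset.inter_eq_right.2 hsub]
      rw [hrest, h, ← Finset.prod_mul_distrib]
      refine Finset.prod_congr rfl fun u hu => ?_
      have hu' : u ≠ v := Finset.ne_of_mem_erase hu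
      by_cases huN : u ∈ N
      · simp [passWeights, hu', huN, ← hN]
      · simp [passWeights, hu', huN, ← hN]
  have h₄ : ∀ c, ∏ u, g u (Function.update x v c u) = g v c * rest := by
    intro c
    rw [← Finset.mul_prod_erase _ _ (Finset.mem_univ v)]
    congr 1
    · simp
    · refine Finset.prod_congr rfl fun u hu => ?_
      simp [Finset.ne_of_mem_erase hu]
  -- This is `hsplit` for the compatibility indicators, whose product is the indicator of joint
  -- compatibility.
  have h₅ : ∑ c, g v c * (if ∀ u ∈ N, r (x u) c then 1 else 0)
      = ∏ u ∈ N, ∑ c', if r (x u) c' then g v c' else 0 := by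
    have := hsplit fun u c => if r (x u) c then 1 else 0
    simpa only [Finset.prod_boole, mul_ite, mul_one, mul_zero] using this
  simp_rw [h₁, h₂, h₃, h₄]
  rw [← Finset.sum_mul, ← Finset.sum_mul, he, one_mul, ← h₅]
  by_cases hPx : P
  · simp only [hPx, and_true, if_true, mul_one]
    rw [Finset.mul_sum]
    exact Finset.sum_congr rfl fun c _ => by ring
  · simp [hPx]

theorem colorSum_of_isolated [Fintype V] [DecidableEq V] (hA : ∀ u ∈ A, nbrsIn G A u = ∅) :
    colorSum G r A g = ∏ v, ∑ c, g v c := by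
  classical
  rw [Finset.prod_univ_sum, colorSum, Fintype.piFinset_univ]
  refine Finset.sum_congr rfl fun h _ => ?_
  rw [if_pos, mul_one]
  intro u hu w hw huw
  have : w ∈ nbrsIn G A u := mem_nbrsIn.2 ⟨hw, huw⟩
  rw [hA u hu] at this
  simp at this

/-! ### The two cases in which elimination is exact -/

theorem sum_mul_prod_of_card_eq_one {N : Finset V} (hN : N.card = 1) (f : C → R) (a : V → C → R) :
    ∑ c, f c * ∏ u ∈ N, a u c = ∏ u ∈ N, ∑ c, f c * a u c := by
  obtain ⟨u, rfl⟩ := Finset.card_eq_one.1 hN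
  simp

/-- The values of `f` are orthogonal idempotents, so only the diagonal of the double sum survives.
-/
theorem IsPinned.sum_mul_sum [DecidableEq C] {f : C → R} (hf : IsPinned f) (a b : C → R) :
    (∑ c, f c * a c) * ∑ c, f c * b c = ∑ c, f c * (a c * b c) := by
  rw [Finset.sum_mul_sum]
  refine Finset.sum_congr rfl fun c _ => ?_
  have : ∀ c', f c * a c * (f c' * b c') = if c = c' then f c * a c * b c' else 0 := by
    intro c'
    have := hf c c'
    split_ifs at this ⊢ with h
    · linear_combination (a c * b c') * this
    · linear_combination (a c * b c') * this
  simp_rw [this]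
  simp [mul_assoc]

/-- For empty `N` the claim would be that `f` sums to `1`, which fails in general. This is why
vertices without active neighbors are never eliminated. -/
theorem IsPinned.sum_mul_prod [DecidableEq C] [DecidableEq V] {f : C → R} (hf : IsPinned f)
    {N : Finset V} (hN : N.Nonempty) (a : V → C → R) :
    ∑ c, f c * ∏ u ∈ N, a u c = ∏ u ∈ N, ∑ c, f c * a u c := by
  induction hN using Finset.Nonempty.cons_induction with
  | singleton u => simp
  | cons u s hu hs ih => 
    rw [Finset.prod_cons, ← ih, hf.sum_mul_sum]
    simp_rw [Finset.prod_cons]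

/-- Edges inside the feedback vertex set make a pinned vertex absorb messages of other pinned
vertices before its own turn. Such a message is idempotent by `sum_mul_sum`, so the values of the
product are again orthogonal idempotents. -/
theorem IsPinned.mul_message [DecidableEq C] {f f' : C → R} (hf : IsPinned f) (hf' : IsPinned f')
    (r : C → C → Prop) [∀ c c', Decidable (r c c')] :
    IsPinned fun c => f c * ∑ c', if r c c' then f' c' else 0 := by
  intro c c'
  have h₁ : ∀ c, (∑ c', if r c c' then f' c' else 0) = ∑ c', f' c' * if r c c' then 1 else 0 :=
    fun c => Finset.sum_congr rfl fun c' _ => by split_ifs <;> simp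
  simp only [h₁]
  have := hf c c'
  split_ifs at this ⊢ with h
  · subst h
    have h₂ := hf'.sum_mul_sum (fun c' => if r c c' then 1 else 0) fun c' => if r c c' then 1 else 0
    simp only [mul_ite, mul_one, mul_zero] at h₂ ⊢
    have h₃ : ∀ c', (if r c c' then if r c c' then f' c' else 0 else 0)
      = if r c c' then f' c' else 0 := fun c' => by split_ifs <;> rfl
    simp only [h₃] at h₂
    linear_combination f c * f c * h₂ + (∑ c', if r c c' then f' c' else 0) * this
  · linear_combination this * ((∑ c', f' c' * if r c c' then 1 else 0) *
      ∑ c'', f' c'' * if r c' c'' then 1 else 0)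

end ColorSum

/-! ### Leaves of acyclic graphs -/

/-- The component of an edge is a nontrivial tree, hence has a vertex of degree one, and all
neighbors of that vertex lie in the component. -/
theorem SimpleGraph.IsAcyclic.exists_unique_adj {V : Type*} [Finite V] {G : SimpleGraph V}
    (hG : G.IsAcyclic) {a b : V} (hab : G.Adj a b) : ∃ v w, G.Adj v w ∧ ∀ u, G.Adj v u → u = w := by
  classical
  have := Fintype.ofFinite V
  set c := G.connectedComponentMk a with hc
  have hT := hG.isTree_connectedComponent c
  have ha : a ∈ c.supp := by simp [hc]
  have hb : b ∈ c.supp := by simpa [hc] using hab.reachable.symm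
  have : Nontrivial c := ⟨⟨⟨a, ha⟩, ⟨b, hb⟩, fun h => hab.ne (congrArg Subtype.val h)⟩⟩
  obtain ⟨⟨v, hv⟩, hdeg⟩ := hT.exists_vert_degree_one_of_nontrivial
  obtain ⟨⟨w, hw⟩, hvw, huniq⟩ := SimpleGraph.degree_eq_one_iff_existsUnique_adj.1 hdeg
  refine ⟨v, w, hvw, fun u hu => ?_⟩
  have hus : u ∈ c.supp := by
    have h := (SimpleGraph.ConnectedComponent.mem_supp_iff _ _).1 hv
    rw [SimpleGraph.ConnectedComponent.mem_supp_iff, ← h]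
    simpa using hu.reachable.symm
  exact congrArg Subtype.val (huniq ⟨u, hus⟩ hu)

/-- Some vertex has exactly one neighbor in `A`, unless there are no edges within `A`. -/
theorem exists_card_nbrsIn_eq_one {V : Type*} [Fintype V] {G : SimpleGraph V} {S A : Finset V}
    (hS : IsFeedbackVertexSet G S) (hSA : ∀ v ∈ S, v ∈ A → nbrsIn G A v = ∅)
    (hA : ∃ u ∈ A, nbrsIn G A u ≠ ∅) : ∃ v ∈ A, (nbrsIn G A v).card = 1 := by
  obtain ⟨a, ha, hab⟩ := hA
  obtain ⟨b, hb⟩ := Finset.nonempty_iff_ne_empty.2 hab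
  obtain ⟨hbA, hab'⟩ := mem_nbrsIn.1 hb
  -- Active vertices of `S` are isolated within `A`, so active edges avoid `S`.
  have hS' : ∀ u ∈ A, ∀ w ∈ A, G.Adj u w → u ∉ S := fun u hu w hw huw h => by
    have : w ∈ nbrsIn G A u := mem_nbrsIn.2 ⟨hw, huw⟩
    rw [hSA u h hu] at this
    simp at this
  -- The active edges form a subgraph of the forest, and a leaf of it is the vertex looked for.
  let H : SimpleGraph {v : V | v ∉ S} :=
    { Adj := fun u w => G.Adj u w ∧ (u : V) ∈ A ∧ (w : V) ∈ A
      symm := ⟨fun u w h => ⟨h.1.symm, h.2.2, h.2.1⟩⟩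
      loopless := ⟨fun u h => h.1.ne rfl⟩ }
  have hH : H.IsAcyclic := SimpleGraph.IsAcyclic.anti (fun u w h => h.1) hS
  obtain ⟨v, w, hvw, huniq⟩ := hH.exists_unique_adj (a := ⟨a, hS' a ha b hbA hab'⟩)
    (b := ⟨b, hS' b hbA a ha hab'.symm⟩) ⟨hab', ha, hbA⟩
  refine ⟨v, hvw.2.1, Finset.card_eq_one.2 ⟨w, ?_⟩⟩
  ext u
  rw [mem_nbrsIn, Finset.mem_singleton]
  constructor
  · rintro ⟨huA, hu⟩
    exact congrArg Subtype.val (huniq ⟨u, hS' u huA v hvw.2.1 hu.symm⟩ ⟨hu, hvw.2.1, huA⟩)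
  · rintro rfl
    exact ⟨hvw.2.2, hvw.1⟩

/-! ### Eliminating a vertex -/

/-- Eliminate the vertex in register `14` if it is active and has fewer active neighbors than
register `15` says. -/
def elimProg : RamProg :=
  .seq (block (mul 16 14 3) [const 17 0, div 18 3 4]) <|
  .seq (.loop 18 <|
    block (sub 18 18 4) [add 19 16 18, load 19 19, add 20 5 18, load 20 20, mul 19 19 20,
      add 17 17 19]) <|
  -- Flag times truncated (threshold minus degree): nonzero exactly for an active vertex of degree
  -- below the threshold.
  .seq (block (add 19 5 14) [load 19 19, sub 20 15 17, mul 19 19 20, div 18 3 4]) <|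
  .ite 19
    (.seq
      (.loop 18 <|
        .seq (block (sub 18 18 4) [add 19 16 18, load 19 19, add 20 5 18, load 20 20,
          mul 19 19 20]) <|
        .ite 19 absorbProg (.instr (const 20 0)))
      -- The new flag is `1` minus the degree, truncated, so a vertex without active neighbors
      -- passes the test but stays active.
      (block (sub 20 4 17) [add 19 5 14, store 19 20]))
    (.instr (const 20 0))

namespace CountSetup

variable {X : CountSetup} {σ : RamState}

/-- The input cells hold the adjacency matrix of `G`. -/
def IsInput (X : CountSetup) (G : SimpleGraph (Fin X.n)) : Prop :=
  ∀ u v : Fin X.n, (X.inp (u * X.n + v) = 1 ↔ G.Adj u v)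

/-- The memory holds the flags of the vertices in `A` and their weights `g`. -/
structure Rep (X : CountSetup) (A : Finset (Fin X.n)) (g : Fin X.n → Fin X.B → ZMod X.M)
    (σ : RamState) : Prop where
  flag : ∀ u : Fin X.n, σ.mem (X.flagBase + u) = if u ∈ A then 1 else 0
  wt : ∀ u ∈ A, ∀ c : Fin X.B, X.wt σ u c = g u c
  le : X.WtLe σ

/-- Compatibility of color sets given by their numbers. -/
def Rel (X : CountSetup) (c c' : Fin X.B) : Prop := X.Compat (X.tbl c) (X.tbl c')

open Classical in
theorem message_eq (v : ℕ) (x : ℕ) : X.message σ v x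
    = ∑ c : Fin X.B, if X.Compat x (X.tbl c) then X.wt σ v c else 0 := by
  rw [message,
    ← Fin.sum_univ_eq_sum_range (fun c => if X.Compat x (X.tbl c) then X.wt σ v c else 0)]

/-- Stated with an arbitrary continuation `P` because sequential composition is nested to the right.
-/
theorem ends_degree {N D v : ℕ} (hσ : X.Within σ) (hc : X.Cfg σ) (hv : v < X.n)
    (h14 : σ.reg 14 = v) (hf : ∀ u < X.n, σ.mem (X.flagBase + u) ≤ 1)
    (hD : D = ∑ u ∈ Finset.range X.n, X.inp (v * X.n + u) * σ.mem (X.flagBase + u))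
    {P : RamProg} {Q : RamState → Prop}
    (hP : ∀ τ, X.Within τ → X.Cfg τ → σ.Agree 16 τ → τ.mem = σ.mem → τ.reg 16 = v * X.n →
      τ.reg 17 = D → X.Ends P τ N Q) :
    X.Ends (.seq (block (mul 16 14 3) [const 17 0, div 18 3 4]) <|
      .seq (.loop 18 <|
        block (sub 18 18 4) [add 19 16 18, load 19 19, add 20 5 18, load 20 20, mul 19 19 20,
          add 17 17 19]) P) σ (8 * X.n + 4 + N) Q := by
  have hU := X.hi_lt_U; rw [X.hi_eq] at hU
  have hvn : v * X.n + X.n ≤ X.n * X.n := by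
    have := Nat.mul_le_mul_right X.n (Nat.succ_le_of_lt hv)
    rwa [Nat.succ_mul] at this
  refine Ends.mono (Ends.block_seq hσ ?_ fun hτ => Ends.seq (Ends.loop
    (fun j τ => σ.Agree 16 τ ∧ τ.mem = σ.mem ∧ τ.reg 16 = v * X.n ∧ j ≤ X.n ∧
      τ.reg 17 = ∑ u ∈ Finset.Ico j X.n, X.inp (v * X.n + u) * σ.mem (X.flagBase + u)) X.n
    ?_ hτ ?_ ?_) ?_) ?_ (fun _ _ h => h) (N := 3 + ((X.n * (7 + 1) + 1) + N))
  · simp [hc.r3, h14]; omega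
  · rintro j hj ρ hρ ⟨ha, hm, h16, hjn, h17⟩ h18
    have cρ : X.Cfg ρ := hc.of_mem_eq (ha.mono (by norm_num)) hm
    have hin : σ.mem (v * X.n + j) = X.inp (v * X.n + j) := hc.inp _ (by omega)
    have hprod : X.inp (v * X.n + j) * σ.mem (X.flagBase + j) ≤ 1 :=
      Nat.mul_le_mul (X.inp_le _) (hf j hj)
    have hsum : ∑ u ∈ Finset.Ico (j + 1) X.n, X.inp (v * X.n + u) * σ.mem (X.flagBase + u)
        ≤ X.n := by
      calc _ ≤ ∑ u ∈ Finset.Ico (j + 1) X.n, 1 := Finset.sum_le_sum fun u hu =>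
            Nat.mul_le_mul (X.inp_le _) (hf u (Finset.mem_Ico.1 hu).2)
        _ ≤ X.n := by simp
    have hfb : X.flagBase = X.n * X.n + X.n := rfl
    refine Ends.block hρ ?_ fun _ => ⟨⟨?_, ?_, ?_, by omega, ?_⟩, ?_⟩
    · simp [cρ.r4, cρ.r5, h16, h17, h18, hm, hin, ← hfb]; omega
    · intro x hx
      have : x ≠ 17 ∧ x ≠ 18 ∧ x ≠ 19 ∧ x ≠ 20 := by omega
      simp [this, ha x hx]
    · simp [hm]
    · simp [h16]
    · rw [Finset.sum_eq_sum_Ico_succ_bot hj, ← h17, ← hin, add_comm (σ.mem _ * _)]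
      simp [cρ.r4, cρ.r5, h16, h18, hm, ← hfb]
    · simp [h18, cρ.r4]
  · refine ⟨?_, ?_, ?_, le_rfl, ?_⟩
    · intro x hx
      have : x ≠ 16 ∧ x ≠ 17 ∧ x ≠ 18 := by omega
      simp [this]
    · simp
    · simp [h14, hc.r3]
    · simp
  · simp [hc.r3, hc.r4]
  · rintro τ hτ ⟨⟨ha, hm, h16, -, h17⟩, -⟩
    exact hP τ hτ (hc.of_mem_eq (ha.mono (by norm_num)) hm) ha hm h16
      (by rw [h17, hD, Finset.range_eq_Ico])
  · omega

-- No vertex is its own neighbor, so the row of `v` never changes and the messages to all neighbors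
-- come from the initial weights.
open Classical in
theorem ends_absorbLoop {G : SimpleGraph (Fin X.n)} {A : Finset (Fin X.n)}
    {v : Fin X.n} (hσ : X.Within σ) (hc : X.Cfg σ) (hin : X.IsInput G)
    (hf : ∀ u : Fin X.n, σ.mem (X.flagBase + u) = if u ∈ A then 1 else 0) (hw : X.WtLe σ)
    (h14 : σ.reg 14 = v) (h16 : σ.reg 16 = v * X.n) (h18 : σ.reg 18 = X.n) :
    X.Ends (.loop 18 <|
        .seq (block (sub 18 18 4) [add 19 16 18, load 19 19, add 20 5 18, load 20 20,
          mul 19 19 20]) <|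
        .ite 19 absorbProg (.instr (const 20 0))) σ
      (X.n * (8 + 50 * (X.k + 1) ^ 2 * (X.B + 1) ^ 2) + 1)
      fun τ => σ.Agree 18 τ ∧ X.WtLe τ ∧ (∀ a < X.wtBase, τ.mem a = σ.mem a) ∧
        ∀ u : Fin X.n, ∀ c < X.B, X.wt τ u c = if u ∈ nbrsIn G A v then
          X.wt σ u c * X.message σ v (X.tbl c) else X.wt σ u c := by
  have hU := X.hi_lt_U; rw [X.hi_eq] at hU
  have hvn : v * X.n + X.n ≤ X.n * X.n := by
    have := Nat.mul_le_mul_right X.n (Nat.succ_le_of_lt v.2)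
    rwa [Nat.succ_mul] at this
  have hfb : X.flagBase = X.n * X.n + X.n := rfl
  have hwb : X.flagBase + X.n + X.B = X.wtBase := rfl
  have hvN : v ∉ nbrsIn G A v := notMem_nbrsIn_self
  refine Ends.mono (Ends.loop
    (fun j τ => σ.Agree 18 τ ∧ X.WtLe τ ∧ (∀ a < X.wtBase, τ.mem a = σ.mem a) ∧ j ≤ X.n ∧
        ∀ u : Fin X.n, ∀ c < X.B, X.wt τ u c = if j ≤ (u : ℕ) ∧ u ∈ nbrsIn G A v then
          X.wt σ u c * X.message σ v (X.tbl c) else X.wt σ u c) X.n ?_ hσ ?_ h18) ?_ ?_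
    (N := X.n * (6 + (50 * (X.k + 1) ^ 2 * (X.B + 1) ^ 2 + 1) + 1) + 1)
  · rintro j hj ρ hρ ⟨ha, hle, hm, hjn, hwt⟩ h18
    have cρ : X.Cfg ρ := hc.of_agree (ha.mono (by norm_num)) fun a h => hm a (by omega)
    have g16 : ρ.reg 16 = v * X.n := (ha 16 (by norm_num)).trans h16
    have hm1 : ρ.mem (v * X.n + j) = X.inp (v * X.n + j) := cρ.inp _ (by omega)
    have hm2 : ρ.mem (X.flagBase + j) = if (⟨j, hj⟩ : Fin X.n) ∈ A then 1 else 0 :=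
      (hm _ (by omega)).trans (hf ⟨j, hj⟩)
    have hm1' := X.inp_le (v * X.n + j)
    have hmul : X.inp (v * X.n + j) * (if (⟨j, hj⟩ : Fin X.n) ∈ A then 1 else 0) ≤ 1 := by
      split_ifs <;> simp [hm1']
    refine Ends.block_seq hρ ?_ fun hθ => ?_
    · simp only [LegalAll, Legal, effect, RamState.reg_setReg, RamState.mem_setReg]
      simp [cρ.r4, cρ.r5, g16, h18, hm1, ← hfb, hm2, -mul_ite]; omega
    · set θ := exec [sub 18 18 4, add 19 16 18, load 19 19, add 20 5 18, load 20 20,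
          mul 19 19 20] ρ with hθd
      have ga : ρ.Agree 18 θ := by
        intro x hx
        have : x ≠ 18 ∧ x ≠ 19 ∧ x ≠ 20 := by omega
        simp [hθd, this]
      have gm : θ.mem = ρ.mem := by simp [hθd]
      have g18 : θ.reg 18 = j := by simp [hθd, cρ.r4, h18]
      have g19 : θ.reg 19 = X.inp (v * X.n + j) * (if (⟨j, hj⟩ : Fin X.n) ∈ A then 1 else 0) := by
        simp [hθd, cρ.r4, cρ.r5, g16, h18, hm1, ← hfb, hm2]
      have hiff : θ.reg 19 ≠ 0 ↔ (⟨j, hj⟩ : Fin X.n) ∈ nbrsIn G A v := by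
        rw [mem_nbrsIn, ← hin v ⟨j, hj⟩, g19]
        split_ifs with h
        · simp [h]; omega
        · simp [h]
      have cθ : X.Cfg θ := cρ.of_mem_eq (ga.mono (by norm_num)) gm
      have wθ : ∀ u c, X.wt θ u c = X.wt ρ u c := fun u c => by rw [wt, wt, gm]
      have hwv : ∀ c < X.B, X.wt θ v c = X.wt σ v c := fun c hc => by
        rw [wθ, hwt v c hc, if_neg fun h => hvN h.2]
      refine Ends.ite hθ (fun h => ?_) fun h => ?_
      · have hN := hiff.1 h
        have hjv : j ≠ v := fun h => hvN (by
          have : (⟨j, hj⟩ : Fin X.n) = v := Fin.ext h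
          rwa [this] at hN)
        refine Ends.mono (ends_absorbProg hθ cθ (fun a h => by rw [gm]; exact hle a h) hj v.2 hjv
          (((ha.trans ga) 14 (by norm_num)).trans h14) g18) le_rfl ?_
        rintro φ hφ ⟨fa, fle, fm, fw⟩
        refine ⟨⟨ha.trans (ga.trans (fa.mono (by norm_num))), fle, fun a h => ?_, by omega, ?_⟩,
          (fa 18 (by norm_num)).trans g18⟩
        · rw [fm a (by omega), gm, hm a h]
        · intro u c hc
          have hmsg : X.message θ v (X.tbl c) = X.message σ v (X.tbl c) :=
            Finset.sum_congr rfl fun c' hc' => by rw [hwv c' (Finset.mem_range.1 hc')]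
          by_cases huj : (u : ℕ) = j
          · have huj' : u = ⟨j, hj⟩ := Fin.ext huj
            have h₁ := hwt u c hc
            rw [if_neg (by omega)] at h₁
            rw [if_pos ⟨huj.ge, huj' ▸ hN⟩, ← hmsg, ← h₁, ← wθ]
            rw [huj]
            exact fw c hc
          · have hdis := X.row_disjoint huj
            have : X.wt φ u c = X.wt θ u c := by rw [wt, wt, fm _ (by omega)]
            rw [this, wθ, hwt u c hc]
            refine if_congr (and_congr_left fun _ => ?_) rfl rfl
            omega
      · have hN := mt hiff.2 (not_not.2 h)
        refine Ends.mono (Ends.instr hθ (by simp) fun _ => ?_) (by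
          have : 1 ≤ (X.k + 1) ^ 2 * (X.B + 1) ^ 2 := Nat.one_le_iff_ne_zero.2 (by positivity)
          nlinarith) fun _ _ h => h
        refine ⟨⟨?_, ?_, ?_, by omega, ?_⟩, ?_⟩
        · intro x hx
          have : x ≠ 20 := by omega
          simpa [this] using (ha.trans ga) x hx
        · simpa [WtLe, gm] using hle
        · simpa [gm] using hm
        · intro u c hc
          have : X.wt (effect (const 20 0) θ) u c = X.wt ρ u c := by simp [wt, gm]
          rw [this, hwt u c hc]
          refine if_congr ⟨fun h => ⟨by omega, h.2⟩, fun h => ⟨?_, h.2⟩⟩ rfl rfl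
          have : (u : ℕ) ≠ j := fun huj => hN (by
            have : u = ⟨j, hj⟩ := Fin.ext huj
            rw [← this]; exact h.2)
          omega
        · simp [g18]
  · refine ⟨RamState.Agree.refl _ _, hw, fun _ _ => rfl, le_rfl, fun u c hc => ?_⟩
    rw [if_neg (by have := u.2; omega)]
  · have : 6 + (50 * (X.k + 1) ^ 2 * (X.B + 1) ^ 2 + 1) + 1
        = 8 + 50 * (X.k + 1) ^ 2 * (X.B + 1) ^ 2 := by ring
    rw [this]
  · rintro τ hτ ⟨⟨ha, hle, hm, -, hwt⟩, -⟩
    refine ⟨ha, hle, hm, fun u c hc => ?_⟩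
    simpa using hwt u c hc

-- The weights `e` are arbitrary: they never appear in memory, since `Rep` ignores the rows of
-- eliminated vertices.
open Classical in
theorem ends_elimProg {G : SimpleGraph (Fin X.n)} {A : Finset (Fin X.n)}
    {g : Fin X.n → Fin X.B → ZMod X.M} {v : Fin X.n} (e : Fin X.B → ZMod X.M)
    (hσ : X.Within σ) (hc : X.Cfg σ) (hin : X.IsInput G) (hrep : X.Rep A g σ)
    (h14 : σ.reg 14 = v) :
    X.Ends elimProg σ (80 * ((X.k + 1) ^ 2 * (X.B + 1) ^ 2) * (X.n + 1)) fun τ =>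
      σ.Agree 16 τ ∧ X.Cfg τ ∧
        if v ∈ A ∧ (nbrsIn G A v).card < σ.reg 15 ∧ nbrsIn G A v ≠ ∅ then
          X.Rep (A.erase v) (passWeights G X.Rel A e g v) τ
        else X.Rep A g τ := by
  have hfb : X.flagBase = X.n * X.n + X.n := rfl
  have hwb : X.flagBase + X.n + X.B = X.wtBase := rfl
  have hhi := X.hi_eq'
  have hlo := X.lo_eq
  have hU := X.hi_lt_U
  have hv := v.2
  have hD : (nbrsIn G A v).card
      = ∑ u ∈ Finset.range X.n, X.inp (v * X.n + u) * σ.mem (X.flagBase + u) := by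
    rw [nbrsIn, Finset.card_filter, ← Fin.sum_univ_eq_sum_range
      (fun u => X.inp (v * X.n + u) * σ.mem (X.flagBase + u))]
    rw [← Finset.sum_subset (Finset.subset_univ A)]
    · refine Finset.sum_congr rfl fun u hu => ?_
      have h1 := X.inp_le (v * X.n + u)
      rw [hrep.flag, if_pos hu, mul_one]
      split_ifs with h
      · exact ((hin v u).2 h).symm
      · have := mt (hin v u).1 h
        omega
    · intro u _ hu
      simp [hrep.flag, hu]
  refine Ends.mono (ends_degree hσ hc hv h14
    (fun u hu => by have := hrep.flag ⟨u, hu⟩; simp only at this; rw [this]; split_ifs <;> simp)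
    hD fun ρ hρ cρ ha hm h16 h17 => Ends.block_seq hρ ?_ fun hθ => Ends.ite hθ (fun h => ?_)
      fun h => ?_) ?_ (fun _ _ h => h)
    (N := 8 * X.n + 4 + (5 + (X.n * (8 + 50 * (X.k + 1) ^ 2 * (X.B + 1) ^ 2) + 1 + 3 + 1)))
  · have h15 := hρ.reg_lt 15
    have hf := hrep.flag v
    have hle : σ.mem (X.flagBase + v) * (ρ.reg 15 - ρ.reg 17) ≤ ρ.reg 15 := by
      calc _ ≤ 1 * (ρ.reg 15 - ρ.reg 17) := Nat.mul_le_mul_right _ (by rw [hf]; split_ifs <;> simp)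
        _ ≤ _ := by omega
    have g14 : ρ.reg 14 = v := (ha 14 (by norm_num)).trans h14
    simp [cρ.r5, g14, hm, ← hfb]
    omega
  pick_goal 3
  · have : 1 ≤ (X.k + 1) ^ 2 * (X.B + 1) ^ 2 := Nat.one_le_iff_ne_zero.2 (by positivity)
    generalize hK : (X.k + 1) ^ 2 * (X.B + 1) ^ 2 = K at this
    rw [mul_assoc 50, hK]
    nlinarith [Nat.mul_le_mul_left X.n this]
  all_goals
    set θ := exec [add 19 5 14, load 19 19, sub 20 15 17, mul 19 19 20, div 18 3 4] ρ with hθd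
    have g14 : ρ.reg 14 = v := (ha 14 (by norm_num)).trans h14
    have g15 : ρ.reg 15 = σ.reg 15 := ha 15 (by norm_num)
    have ga : ρ.Agree 18 θ := by
      intro x hx
      have : x ≠ 18 ∧ x ≠ 19 ∧ x ≠ 20 := by omega
      simp [hθd, this]
    have gm : θ.mem = σ.mem := by simp [hθd, hm]
    have g18 : θ.reg 18 = X.n := by simp [hθd, cρ.r3, cρ.r4]
    have g19 : θ.reg 19 = (if v ∈ A then 1 else 0) * (σ.reg 15 - (nbrsIn G A v).card) := by
      simp [hθd, cρ.r5, g14, g15, h17, hm, ← hfb, hrep.flag]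
    have fa : σ.Agree 16 θ := ha.trans (ga.mono (by norm_num))
    have cθ : X.Cfg θ := hc.of_mem_eq (fa.mono (by norm_num)) gm
    rw [g19] at h
  · have hvA : v ∈ A := by by_contra hvA; simp [hvA] at h
    have hcard : (nbrsIn G A v).card < σ.reg 15 := by
      rw [if_pos hvA] at h; omega
    refine Ends.seq (ends_absorbLoop (A := A) (v := v) hθ cθ hin
      (fun u => by rw [gm]; exact hrep.flag u)
      (fun a h => by rw [gm]; exact hrep.le a h) ((ga 14 (by norm_num)).trans g14)
      ((ga 16 (by norm_num)).trans h16) g18) ?_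
    rintro φ hφ ⟨pa, pl, pm, pw⟩
    have fa' : σ.Agree 16 φ := fa.trans (pa.mono (by norm_num))
    have cφ : X.Cfg φ := cθ.of_agree (pa.mono (by norm_num)) fun a h => pm a (by omega)
    have p14 : φ.reg 14 = v := (fa' 14 (by norm_num)).trans h14
    have p17 : φ.reg 17 = (nbrsIn G A v).card :=
      ((pa 17 (by norm_num)).trans (ga 17 (by norm_num))).trans h17
    refine Ends.block hφ ?_ fun _ => ?_
    · simp [cφ.r5, p14]; omega
    · set ψ := exec [sub 20 4 17, add 19 5 14, store 19 20] φ with hψd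
      have qa : φ.Agree 16 ψ := by
        intro x hx
        have : x ≠ 19 ∧ x ≠ 20 := by omega
        simp [hψd, this]
      have qm : ∀ a, ψ.mem a = if a = X.flagBase + v then 1 - (nbrsIn G A v).card
          else φ.mem a := fun a => by
        simp [hψd, cφ.r4, cφ.r5, p14, p17, hfb]
      have qle : X.WtLe ψ := fun a h => by
        rw [qm, if_neg (by omega)]; exact pl a h
      have qwt : ∀ u c, X.wt ψ u c = X.wt φ u c := fun u c => by
        rw [wt, wt, qm, if_neg (by omega)]
      have cψ : X.Cfg ψ := cφ.of_agree (qa.mono (by norm_num)) fun a h => by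
        rw [qm, if_neg]
        have : X.tblBase = X.flagBase + X.n := rfl
        omega
      have qflag : ∀ u : Fin X.n, u ≠ v → ψ.mem (X.flagBase + u) = if u ∈ A then 1 else 0 := by
        intro u huv
        have huv' : (u : ℕ) ≠ v := fun h => huv (Fin.ext h)
        have hu := u.2
        rw [qm, if_neg (by omega), pm _ (by omega), gm, hrep.flag]
      have qv : ψ.mem (X.flagBase + v) = 1 - (nbrsIn G A v).card := by rw [qm, if_pos rfl]
      refine ⟨fa'.trans qa, cψ, ?_⟩
      split_ifs with hcond
      · have hne := hcond.2.2
        refine ⟨fun u => ?_, fun u hu c => ?_, qle⟩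
        · by_cases huv : u = v
          · subst huv
            have := Finset.card_pos.2 (Finset.nonempty_iff_ne_empty.2 hne)
            rw [qv, if_neg (by simp)]; omega
          · rw [qflag u huv]; simp [huv]
        · have huv := Finset.ne_of_mem_erase hu
          have huA := Finset.mem_of_mem_erase hu
          have hwg : ∀ u ∈ A, ∀ c : Fin X.B, X.wt θ u c = g u c := fun u hu c => by
            rw [← hrep.wt u hu c, wt, wt, gm]
          rw [qwt, pw u c c.2, passWeights, if_neg huv, hwg u huA, message_eq]
          refine if_congr Iff.rfl ?_ rfl
          congr 1
          refine Finset.sum_congr rfl fun c' _ => ?_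
          rw [hwg v hvA]
          exact if_congr Iff.rfl rfl rfl
      -- The test was passed with degree zero: no row was touched, and the flag is rewritten as `1`.
      · have hne : nbrsIn G A v = ∅ := by
          by_contra hne
          exact hcond ⟨hvA, hcard, hne⟩
        refine ⟨fun u => ?_, fun u hu c => ?_, qle⟩
        · by_cases huv : u = v
          · subst huv
            rw [qv, if_pos hvA, hne]; rfl
          · exact qflag u huv
        · rw [qwt, pw u c c.2, hne, if_neg (by simp), ← hrep.wt u hu c, wt, wt, gm]
  · refine Ends.mono (Ends.instr hθ (by simp) fun _ => ?_) (by omega) fun _ _ h => h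
    have hcond : ¬ (v ∈ A ∧ (nbrsIn G A v).card < σ.reg 15 ∧ nbrsIn G A v ≠ ∅) := by
      rintro ⟨h₁, h₂, -⟩
      rw [if_pos h₁] at h
      omega
    rw [if_neg hcond]
    refine ⟨?_, cθ.of_mem_eq ?_ rfl, ?_, ?_, ?_⟩
    · intro x hx
      have : x ≠ 20 := by omega
      simpa [this] using fa x hx
    · intro x hx
      have : x ≠ 20 := by omega
      simp [this]
    · simpa [gm] using hrep.flag
    · intro u hu c
      rw [← hrep.wt u hu c]
      simp [wt, gm]
    · simpa [WtLe, gm] using hrep.le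

end CountSetup

/-! ### Eliminating all vertices -/

/-- Eliminate the vertices in the feedback vertex set. -/
def pinPhase : RamProg :=
  .seq (block (div 14 3 4) []) <|
  .loop 14 <|
  -- The threshold is `n + 1`, above every degree, for the vertices in the set, and `0` for all
  -- others.
  .seq (block (sub 14 14 4) [add 15 6 14, load 15 15, add 16 3 4, mul 15 15 16]) elimProg

/-- Eliminate leaves, in as many rounds as there are vertices. -/
def leafPhase : RamProg :=
  .seq (block (div 13 3 4) []) <|
  .loop 13 <|
  .seq (block (sub 13 13 4) [div 14 3 4]) <|
  .loop 14 <|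
  -- With threshold `2`, only vertices with exactly one active neighbor are eliminated.
  .seq (block (sub 14 14 4) [const 15 2]) elimProg

theorem nbrsIn_erase_subset {V : Type*} [DecidableEq V] (G : SimpleGraph V) (A : Finset V)
    (u v : V) : nbrsIn G (A.erase v) u ⊆ nbrsIn G A u := fun w hw => by
  rw [mem_nbrsIn] at hw ⊢
  exact ⟨Finset.mem_of_mem_erase hw.1, hw.2⟩

theorem commonDigits_comm (q k x y : ℕ) : commonDigits q k x y = commonDigits q k y x := by
  rw [commonDigits, Finset.sum_comm]
  exact Finset.sum_congr rfl fun _ _ => Finset.sum_congr rfl fun _ _ => if_congr eq_comm rfl rfl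

namespace CountSetup

variable {X : CountSetup} {σ : RamState} {G : SimpleGraph (Fin X.n)}
  {S : Finset (Fin X.n)}

/-- The vertices in `A` have not been eliminated, their weights are `g`, and the weighted sum over
colorings is `W`. -/
structure State (X : CountSetup) (G : SimpleGraph (Fin X.n)) (W : ZMod X.M)
    (A : Finset (Fin X.n)) (g : Fin X.n → Fin X.B → ZMod X.M) (σ : RamState) : Prop where
  cfg : X.Cfg σ
  rep : X.Rep A g σ
  sum : colorSum G X.Rel A g = W
  unit : ∀ v ∉ A, ∑ c, g v c = 1

theorem State.of_agree {W : ZMod X.M} {A : Finset (Fin X.n)} {g : Fin X.n → Fin X.B → ZMod X.M}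
    {τ : RamState} (h : X.State G W A g σ) (ha : σ.Agree 11 τ) (hm : τ.mem = σ.mem) :
    X.State G W A g τ where
  cfg := h.cfg.of_mem_eq ha hm
  rep := ⟨by simpa [hm] using h.rep.flag, by simpa [CountSetup.wt, hm] using h.rep.wt,
    by simpa [WtLe, hm] using h.rep.le⟩
  sum := h.sum
  unit := h.unit

/-- Without color sets the modulus is `0 ^ n + 1 = 1`, as there is a vertex, and the ring is
trivial. -/
theorem exists_sum_eq_one (X : CountSetup) (v : Fin X.n) :
    ∃ e : Fin X.B → ZMod X.M, ∑ c, e c = 1 := by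
  have hv := v.2
  rcases Nat.eq_zero_or_pos X.B with hB | hB
  · refine ⟨0, ?_⟩
    have hM : X.M = 1 := by rw [M, hB, zero_pow (by omega)]
    have : Subsingleton (ZMod X.M) := by rw [hM]; infer_instance
    exact Subsingleton.elim _ _
  · exact ⟨fun c => if c = ⟨0, hB⟩ then 1 else 0, by simp⟩

/-- Under `hsplit` every elimination is exact, so `W` is preserved. The eliminated vertex gets dummy
weights of sum `1`, which keeps `State.unit`. -/
theorem ends_elimProg_of_state (hin : X.IsInput G) {W : ZMod X.M} {A : Finset (Fin X.n)}
    {g : Fin X.n → Fin X.B → ZMod X.M} {v : Fin X.n} (hσ : X.Within σ) (h : X.State G W A g σ)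
    (h14 : σ.reg 14 = v)
    (hsplit : v ∈ A → (nbrsIn G A v).card < σ.reg 15 → (nbrsIn G A v).Nonempty →
      (nbrsIn G A v).card = 1 ∨ IsPinned (g v)) :
    X.Ends elimProg σ (80 * ((X.k + 1) ^ 2 * (X.B + 1) ^ 2) * (X.n + 1)) fun τ =>
      σ.Agree 16 τ ∧ ∃ A' g', X.State G W A' g' τ ∧
        (A' = A ∧ g' = g ∧ ¬ (v ∈ A ∧ (nbrsIn G A v).card < σ.reg 15 ∧ nbrsIn G A v ≠ ∅) ∨
          v ∈ A ∧ (nbrsIn G A v).card < σ.reg 15 ∧ (nbrsIn G A v).Nonempty ∧ A' = A.erase v ∧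
          ∃ e, g' = passWeights G X.Rel A e g v) := by
  obtain ⟨e, he⟩ := X.exists_sum_eq_one v
  refine (ends_elimProg e hσ h.cfg hin h.rep h14).mono le_rfl ?_
  rintro τ hτ ⟨ha, hc, hrep⟩
  refine ⟨ha, ?_⟩
  split_ifs at hrep with hcond
  · obtain ⟨hvA, hlt, hne⟩ := hcond
    have hne := Finset.nonempty_iff_ne_empty.2 hne
    refine ⟨_, _, ⟨hc, hrep, ?_, ?_⟩, Or.inr ⟨hvA, hlt, hne, rfl, e, rfl⟩⟩
    · rw [← h.sum]
      refine colorSum_passWeights (fun c c' hcc => ?_) hvA he ?_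
      · unfold Rel Compat at hcc ⊢
        rwa [commonDigits_comm]
      · intro a
        rcases hsplit hvA hlt hne with hcard | hpin
        · exact sum_mul_prod_of_card_eq_one hcard _ _
        · exact hpin.sum_mul_prod hne _
    · intro u hu
      by_cases huv : u = v
      · simpa [passWeights, huv] using he
      · have huA : u ∉ A := fun h => hu (by simp [h, huv])
        have : u ∉ nbrsIn G A v := fun h => huA (mem_nbrsIn.1 h).1
        simpa [passWeights, huv, this] using h.unit u huA
  · exact ⟨A, g, ⟨hc, hrep, h.sum, h.unit⟩, Or.inl ⟨rfl, rfl, hcond⟩⟩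

theorem ends_pinPhase (hin : X.IsInput G)
    (hS : ∀ v : Fin X.n, X.inp (X.n * X.n + v) = 1 ↔ v ∈ S) {W : ZMod X.M}
    {g : Fin X.n → Fin X.B → ZMod X.M} (hσ : X.Within σ) (h : X.State G W Finset.univ g σ)
    (hpin : ∀ v ∈ S, IsPinned (g v)) :
    X.Ends pinPhase σ (90 * ((X.k + 1) ^ 2 * (X.B + 1) ^ 2) * (X.n + 1) ^ 2) fun τ =>
      σ.Agree 13 τ ∧ ∃ A g, X.State G W A g τ ∧ ∀ v ∈ S, v ∈ A → nbrsIn G A v = ∅ := by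
  have hU := X.hi_lt_U; rw [X.hi_eq] at hU
  refine Ends.mono (Ends.block_seq hσ (by simp) fun hτ => Ends.loop
    -- Members of `S` from `j` on have had their turn: those still active are isolated, and remain
    -- so as `A` shrinks. The members below `j` are active and pinned.
    (fun j τ => σ.Agree 13 τ ∧ ∃ A g, X.State G W A g τ ∧
      (∀ v ∈ S, j ≤ v.1 → v ∈ A → nbrsIn G A v = ∅) ∧
      ∀ v ∈ S, v.1 < j → v ∈ A ∧ IsPinned (g v)) X.n ?_ hτ ?_ ?_) ?_ ?_
    (N := 1 + (X.n * (5 + 80 * ((X.k + 1) ^ 2 * (X.B + 1) ^ 2) * (X.n + 1) + 1) + 1))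
  · rintro j hj ρ hρ ⟨ha, A, g, hst, hiso, hpin⟩ h14
    have cρ := hst.cfg
    set v : Fin X.n := ⟨j, hj⟩ with hv
    have hins : ρ.mem (X.n * X.n + j) = X.inp (X.n * X.n + j) := cρ.inp _ (by omega)
    have hle := X.inp_le (X.n * X.n + j)
    have hmul : X.inp (X.n * X.n + j) * (X.n + 1) ≤ X.n + 1 := by
      simpa using Nat.mul_le_mul_right (X.n + 1) hle
    refine Ends.block_seq hρ ?_ fun hθ => ?_
    · simp [cρ.r3, cρ.r4, cρ.r6, h14, hins]; omega
    · set θ := exec [sub 14 14 4, add 15 6 14, load 15 15, add 16 3 4, mul 15 15 16] ρ with hθd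
      have ga : ρ.Agree 14 θ := by
        intro x hx
        have : x ≠ 14 ∧ x ≠ 15 ∧ x ≠ 16 := by omega
        simp [hθd, this]
      have gm : θ.mem = ρ.mem := by simp [hθd]
      have g14 : θ.reg 14 = j := by simp [hθd, cρ.r4, h14]
      have g15 : θ.reg 15 = X.inp (X.n * X.n + j) * (X.n + 1) := by
        simp [hθd, cρ.r3, cρ.r4, cρ.r6, h14, hins]
      have hvS : (nbrsIn G A v).card < θ.reg 15 ↔ v ∈ S := by
        have hcard := (nbrsIn G A v).card_le_univ
        rw [Fintype.card_fin] at hcard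
        rw [← hS v, g15]
        have h01 : X.inp (X.n * X.n + j) = 0 ∨ X.inp (X.n * X.n + j) = 1 := by omega
        rcases h01 with h01 | h01 <;> simp [hv, h01] at hcard ⊢
        omega
      refine (ends_elimProg_of_state hin (v := v) hθ (hst.of_agree (ga.mono (by norm_num)) gm) g14
        fun _ hlt _ => Or.inr (hpin v (hvS.1 hlt) (Nat.lt_succ_self j)).2).mono le_rfl ?_
      rintro φ hφ ⟨fa, A', g', hst', hcase⟩
      refine ⟨⟨ha.trans ((ga.mono (by norm_num)).trans (fa.mono (by norm_num))), A', g', hst', ?_⟩,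
        (fa 14 (by norm_num)).trans g14⟩
      rcases hcase with ⟨rfl, rfl, hcond⟩ | ⟨hvA, hlt, hne, rfl, e, rfl⟩
      · refine ⟨fun u hu hju huA => ?_, fun u hu huj => hpin u hu (by omega)⟩
        rcases Nat.eq_or_lt_of_le hju with hju | hju
        · have huv : u = v := Fin.ext hju.symm
          subst huv
          by_contra hne
          exact hcond ⟨huA, hvS.2 hu, hne⟩
        · exact hiso u hu hju huA
      · refine ⟨fun u hu hju huA => ?_, fun u hu huj => ?_⟩
        · have huv := Finset.ne_of_mem_erase huA
          have huj : u.1 ≠ j := fun h => huv (Fin.ext h)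
          have := hiso u hu (by omega) (Finset.mem_of_mem_erase huA)
          exact Finset.subset_empty.1 (this ▸ nbrsIn_erase_subset G A u v)
        · have huv : u ≠ v := fun h => by simp [h, hv] at huj
          obtain ⟨huA, hpu⟩ := hpin u hu (by omega)
          refine ⟨by simp [huv, huA], ?_⟩
          -- A later member of `S` adjacent to `v` absorbs a message from a pinned vertex.
          by_cases huN : u ∈ nbrsIn G A v
          · classical
            have hpv := (hpin v (hvS.1 hlt) (Nat.lt_succ_self j)).2
            have hfun : passWeights G X.Rel A e g v u
              = fun c => g u c * ∑ c', if X.Rel c c' then g v c' else 0 := by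
              funext c
              rw [passWeights, if_neg huv, if_pos huN]
            rw [hfun]
            exact hpu.mul_message hpv X.Rel
          · have hfun : passWeights G X.Rel A e g v u = g u := by
              funext c
              rw [passWeights, if_neg huv, if_neg huN]
            rwa [hfun]
  · have ga : σ.Agree 13 (exec [div 14 3 4] σ) := by
      intro x hx
      have : x ≠ 14 := by omega
      simp [this]
    exact ⟨ga, _, g, h.of_agree (ga.mono (by norm_num)) (by simp),
      fun u _ hu => absurd u.2 (by omega), fun v hv _ => ⟨Finset.mem_univ v, hpin v hv⟩⟩
  · simp [h.cfg.r3, h.cfg.r4]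
  · have : 1 ≤ (X.k + 1) ^ 2 * (X.B + 1) ^ 2 := Nat.one_le_iff_ne_zero.2 (by positivity)
    generalize (X.k + 1) ^ 2 * (X.B + 1) ^ 2 = K at this
    nlinarith [Nat.mul_le_mul_left X.n this, Nat.zero_le (K * X.n * X.n)]
  · rintro τ hτ ⟨⟨ha, A, g, hst, hiso, -⟩, -⟩
    exact ⟨ha, A, g, hst, fun v hv => hiso v hv (Nat.zero_le _)⟩

/-- If edges remain, there is a leaf at the start of the round. Either it is still a leaf at its
turn and is eliminated, or another vertex was eliminated before; in both cases `A` has lost a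
vertex. The third case of the invariant is that this leaf is still waiting. -/
theorem ends_leafRound (hin : X.IsInput G) {W : ZMod X.M} {A : Finset (Fin X.n)} {r : ℕ}
    {g : Fin X.n → Fin X.B → ZMod X.M} (hσ : X.Within σ) (h : X.State G W A g σ)
    (h14 : σ.reg 14 = X.n) (hAr : A.card ≤ r + 1 ∨ ∀ u ∈ A, nbrsIn G A u = ∅)
    (hSA : ∀ v ∈ S, v ∈ A → nbrsIn G A v = ∅) (hS : IsFeedbackVertexSet G S) :
    X.Ends (.loop 14 <| .seq (block (sub 14 14 4) [const 15 2]) elimProg) σ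
      (90 * ((X.k + 1) ^ 2 * (X.B + 1) ^ 2) * (X.n + 1) ^ 2) fun τ => σ.Agree 14 τ ∧
      ∃ A g, X.State G W A g τ ∧ (∀ v ∈ S, v ∈ A → nbrsIn G A v = ∅) ∧
        (A.card ≤ r ∨ ∀ u ∈ A, nbrsIn G A u = ∅) := by
  refine Ends.mono (Ends.loop
    (fun j τ => σ.Agree 14 τ ∧ ∃ A g, X.State G W A g τ ∧
      (∀ v ∈ S, v ∈ A → nbrsIn G A v = ∅) ∧ (A.card ≤ r ∨ (∀ u ∈ A, nbrsIn G A u = ∅) ∨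
        A.card ≤ r + 1 ∧ ∃ v ∈ A, v.1 < j ∧ (nbrsIn G A v).card = 1)) X.n ?_ hσ ?_ h14) ?_ ?_
    (N := X.n * (2 + 80 * ((X.k + 1) ^ 2 * (X.B + 1) ^ 2) * (X.n + 1) + 1) + 1)
  · rintro j hj ρ hρ ⟨ha, A, g, hst, hiso, hcard⟩ h14
    set v : Fin X.n := ⟨j, hj⟩ with hv
    refine Ends.block_seq hρ (by simp) fun hθ => ?_
    set θ := exec [sub 14 14 4, const 15 2] ρ with hθd
    have ga : ρ.Agree 14 θ := by
      intro x hx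
      have : x ≠ 14 ∧ x ≠ 15 := by omega
      simp [hθd, this]
    have gm : θ.mem = ρ.mem := by simp [hθd]
    have g14 : θ.reg 14 = j := by simp [hθd, hst.cfg.r4, h14]
    have g15 : θ.reg 15 = 2 := by simp [hθd]
    refine (ends_elimProg_of_state hin (v := v) hθ (hst.of_agree (ga.mono (by norm_num)) gm) g14
      fun _ hlt hne => Or.inl (by have := Finset.card_pos.2 hne; omega)).mono le_rfl ?_
    rintro φ hφ ⟨fa, A', g', hst', hcase⟩
    refine ⟨⟨ha.trans (ga.trans (fa.mono (by norm_num))), A', g', hst', ?_⟩,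
      (fa 14 (by norm_num)).trans g14⟩
    rcases hcase with ⟨rfl, rfl, hcond⟩ | ⟨hvA, hlt, hne, rfl, e, rfl⟩
    · refine ⟨hiso, hcard.imp_right (Or.imp_right ?_)⟩
      rintro ⟨hr, u, huA, huj, hu1⟩
      refine ⟨hr, u, huA, ?_, hu1⟩
      have : u.1 ≠ j := fun h => hcond (by
        have huv : u = v := Fin.ext h
        rw [← huv, g15]
        exact ⟨huA, by omega, fun h => by simp [h] at hu1⟩)
      omega
    · have hsub : ∀ u, nbrsIn G A u = ∅ → nbrsIn G (A.erase v) u = ∅ := fun u hu =>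
        Finset.subset_empty.1 (hu ▸ nbrsIn_erase_subset G A u v)
      have hc := Finset.card_erase_of_mem hvA
      refine ⟨fun u hu huA => hsub u (hiso u hu (Finset.mem_of_mem_erase huA)), ?_⟩
      rcases hcard with hcard | hcard | hcard
      · left; omega
      · exact absurd (hcard v hvA) hne.ne_empty
      · left; omega
  · refine ⟨RamState.Agree.refl _ _, A, g, h, hSA, ?_⟩
    by_cases hiso : ∀ u ∈ A, nbrsIn G A u = ∅
    · exact Or.inr (Or.inl hiso)
    · obtain ⟨v, hvA, hv⟩ := exists_card_nbrsIn_eq_one hS hSA (by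
        by_contra hcon
        exact hiso fun u hu => by_contra fun h => hcon ⟨u, hu, h⟩)
      exact Or.inr (Or.inr ⟨hAr.resolve_right hiso, v, hvA, v.2, hv⟩)
  · have : 1 ≤ (X.k + 1) ^ 2 * (X.B + 1) ^ 2 := Nat.one_le_iff_ne_zero.2 (by positivity)
    generalize (X.k + 1) ^ 2 * (X.B + 1) ^ 2 = K at this
    nlinarith [Nat.mul_le_mul_left X.n this, Nat.zero_le (K * X.n * X.n)]
  · rintro τ hτ ⟨⟨ha, A, g, hst, hiso, hcase⟩, -⟩
    refine ⟨ha, A, g, hst, hiso, ?_⟩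
    rcases hcase with hcard | hcard | ⟨-, v, -, hv, -⟩
    · exact Or.inl hcard
    · exact Or.inr hcard
    · omega

/-- Each round shrinks `A` unless no active edge is left, so `n` rounds suffice. -/
theorem ends_leafPhase (hin : X.IsInput G) {W : ZMod X.M} {A : Finset (Fin X.n)}
    {g : Fin X.n → Fin X.B → ZMod X.M} (hσ : X.Within σ) (h : X.State G W A g σ)
    (hSA : ∀ v ∈ S, v ∈ A → nbrsIn G A v = ∅) (hS : IsFeedbackVertexSet G S) :
    X.Ends leafPhase σ (100 * ((X.k + 1) ^ 2 * (X.B + 1) ^ 2) * (X.n + 1) ^ 3) fun τ =>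
      σ.Agree 13 τ ∧ ∃ A g, X.State G W A g τ ∧ ∀ u ∈ A, nbrsIn G A u = ∅ := by
  refine Ends.mono (Ends.block_seq hσ (by simp) fun hτ => Ends.loop
    (fun j τ => σ.Agree 13 τ ∧ ∃ A g, X.State G W A g τ ∧ (∀ v ∈ S, v ∈ A → nbrsIn G A v = ∅) ∧
      (A.card ≤ j ∨ ∀ u ∈ A, nbrsIn G A u = ∅)) X.n ?_ hτ ?_ ?_) ?_ ?_
    (N := 1 + (X.n * (2 + 90 * ((X.k + 1) ^ 2 * (X.B + 1) ^ 2) * (X.n + 1) ^ 2 + 1) + 1))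
  · rintro j hj ρ hρ ⟨ha, A, g, hst, hiso, hcard⟩ h13
    refine Ends.block_seq hρ (by simp) fun hθ => ?_
    set θ := exec [sub 13 13 4, div 14 3 4] ρ with hθd
    have ga : ρ.Agree 13 θ := by
      intro x hx
      have : x ≠ 13 ∧ x ≠ 14 := by omega
      simp [hθd, this]
    have gm : θ.mem = ρ.mem := by simp [hθd]
    have g13 : θ.reg 13 = j := by simp [hθd, hst.cfg.r4, h13]
    have g14 : θ.reg 14 = X.n := by simp [hθd, hst.cfg.r3, hst.cfg.r4]
    refine (ends_leafRound hin (r := j) hθ (hst.of_agree (ga.mono (by norm_num)) gm) g14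
      hcard hiso hS).mono le_rfl ?_
    rintro φ hφ ⟨fa, A', g', hst', hiso', hcase⟩
    exact ⟨⟨ha.trans (ga.trans (fa.mono (by norm_num))), A', g', hst', hiso', hcase⟩,
      (fa 13 (by norm_num)).trans g13⟩
  · have ga : σ.Agree 13 (exec [div 13 3 4] σ) := by
      intro x hx
      have : x ≠ 13 := by omega
      simp [this]
    refine ⟨ga, A, g, h.of_agree (ga.mono (by norm_num)) (by simp), hSA, Or.inl ?_⟩
    simpa using A.card_le_univ
  · simp [h.cfg.r3, h.cfg.r4]
  · have : 1 ≤ (X.k + 1) ^ 2 * (X.B + 1) ^ 2 := Nat.one_le_iff_ne_zero.2 (by positivity)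
    generalize (X.k + 1) ^ 2 * (X.B + 1) ^ 2 = K at this
    nlinarith [Nat.mul_le_mul_left X.n this, Nat.zero_le (K * X.n * X.n),
      Nat.zero_le (K * X.n * X.n * X.n)]
  · rintro τ hτ ⟨⟨ha, A, g, hst, hiso, hcase⟩, -⟩
    refine ⟨ha, A, g, hst, ?_⟩
    rcases hcase with hcard | hcard
    · intro u hu
      rw [Finset.card_eq_zero.1 (Nat.le_zero.1 hcard)] at hu
      simp at hu
    · exact hcard

end CountSetup

/-! ### Summing over the colorings of the feedback vertex set -/

/-- Activate all vertices and set their weights, the vertices in the feedback vertex set being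
colored by the digits of the number in register `11`. -/
def initPhase : RamProg :=
  .seq (block (div 13 11 4) [div 14 3 4]) <|
  .loop 14 <|
  -- Vertices are visited in decreasing order, each marked one consuming the lowest remaining digit.
  -- The position of its digit is thus the number of larger marked vertices, as in `pinDigit`.
  .seq (block (sub 14 14 4) [add 15 5 14, store 15 4, add 15 6 14, load 15 15, mod 16 13 8,
    mul 17 14 8, add 17 17 9, div 18 8 4]) <|
  .seq
    (.loop 18 <|
      .seq (block (sub 18 18 4) [add 19 17 18]) <|
      .ite 15 (block (sub 20 16 18) [sub 21 18 16, sub 22 4 20, sub 22 22 21, store 19 22])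
        (.instr (store 19 4)))
    (.ite 15 (.instr (div 13 13 8)) (.instr (const 20 0)))

/-- Register `13` becomes the product, over all active vertices, of the sums of the weights. -/
def productPhase : RamProg :=
  .seq (block (const 13 1) [div 14 3 4]) <|
  .loop 14 <|
  .seq (block (sub 14 14 4) [add 15 5 14, load 15 15, mul 16 14 8, add 16 16 9, const 17 0,
    div 18 8 4]) <|
  .ite 15
    (.seq
      (.loop 18 <|
        block (sub 18 18 4) [add 19 16 18, load 19 19, add 17 17 19, mod 17 17 10])
      (block (mul 13 13 17) [mod 13 13 10]))
    (.instr (const 20 0))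

/-- Add up the weighted sums over colorings for all numbers below the one in register `11`. -/
def countPhase : RamProg :=
  .loop 11 <|
  .seq (.instr (sub 11 11 4)) <|
  .seq initPhase <|
  .seq pinPhase <|
  .seq leafPhase <|
  .seq productPhase <|
  block (add 12 12 13) [mod 12 12 10]

theorem Fin.filter_le_eq_insert {n j : ℕ} (hj : j < n) (S : Finset (Fin n)) :
    S.filter (fun u => j ≤ u.1)
      = if (⟨j, hj⟩ : Fin n) ∈ S then insert ⟨j, hj⟩ (S.filter fun u => j + 1 ≤ u.1)
        else S.filter fun u => j + 1 ≤ u.1 := by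
  ext u
  have : u = ⟨j, hj⟩ ↔ u.1 = j := Fin.ext_iff
  split_ifs with h
  · simp only [Finset.mem_filter, Finset.mem_insert, this]
    constructor
    · rintro ⟨h₁, h₂⟩
      by_cases hu : u.1 = j
      · exact Or.inl hu
      · exact Or.inr ⟨h₁, by omega⟩
    · rintro (hu | ⟨h₁, h₂⟩)
      · exact ⟨by rwa [this.2 hu], hu.ge⟩
      · exact ⟨h₁, by omega⟩
  · simp only [Finset.mem_filter]
    refine and_congr_right fun h₁ => ⟨fun h₂ => ?_, fun h₂ => by omega⟩
    have : u.1 ≠ j := fun hu => h (by rwa [← this.2 hu])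
    omega

/-- The digits of the numbers below `B ^ S.card` run through all functions on `S`. -/
theorem sum_prod_digit_eq_one {V R : Type*} [LinearOrder V] [CommRing R] {B : ℕ} (h : V → Fin B)
    (S : Finset V) : ∑ x ∈ Finset.range (B ^ S.card), ∏ v ∈ S,
      (if (h v : ℕ) = x / B ^ (S.filter (v < ·)).card % B then 1 else 0 : R) = 1 := by
  induction S using Finset.induction_on_max with
  | empty => simp
  | insert a S ha ih =>
    -- A new maximum `a` takes the lowest digit and moves all others up by one place. Writing `x = b
    -- + B * y`, only `b = h a` contributes, and `y` runs through the numbers for `S`.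
    have haS : a ∉ S := fun h => lt_irrefl _ (ha a h)
    have hB : 0 < B := (Nat.zero_le _).trans_lt (h a).2
    have h₁ : (insert a S).filter (a < ·) = ∅ := by
      rw [Finset.filter_eq_empty_iff]
      intro v hv
      rcases Finset.mem_insert.1 hv with rfl | hv
      · exact lt_irrefl _
      · exact (ha v hv).le.not_gt
    have h₂ : ∀ v ∈ S, ((insert a S).filter (v < ·)).card = (S.filter (v < ·)).card + 1 := by
      intro v hv
      rw [Finset.filter_insert, if_pos (ha v hv), Finset.card_insert_of_notMem (by simp [haS])]
    rw [Finset.card_insert_of_notMem haS, pow_succ, Finset.sum_range,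
      ← finProdFinEquiv.sum_comp, Fintype.sum_prod_type]
    refine Eq.trans ?_ ih
    rw [Finset.sum_range]
    refine Finset.sum_congr rfl fun y _ => ?_
    rw [Finset.sum_eq_single (h a)]
    · rw [Finset.prod_insert haS, h₁]
      have hdiv : ((h a : ℕ) + B * y) / B = y := by
        rw [Nat.add_mul_div_left _ _ hB, Nat.div_eq_of_lt (h a).2, zero_add]
      have hmod : ((h a : ℕ) + B * y) % B = h a := by
        rw [Nat.add_mul_mod_self_left, Nat.mod_eq_of_lt (h a).2]
      simp only [finProdFinEquiv_apply_val, Finset.card_empty, pow_zero, Nat.div_one, hmod,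
        eq_self, if_true, one_mul]
      refine Finset.prod_congr rfl fun v hv => ?_
      rw [h₂ v hv, pow_succ', ← Nat.div_div_eq_div_mul, hdiv]
    · intro b _ hb
      rw [Finset.prod_insert haS, h₁]
      have hmod : ((b : ℕ) + B * y) % B = b := by
        rw [Nat.add_mul_mod_self_left, Nat.mod_eq_of_lt b.2]
      have : (h a : ℕ) ≠ b := fun h' => hb (Fin.ext h').symm
      simp [hmod, this]
    · simp

namespace CountSetup

variable {X : CountSetup} {σ : RamState} {G : SimpleGraph (Fin X.n)}
  {S : Finset (Fin X.n)}

/-- The color that the number `x` prescribes for the vertex `v`. -/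
def pinDigit (X : CountSetup) (S : Finset (Fin X.n)) (x : ℕ) (v : Fin X.n) : ℕ :=
  x / X.B ^ (S.filter (v < ·)).card % X.B

/-- The weights that force the vertices in `S` to have the colors prescribed by `x`. -/
def pinWeight (X : CountSetup) (S : Finset (Fin X.n)) (x : ℕ) (v : Fin X.n) (c : ℕ) : ℕ :=
  if v ∈ S then if c = X.pinDigit S x v then 1 else 0 else 1

theorem isPinned_pinWeight (x : ℕ) {v : Fin X.n} (hv : v ∈ S) :
    IsPinned fun c : Fin X.B => (X.pinWeight S x v c : ZMod X.M) := by
  intro c c'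
  simp only [pinWeight, if_pos hv]
  by_cases hcc : c = c'
  · subst hcc
    by_cases h : (c : ℕ) = X.pinDigit S x v <;> simp [h]
  · have : (c : ℕ) ≠ c' := fun h => hcc (Fin.ext h)
    by_cases h : (c : ℕ) = X.pinDigit S x v
    · have h' : (c' : ℕ) ≠ X.pinDigit S x v := fun h' => this (h.trans h'.symm)
      simp [h', hcc]
    · simp [h]

theorem ends_fillRow (hσ : X.Within σ) (hc : X.Cfg σ) {v : Fin X.n} {x : ℕ}
    (h15 : σ.reg 15 ≠ 0 ↔ v ∈ S) (h16 : σ.reg 16 = X.pinDigit S x v)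
    (h17 : σ.reg 17 = X.wtBase + v * X.B) (h18 : σ.reg 18 = X.B) :
    X.Ends (.loop 18 <|
      .seq (block (sub 18 18 4) [add 19 17 18]) <|
      .ite 15 (block (sub 20 16 18) [sub 21 18 16, sub 22 4 20, sub 22 22 21, store 19 22])
        (.instr (store 19 4))) σ (X.B * 9 + 1) fun τ => σ.Agree 18 τ ∧
      (∀ a, a < X.wtBase + v * X.B ∨ X.wtBase + v * X.B + X.B ≤ a → τ.mem a = σ.mem a) ∧
      ∀ c < X.B, τ.mem (X.wtBase + v * X.B + c) = X.pinWeight S x v c := by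
  have hrow := X.row_le v.2
  have hhi := X.hi_eq'
  have hlo := X.lo_le_wtBase
  have hU := X.hi_lt_U
  refine Ends.mono (Ends.loop
    (fun j τ => σ.Agree 18 τ ∧ j ≤ X.B ∧
      (∀ a, a < X.wtBase + v * X.B + j ∨ X.wtBase + v * X.B + X.B ≤ a → τ.mem a = σ.mem a) ∧
      ∀ c, j ≤ c → c < X.B → τ.mem (X.wtBase + v * X.B + c) = X.pinWeight S x v c) X.B
    ?_ hσ ?_ h18) (le_of_eq ?_) ?_ (N := X.B * (2 + (5 + 1) + 1) + 1)
  · rintro j hj ρ hρ ⟨ha, hjB, hm, hw⟩ h18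
    have r4 : ρ.reg 4 = 1 := (ha 4 (by norm_num)).trans hc.r4
    have g17 : ρ.reg 17 = X.wtBase + v * X.B := (ha 17 (by norm_num)).trans h17
    have g16 : ρ.reg 16 = X.pinDigit S x v := (ha 16 (by norm_num)).trans h16
    have g15 : ρ.reg 15 = σ.reg 15 := ha 15 (by norm_num)
    have hnew : ∀ τ : RamState, (∀ a, τ.mem a = if a = X.wtBase + v * X.B + j then
        X.pinWeight S x v j else ρ.mem a) →
        (∀ a, a < X.wtBase + v * X.B + j ∨ X.wtBase + v * X.B + X.B ≤ a → τ.mem a = σ.mem a) ∧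
        ∀ c, j ≤ c → c < X.B → τ.mem (X.wtBase + v * X.B + c) = X.pinWeight S x v c := by
      intro τ hτ
      refine ⟨fun a h => ?_, fun c h h' => ?_⟩
      · rw [hτ, if_neg (by omega), hm a (by omega)]
      · rcases Nat.eq_or_lt_of_le h with rfl | h
        · rw [hτ, if_pos rfl]
        · rw [hτ, if_neg (by omega), hw c h h']
    refine Ends.block_seq hρ ?_ fun hθ => Ends.ite hθ (fun h => ?_) fun h => ?_
    · simp [r4, g17, h18]; omega
    · have hv : v ∈ S := h15.1 (by simpa [g15] using h)
      refine Ends.block hθ ?_ fun _ => ⟨⟨?_, by omega, hnew _ fun a => ?_⟩, ?_⟩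
      · simp [r4, g17, h18]; omega
      · intro x hx
        have : x ≠ 18 ∧ x ≠ 19 ∧ x ≠ 20 ∧ x ≠ 21 ∧ x ≠ 22 := by omega
        simp [this, ha x hx]
      · simp only [pinWeight, if_pos hv]
        simp [r4, g16, g17, h18]
        refine if_congr Iff.rfl ?_ rfl
        split_ifs <;> omega
      · simp [h18, r4]
    · have hv : v ∉ S := fun hv => (h15.2 hv) (by simpa [g15] using h)
      refine Ends.mono (Ends.instr hθ ?_ fun _ => ⟨⟨?_, by omega, hnew _ fun a => ?_⟩, ?_⟩)
        (by norm_num) fun _ _ h => h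
      · simp [r4, g17, h18]; omega
      · intro x hx
        have : x ≠ 18 ∧ x ≠ 19 := by omega
        simp [this, ha x hx]
      · simp [r4, g17, h18, pinWeight, hv]
      · simp [h18, r4]
  · exact ⟨RamState.Agree.refl _ _, le_rfl, fun _ _ => rfl, fun c h h' => by omega⟩
  · ring
  · rintro τ hτ ⟨⟨ha, -, hm, hw⟩, -⟩
    exact ⟨ha, hm, fun c hc => hw c (Nat.zero_le _) hc⟩

theorem ends_initPhase (hS : ∀ v : Fin X.n, X.inp (X.n * X.n + v) = 1 ↔ v ∈ S)
    (hσ : X.Within σ) (hc : X.Cfg σ) (hw : X.WtLe σ) :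
    X.Ends initPhase σ (20 * (X.B + 1) * (X.n + 1)) fun τ => σ.Agree 13 τ ∧
      X.State G (colorSum G X.Rel Finset.univ fun v c => (X.pinWeight S (σ.reg 11) v c : ZMod X.M))
        Finset.univ (fun v c => (X.pinWeight S (σ.reg 11) v c : ZMod X.M)) τ := by
  have hhi := X.hi_eq
  have hlo := X.lo_eq
  have hU := X.hi_lt_U
  have hwb : X.wtBase = X.n * X.n + X.n + X.n + X.B := rfl
  have hfb : X.flagBase = X.n * X.n + X.n := rfl
  have htb : X.tblBase = X.n * X.n + X.n + X.n := rfl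
  refine Ends.mono (Ends.block_seq hσ (by simp) fun hτ => Ends.loop
    (fun j τ => σ.Agree 13 τ ∧ j ≤ X.n ∧
      τ.reg 13 = σ.reg 11 / X.B ^ (S.filter fun u => j ≤ u.1).card ∧ X.WtLe τ ∧
      (∀ a, a < X.flagBase ∨ X.tblBase ≤ a ∧ a < X.wtBase → τ.mem a = σ.mem a) ∧
      ∀ u : Fin X.n, j ≤ u.1 → τ.mem (X.flagBase + u) = 1 ∧
        ∀ c < X.B, τ.mem (X.wtBase + u * X.B + c) = X.pinWeight S (σ.reg 11) u c) X.n
    ?_ hτ ?_ ?_) ?_ ?_ (N := 2 + (X.n * (9 + ((X.B * 9 + 1) + (1 + 1)) + 1) + 1))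
  · rintro j hj ρ hρ ⟨ha, hjn, h13, hle, hm, hw⟩ h14
    set v : Fin X.n := ⟨j, hj⟩ with hv
    have cρ : X.Cfg ρ := hc.of_agree (ha.mono (by norm_num)) hm
    have hrow := X.row_le hj
    have hins : ρ.mem (X.n * X.n + j) = X.inp (X.n * X.n + j) := cρ.inp _ (by omega)
    refine Ends.block_seq hρ ?_ fun hθ => ?_
    · simp [cρ.r4, cρ.r5, cρ.r6, cρ.r8, cρ.r9, h14]; omega
    · set θ := exec [sub 14 14 4, add 15 5 14, store 15 4, add 15 6 14, load 15 15, mod 16 13 8,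
        mul 17 14 8, add 17 17 9, div 18 8 4] ρ with hθd
      have ga : ρ.Agree 14 θ := by
        intro x hx
        have : x ≠ 14 ∧ x ≠ 15 ∧ x ≠ 16 ∧ x ≠ 17 ∧ x ≠ 18 := by omega
        simp [hθd, this]
      have gm : ∀ a, θ.mem a = if a = X.flagBase + j then 1 else ρ.mem a := fun a => by
        simp [hθd, cρ.r4, cρ.r5, h14, hfb]
      have g14 : θ.reg 14 = j := by simp [hθd, cρ.r4, h14]
      have g13 : θ.reg 13 = ρ.reg 13 := ga 13 (by norm_num)
      have g15 : θ.reg 15 = X.inp (X.n * X.n + j) := by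
        -- The flag was stored just before the mark is loaded; their addresses differ by `n`, so
        -- they must be seen to be distinct.
        have : X.n ≠ 0 := by omega
        simp [hθd, cρ.r4, cρ.r5, cρ.r6, h14, hins, this]
      have g15' : θ.reg 15 ≠ 0 ↔ v ∈ S := by
        have := X.inp_le (X.n * X.n + j)
        rw [← hS v, g15, hv]
        simp only
        omega
      have hcθ : X.Cfg θ := cρ.of_agree (ga.mono (by norm_num)) fun a h => by
        rw [gm, if_neg (by omega)]
      refine Ends.seq (ends_fillRow (S := S) (v := v) (x := σ.reg 11) hθ hcθ g15' ?_ ?_ ?_) ?_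
      · simp only [hθd]
        simp [cρ.r4, cρ.r8, h13, pinDigit]
        rfl
      · simp [hθd, cρ.r4, cρ.r8, cρ.r9, h14, hv, add_comm]
      · simp [hθd, cρ.r4, cρ.r8]
      · rintro φ hφ ⟨fa, fm, fw⟩
        have fa' : ρ.Agree 14 φ := ga.trans (fa.mono (by norm_num))
        have f13 : φ.reg 13 = ρ.reg 13 := fa' 13 (by norm_num)
        have f8 : φ.reg 8 = X.B := (fa' 8 (by norm_num)).trans cρ.r8
        have f14 : φ.reg 14 = j := (fa 14 (by norm_num)).trans g14
        have f15 : φ.reg 15 = θ.reg 15 := fa 15 (by norm_num)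
        have fle : X.WtLe φ := fun a h => by
          by_cases h' : a < X.wtBase + v * X.B ∨ X.wtBase + v * X.B + X.B ≤ a
          · rw [fm a h', gm, if_neg (by omega)]; exact hle a h
          · obtain ⟨c, rfl⟩ : ∃ c, a = X.wtBase + v * X.B + c :=
              ⟨a - (X.wtBase + v * X.B), by omega⟩
            rw [fw c (by omega)]
            have : X.pinWeight S (σ.reg 11) v c ≤ 1 := by
              unfold pinWeight; split_ifs <;> simp
            exact this.trans X.M_pos
        have fmem : ∀ a, a < X.flagBase ∨ X.tblBase ≤ a ∧ a < X.wtBase → φ.mem a = σ.mem a := by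
          intro a h
          rw [fm a (by omega), gm, if_neg (by omega), hm a h]
        have fnew : ∀ u : Fin X.n, j ≤ u.1 → φ.mem (X.flagBase + u) = 1 ∧
            ∀ c < X.B, φ.mem (X.wtBase + u * X.B + c) = X.pinWeight S (σ.reg 11) u c := by
          intro u hju
          have hu := u.2
          rcases Nat.eq_or_lt_of_le hju with hju | hju
          · have huv : u = v := Fin.ext hju.symm
            subst huv
            refine ⟨?_, fw⟩
            rw [fm _ (by omega), gm, if_pos (by rw [hju])]
          · have hdis := X.row_disjoint hju.ne
            obtain ⟨h₁, h₂⟩ := hw u hju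
            refine ⟨?_, fun c hc => ?_⟩
            · rw [fm _ (by omega), gm, if_neg (by omega), h₁]
            · have hvj : (v : ℕ) = j := rfl
              rw [fm _ (by rw [hvj]; omega), gm, if_neg (by omega), h₂ c hc]
        have hfil := Fin.filter_le_eq_insert hj S
        refine Ends.ite hφ (fun h => ?_) fun h => ?_
        · rw [f15, g15'] at h
          rw [if_pos h] at hfil
          refine Ends.instr hφ (by simp) fun _ =>
            ⟨⟨?_, by omega, ?_, fle, fmem, fnew⟩, by simp [f14]⟩
          · intro x hx
            have : x ≠ 13 := by omega
            simp [this, fa' x (by omega), ha x hx]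
          · rw [hfil, Finset.card_insert_of_notMem (by simp), pow_succ,
              ← Nat.div_div_eq_div_mul, ← h13]
            simp [f13, f8]
        · have hvS : v ∉ S := fun hvS => g15'.2 hvS (by rw [← f15]; exact h)
          rw [if_neg hvS] at hfil
          refine Ends.instr hφ (by simp) fun _ =>
            ⟨⟨?_, by omega, ?_, fle, fmem, fnew⟩, by simp [f14]⟩
          · intro x hx
            have : x ≠ 20 := by omega
            simp [this, fa' x (by omega), ha x hx]
          · rw [hfil, ← h13]
            simp [f13]
  · refine ⟨?_, le_rfl, ?_, by simpa [WtLe] using hw, by simp, fun u hu => by omega⟩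
    · intro x hx
      have : x ≠ 13 ∧ x ≠ 14 := by omega
      simp [this]
    · have : S.filter (fun u => X.n ≤ u.1) = ∅ :=
        Finset.filter_eq_empty_iff.2 fun u _ => by omega
      simp [hc.r4, this]
  · simp [hc.r3, hc.r4]
  · nlinarith [Nat.zero_le (X.B * X.n)]
  · rintro τ hτ ⟨⟨ha, -, -, hle, hm, hnew⟩, -⟩
    refine ⟨ha, hc.of_agree (ha.mono (by norm_num)) hm, ⟨fun u => ?_, fun u _ c => ?_, hle⟩, rfl,
      fun v hv => absurd (Finset.mem_univ v) hv⟩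
    · simpa using (hnew u (Nat.zero_le _)).1
    · rw [wt, (hnew u (Nat.zero_le _)).2 c c.2]

theorem ends_sumRow (hσ : X.Within σ) (hc : X.Cfg σ) (hw : X.WtLe σ) {v : Fin X.n}
    (h16 : σ.reg 16 = X.wtBase + v * X.B) (h17 : σ.reg 17 = 0) (h18 : σ.reg 18 = X.B) :
    X.Ends (.loop 18 <|
        block (sub 18 18 4) [add 19 16 18, load 19 19, add 17 17 19, mod 17 17 10]) σ
      (X.B * 6 + 1) fun τ => σ.Agree 17 τ ∧ τ.mem = σ.mem ∧ τ.reg 17 ≤ X.M ∧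
        (τ.reg 17 : ZMod X.M) = ∑ c : Fin X.B, X.wt σ v c := by
  have hrow := X.row_le v.2
  have hhi := X.hi_eq'
  have hU := X.hi_lt_U
  have hM := X.two_mul_M_lt_U
  have hM1 := X.M_pos
  refine Ends.mono (Ends.loop
    (fun j τ => σ.Agree 17 τ ∧ τ.mem = σ.mem ∧ τ.reg 17 ≤ X.M ∧
        (τ.reg 17 : ZMod X.M) = ∑ c ∈ Finset.Ico j X.B, X.wt σ v c) X.B
    ?_ hσ ?_ h18) (le_of_eq ?_) ?_ (N := X.B * (5 + 1) + 1)
  · rintro j hj ρ hρ ⟨ha, hm, hle, hsum⟩ h18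
    have cρ : X.Cfg ρ := hc.of_mem_eq (ha.mono (by norm_num)) hm
    have g16 : ρ.reg 16 = X.wtBase + v * X.B := (ha 16 (by norm_num)).trans h16
    have hmem : σ.mem (X.wtBase + v * X.B + j) ≤ X.M := hw _ (by omega)
    refine Ends.block hρ ?_ fun _ => ⟨⟨?_, by simp [hm], ?_, ?_⟩, by simp [h18, cρ.r4]⟩
    · simp [cρ.r4, h18, g16, hm]; omega
    · intro x hx
      have : x ≠ 17 ∧ x ≠ 18 ∧ x ≠ 19 := by omega
      simp [this, ha x hx]
    · simp [cρ.r10]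
      exact (Nat.mod_lt _ hM1).le
    · rw [Finset.sum_eq_sum_Ico_succ_bot hj, ← hsum]
      simp [cρ.r4, cρ.r10, h18, g16, hm, wt, add_comm]
  · exact ⟨RamState.Agree.refl _ _, rfl, by simp [h17], by simp [h17]⟩
  · ring
  · rintro τ hτ ⟨⟨ha, hm, hle, hsum⟩, -⟩
    refine ⟨ha, hm, hle, ?_⟩
    rw [hsum, Fin.sum_univ_eq_sum_range (fun c => X.wt σ v c), Finset.range_eq_Ico]

/-- Skipping the eliminated vertices is correct because their weights sum to `1`. -/
theorem ends_productPhase {W : ZMod X.M} {A : Finset (Fin X.n)}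
    {g : Fin X.n → Fin X.B → ZMod X.M} (hσ : X.Within σ) (h : X.State G W A g σ)
    (hA : ∀ u ∈ A, nbrsIn G A u = ∅) :
    X.Ends productPhase σ (20 * (X.B + 1) * (X.n + 1)) fun τ => σ.Agree 13 τ ∧ τ.mem = σ.mem ∧
      τ.reg 13 ≤ X.M ∧ (τ.reg 13 : ZMod X.M) = W := by
  have hc := h.cfg
  have hhi := X.hi_eq
  have hU := X.hi_lt_U
  have hM := X.sq_lt_U
  have hM1 := X.M_pos
  have hwb : X.wtBase = X.n * X.n + X.n + X.n + X.B := rfl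
  have hfb : X.flagBase = X.n * X.n + X.n := rfl
  refine Ends.mono (Ends.block_seq hσ (by simp) fun hτ => Ends.loop
    (fun j τ => σ.Agree 13 τ ∧ τ.mem = σ.mem ∧ τ.reg 13 ≤ X.M ∧ (τ.reg 13 : ZMod X.M)
      = ∏ u ∈ Finset.univ.filter (fun u : Fin X.n => j ≤ u.1), ∑ c, g u c) X.n
    ?_ hτ ?_ ?_) ?_ ?_ (N := 2 + (X.n * (7 + (((X.B * 6 + 1) + 2) + 1) + 1) + 1))
  · rintro j hj ρ hρ ⟨ha, hm, hle, hprod⟩ h14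
    set v : Fin X.n := ⟨j, hj⟩ with hv
    have cρ : X.Cfg ρ := hc.of_mem_eq (ha.mono (by norm_num)) hm
    have hrow := X.row_le hj
    have hfl : ρ.mem (X.flagBase + j) = if v ∈ A then 1 else 0 := by rw [hm]; exact h.rep.flag v
    have hfil := Fin.filter_le_eq_insert hj Finset.univ
    rw [if_pos (Finset.mem_univ _)] at hfil
    refine Ends.block_seq hρ ?_ fun hθ => ?_
    · simp [cρ.r4, cρ.r5, cρ.r8, cρ.r9, h14]; omega
    · set θ := exec [sub 14 14 4, add 15 5 14, load 15 15, mul 16 14 8, add 16 16 9, const 17 0,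
        div 18 8 4] ρ with hθd
      have ga : ρ.Agree 14 θ := by
        intro x hx
        have : x ≠ 14 ∧ x ≠ 15 ∧ x ≠ 16 ∧ x ≠ 17 ∧ x ≠ 18 := by omega
        simp [hθd, this]
      have gm : θ.mem = σ.mem := by simp [hθd, hm]
      have g13 : θ.reg 13 = ρ.reg 13 := ga 13 (by norm_num)
      have g14 : θ.reg 14 = j := by simp [hθd, cρ.r4, h14]
      have g15 : θ.reg 15 = if v ∈ A then 1 else 0 := by
        rw [← hfl, hfb]
        simp [hθd, cρ.r4, cρ.r5, h14]
      have g16 : θ.reg 16 = X.wtBase + v * X.B := by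
        simp [hθd, cρ.r4, cρ.r8, cρ.r9, h14, hv, add_comm]
      have cθ : X.Cfg θ := cρ.of_mem_eq (ga.mono (by norm_num)) (gm.trans hm.symm)
      refine Ends.ite hθ (fun h' => ?_) fun h' => ?_
      · have hvA : v ∈ A := by by_contra hvA; simp [g15, hvA] at h'
        refine Ends.seq (N := X.B * 6 + 1) (N' := 2) (ends_sumRow hθ cθ (fun a h' => by rw [gm]; exact h.rep.le a h') g16
          (by simp [hθd]) (by simp [hθd, cρ.r4, cρ.r8])) ?_
        rintro φ hφ ⟨fa, fm, fle, fsum⟩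
        have f13 : φ.reg 13 = ρ.reg 13 := (fa 13 (by norm_num)).trans g13
        have f14 : φ.reg 14 = j := (fa 14 (by norm_num)).trans g14
        have f10 : φ.reg 10 = X.M := (fa 10 (by norm_num)).trans cθ.r10
        have hmm := Nat.mul_le_mul hle fle
        refine Ends.block hφ ?_ fun _ => ⟨⟨?_, by simp [fm, gm], ?_, ?_⟩, by simp [f14]⟩
        · simp [f13]; omega
        · intro x hx
          have : x ≠ 13 := by omega
          simp [this, fa x (by omega), ga x (by omega), ha x hx]
        · simp [f10]
          exact (Nat.mod_lt _ hM1).le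
        · rw [hfil, Finset.prod_insert (by simp), ← hprod]
          have hg : ∑ c, g v c = ∑ c : Fin X.B, X.wt θ v c :=
            Finset.sum_congr rfl fun c _ => by rw [← h.rep.wt v hvA c, wt, wt, gm]
          rw [hg, ← fsum]
          simp [f10, f13, mul_comm]
      · have hvA : v ∉ A := fun hvA => by simp [g15, hvA] at h'
        refine Ends.mono (Ends.instr hθ (by simp) fun _ =>
          ⟨⟨?_, by simp [gm], ?_, ?_⟩, by simp [g14]⟩) (by omega) fun _ _ h => h
        · intro x hx
          have : x ≠ 20 := by omega
          simp [this, ga x (by omega), ha x hx]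
        · simpa [g13] using hle
        · rw [hfil, Finset.prod_insert (by simp), ← hprod, h.unit v hvA]
          simp [g13]
  -- The start value `1` explains the non-strict bound: the modulus is `1` if there are vertices but
  -- no color sets.
  · refine ⟨?_, by simp, by simpa using hM1, ?_⟩
    · intro x hx
      have : x ≠ 13 ∧ x ≠ 14 := by omega
      simp [this]
    · have : Finset.univ.filter (fun u : Fin X.n => X.n ≤ u.1) = ∅ :=
        Finset.filter_eq_empty_iff.2 fun u _ => by omega
      simp [this]
  · simp [hc.r3, hc.r4]
  · nlinarith [Nat.zero_le (X.B * X.n)]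
  · rintro τ hτ ⟨⟨ha, hm, hle, hprod⟩, -⟩
    refine ⟨ha, hm, hle, ?_⟩
    rw [hprod, ← h.sum, colorSum_of_isolated hA]
    simp

theorem ends_countPhase (hin : X.IsInput G)
    (hS : ∀ v : Fin X.n, X.inp (X.n * X.n + v) = 1 ↔ v ∈ S) (hfvs : IsFeedbackVertexSet G S)
    (hσ : X.Within σ) (hc : X.Cfg σ) (hw : X.WtLe σ) (h12 : σ.reg 12 = 0) {T : ℕ}
    (h11 : σ.reg 11 = T) :
    X.Ends countPhase σ (T * (240 * ((X.k + 1) ^ 2 * (X.B + 1) ^ 2) * (X.n + 1) ^ 3) + 1)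
      fun τ => τ.reg 4 = 1 ∧ τ.reg 12 < X.M ∧ (τ.reg 12 : ZMod X.M) = ∑ x ∈ Finset.range T,
        colorSum G X.Rel Finset.univ fun v c => (X.pinWeight S x v c : ZMod X.M) := by
  have hM := X.two_mul_M_lt_U
  have hM1 := X.M_pos
  refine Ends.mono (Ends.loop
    -- Only the size of the old weights matters for the next `x`, since `initPhase` rewrites flags
    -- and weights. The accumulator stays strictly below `M`, so its residue determines it.
    (fun j τ => X.Cfg τ ∧ X.WtLe τ ∧ τ.reg 12 < X.M ∧
      (τ.reg 12 : ZMod X.M) = ∑ x ∈ Finset.Ico j T,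
        colorSum G X.Rel Finset.univ fun v c => (X.pinWeight S x v c : ZMod X.M)) T
    ?_ hσ ?_ h11) ?_ ?_ (N := T * (1 + (20 * (X.B + 1) * (X.n + 1) +
      (90 * ((X.k + 1) ^ 2 * (X.B + 1) ^ 2) * (X.n + 1) ^ 2 +
      (100 * ((X.k + 1) ^ 2 * (X.B + 1) ^ 2) * (X.n + 1) ^ 3 +
      (20 * (X.B + 1) * (X.n + 1) + 2)))) + 1) + 1)
  · rintro j hj ρ hρ ⟨cρ, hle, hlt, hsum⟩ h11
    refine Ends.seq (Ends.instr (Q := fun τ => τ = ρ.setReg 11 j) hρ (by simp)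
      fun _ => by simp [cρ.r4, h11]) ?_
    rintro ρ₁ hρ₁ rfl
    have a₁ : ρ.Agree 11 (ρ.setReg 11 j) := by
      intro x hx
      have : x ≠ 11 := by omega
      simp [this]
    refine Ends.seq (ends_initPhase (G := G) hS hρ₁ (cρ.of_mem_eq a₁ rfl) hle) ?_
    rintro ρ₂ hρ₂ ⟨a₂, st₂⟩
    refine Ends.seq (ends_pinPhase hin hS hρ₂ st₂ fun v hv => isPinned_pinWeight _ hv) ?_
    rintro ρ₃ hρ₃ ⟨a₃, A₃, g₃, st₃, hiso⟩
    refine Ends.seq (ends_leafPhase hin hρ₃ st₃ hiso hfvs) ?_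
    rintro ρ₄ hρ₄ ⟨a₄, A₄, g₄, st₄, hiso₄⟩
    refine Ends.seq (ends_productPhase hρ₄ st₄ hiso₄) ?_
    rintro ρ₅ hρ₅ ⟨a₅, m₅, le₅, h13⟩
    have a := a₂.trans (a₃.trans (a₄.trans a₅))
    have c₅ : X.Cfg ρ₅ := st₄.cfg.of_mem_eq (a₅.mono (by norm_num)) m₅
    have g12 : ρ₅.reg 12 = ρ.reg 12 := by rw [a 12 (by norm_num)]; simp
    have g11 : ρ₅.reg 11 = j := by rw [a 11 (by norm_num)]; simp
    refine Ends.block hρ₅ ?_ fun _ => ⟨⟨?_, ?_, ?_, ?_⟩, by simp [g11]⟩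
    · simp [g12]; omega
    · refine c₅.of_mem_eq ?_ (by simp)
      intro x hx
      have : x ≠ 12 := by omega
      simp [this]
    · intro a h
      simpa [m₅] using st₄.rep.le a h
    · simpa [c₅.r10] using Nat.mod_lt _ hM1
    · rw [Finset.sum_eq_sum_Ico_succ_bot hj, ← hsum]
      simp [c₅.r10, g12, h13, add_comm]
  · exact ⟨hc, hw, by rw [h12]; exact hM1, by simp [h12]⟩
  · refine Nat.add_le_add_right (Nat.mul_le_mul_left _ ?_) 1
    have h₁ : X.B + 1 ≤ (X.k + 1) ^ 2 * (X.B + 1) ^ 2 := by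
      have : 1 ≤ (X.k + 1) ^ 2 := Nat.one_le_pow _ _ (Nat.succ_pos _)
      nlinarith [Nat.zero_le X.B, Nat.mul_le_mul_right ((X.B + 1) ^ 2) this]
    generalize (X.k + 1) ^ 2 * (X.B + 1) ^ 2 = K at h₁
    have h₂ : 20 * (X.B + 1) * (X.n + 1) ≤ 20 * K * (X.n + 1) ^ 3 := by
      gcongr
      exact Nat.le_self_pow (by norm_num) _
    have h₃ : 90 * K * (X.n + 1) ^ 2 ≤ 90 * K * (X.n + 1) ^ 3 := by
      gcongr <;> omega
    have h₄ : 1 ≤ K * (X.n + 1) ^ 3 :=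
      Nat.one_le_iff_ne_zero.2 (Nat.mul_ne_zero (by omega) (by positivity))
    nlinarith
  · rintro τ hτ ⟨⟨hc, -, hlt, hsum⟩, -⟩
    exact ⟨hc.r4, hlt, by rw [hsum, Finset.range_eq_Ico]⟩

end CountSetup

/-! ### Listing the color sets -/

/-- The first `k` digits of `x` in base `q` are strictly increasing. -/
def IsCode (q k x : ℕ) : Prop := ∀ j < k - 1, x / q ^ j % q < x / q ^ (j + 1) % q

instance (q k x : ℕ) : Decidable (IsCode q k x) :=
  inferInstanceAs (Decidable (∀ j < k - 1, _))

/-- The number of codes of color sets that are at least `j`. -/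
def numCodes (q k j : ℕ) : ℕ := ((Finset.Ico j (q ^ k)).filter (IsCode q k)).card

theorem numCodes_eq {q k j : ℕ} (hj : j < q ^ k) :
    numCodes q k j = if IsCode q k j then numCodes q k (j + 1) + 1 else numCodes q k (j + 1) := by
  rw [numCodes, numCodes, ← Finset.insert_Ico_succ_left_eq_Ico hj, Finset.filter_insert]
  split_ifs
  · rw [Finset.card_insert_of_notMem (by simp)]
    rfl
  · rfl

theorem numCodes_anti (q k : ℕ) : Antitone (numCodes q k) := fun _ _ h =>
  Finset.card_le_card (Finset.filter_subset_filter _ (Finset.Ico_subset_Ico_left h))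

/-- Register `15` becomes one if the number in register `9` is the code of a color set, and zero
otherwise. -/
def codeTest : RamProg :=
  .seq (block (div 13 9 4) [const 14 0, const 15 1, div 16 1 4]) <|
  .loop 16 <|
  -- Register `14` holds the previous digit plus one, initially `0`. Register `15` loses its `1` as
  -- soon as this exceeds the current digit.
  block (sub 16 16 4) [mod 17 13 0, add 17 17 4, div 13 13 0, add 14 14 4, sub 14 14 17,
    sub 15 15 14, div 14 17 4]

/-- List the codes of color sets below register `9` in decreasing order, and count them in
register `8`. -/
def tableLoop : RamProg :=
  .loop 9 <|
  .seq (.instr (sub 9 9 4)) <|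
  .seq codeTest <|
  .ite 15 (block (add 14 7 8) [store 14 9, add 8 8 4]) (.instr (const 20 0))

/-- Compute the powers of the number of color sets that are needed. -/
def powerLoop : RamProg :=
  .loop 13 <|
  .seq (block (sub 13 13 4) [mul 10 10 8, add 14 6 13, load 14 14]) <|
  .ite 14 (.instr (mul 11 11 8)) (.instr (const 20 0))

/-- Prepare the global registers and the list of color sets. -/
def setupPhase : RamProg :=
  .seq (block (const 4 1) [mul 6 3 3, add 5 6 3, add 7 5 3, const 9 1, div 13 1 4]) <|
  .seq (.loop 13 <| block (sub 13 13 4) [mul 9 9 0]) <|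
  .seq tableLoop <|
  .seq (block (add 9 7 8) [const 10 1, const 11 1, const 12 0, div 13 3 4]) <|
  .seq powerLoop <|
  .instr (add 10 10 4)

/-- The counting program. -/
def countProg : RamProg :=
  .seq setupPhase <| .seq countPhase <| .instr (div 0 12 4)

/-! ### Correctness of the setup phase -/

namespace CountSetup

variable {X : CountSetup} {σ : RamState}

/-- The contents of the first registers and of the input cells. -/
structure Base (X : CountSetup) (σ : RamState) : Prop where
  r0 : σ.reg 0 = X.q
  r1 : σ.reg 1 = X.k
  r2 : σ.reg 2 = X.i
  r3 : σ.reg 3 = X.n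
  r4 : σ.reg 4 = 1
  r5 : σ.reg 5 = X.n * X.n + X.n
  r6 : σ.reg 6 = X.n * X.n
  r7 : σ.reg 7 = X.tblBase

theorem Base.of_agree {τ : RamState} (h : X.Base σ) (ha : σ.Agree 8 τ) : X.Base τ where
  r0 := (ha 0 (by norm_num)).trans h.r0
  r1 := (ha 1 (by norm_num)).trans h.r1
  r2 := (ha 2 (by norm_num)).trans h.r2
  r3 := (ha 3 (by norm_num)).trans h.r3
  r4 := (ha 4 (by norm_num)).trans h.r4
  r5 := (ha 5 (by norm_num)).trans h.r5
  r6 := (ha 6 (by norm_num)).trans h.r6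
  r7 := (ha 7 (by norm_num)).trans h.r7

theorem ends_codeTest (hσ : X.Within σ) (hb : X.Base σ) {x : ℕ} (hx : x < X.q ^ X.k)
    (h9 : σ.reg 9 = x) :
    X.Ends codeTest σ (10 * (X.k + 1)) fun τ => σ.Agree 13 τ ∧ τ.mem = σ.mem ∧
      τ.reg 15 = if IsCode X.q X.k x then 1 else 0 := by
  have hU : X.q + 4 < X.U := X.q_lt
  refine Ends.mono (Ends.block_seq hσ (by simp) fun hτ => Ends.loop
    (fun j τ => σ.Agree 13 τ ∧ τ.mem = σ.mem ∧ j ≤ X.k ∧ τ.reg 13 = x / X.q ^ (X.k - j) ∧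
      τ.reg 14 = (if X.k - j = 0 then 0 else x / X.q ^ (X.k - j - 1) % X.q + 1) ∧
      τ.reg 15 = if IsCode X.q (X.k - j) x then 1 else 0) X.k ?_ hτ ?_ ?_) ?_ ?_
    (N := 4 + (X.k * (8 + 1) + 1))
  · rintro j hj ρ hρ ⟨ha, hm, hjk, h13, h14, h15⟩ h16
    have bρ := hb.of_agree (ha.mono (by norm_num))
    have hq : 0 < X.q := Nat.pos_of_ne_zero fun h => by
      rw [h, zero_pow (by omega)] at hx
      omega
    have hmod : ∀ y, y % X.q < X.q := fun y => Nat.mod_lt y hq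
    have e : X.k - j = X.k - (j + 1) + 1 := by omega
    have h14le : ρ.reg 14 ≤ X.q := by
      rw [h14]
      split_ifs
      · omega
      · exact hmod _
    have hm13 := hmod (ρ.reg 13)
    refine Ends.block hρ ?_ fun _ => ⟨⟨?_, by simp [hm], by omega, ?_, ?_, ?_⟩, ?_⟩
    · simp [bρ.r0, bρ.r4]; omega
    · intro x hx
      have : x ≠ 13 ∧ x ≠ 14 ∧ x ≠ 15 ∧ x ≠ 16 ∧ x ≠ 17 := by omega
      simp [this, ha x hx]
    · simp [h13, bρ.r0, e, pow_succ, Nat.div_div_eq_div_mul]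
    · rw [if_neg (by omega), e, Nat.add_sub_cancel, ← h13]
      simp [bρ.r0, bρ.r4]
    · have hcode : IsCode X.q (X.k - j) x ↔ IsCode X.q (X.k - (j + 1)) x ∧
          ρ.reg 14 ≤ x / X.q ^ (X.k - (j + 1)) % X.q := by
        rw [e, h14]
        generalize X.k - (j + 1) = m
        rcases m with _ | m
        · simp [IsCode]
        · simp only [IsCode, Nat.add_sub_cancel, Nat.succ_ne_zero, if_false]
          rw [Nat.forall_lt_succ_right]
          exact Iff.rfl
      simp only [hcode, exec, effect, RamState.reg_setReg]
      simp only [Nat.reduceEqDiff, if_true, if_false, h15, bρ.r0, bρ.r4, h13]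
      by_cases h₁ : IsCode X.q (X.k - (j + 1)) x
      · simp only [h₁, true_and, if_true]
        split_ifs <;> omega
      · simp [h₁]
    · simp [h16, bρ.r4]
  · refine ⟨?_, by simp, le_rfl, ?_, by simp, ?_⟩
    · intro x hx
      have : x ≠ 13 ∧ x ≠ 14 ∧ x ≠ 15 ∧ x ≠ 16 := by omega
      simp [this]
    · simp [h9, hb.r4]
    · simp [IsCode]
  · simp [hb.r1, hb.r4]
  · omega
  · rintro τ hτ ⟨⟨ha, hm, -, -, -, h15⟩, -⟩
    exact ⟨ha, hm, by simpa using h15⟩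

/-- The list is built from the largest code down, so a code `x` lands at the index `numCodes q k (x
+ 1)`, the number of larger codes. Cells beyond the list are still zero, which later bounds the
initial weights. -/
theorem ends_tableLoop (hB : X.B = numCodes X.q X.k 0)
    (htbl : ∀ x < X.q ^ X.k, IsCode X.q X.k x → X.tbl (numCodes X.q X.k (x + 1)) = x)
    (hσ : X.Within σ) (hb : X.Base σ) (hm : σ.mem = X.inp) (hz : ∀ a, X.lo ≤ a → X.inp a = 0)
    (h8 : σ.reg 8 = 0) (h9 : σ.reg 9 = X.q ^ X.k) :
    X.Ends tableLoop σ (16 * (X.k + 1) * (X.q ^ X.k + 1)) fun τ => σ.Agree 8 τ ∧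
      τ.reg 8 = X.B ∧ (∀ a < X.tblBase, τ.mem a = X.inp a) ∧
      (∀ j < X.B, τ.mem (X.tblBase + j) = X.tbl j) ∧ ∀ a, X.wtBase ≤ a → τ.mem a = 0 := by
  have hhi := X.hi_eq
  have hlo := X.lo_eq
  have hU := X.hi_lt_U
  have hwb : X.wtBase = X.tblBase + X.B := rfl
  have htb : X.tblBase = X.n * X.n + X.n + X.n := rfl
  refine Ends.mono (Ends.loop
    (fun j τ => σ.Agree 8 τ ∧ j ≤ X.q ^ X.k ∧ τ.reg 8 = numCodes X.q X.k j ∧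
      (∀ a < X.tblBase, τ.mem a = X.inp a) ∧
      (∀ l < numCodes X.q X.k j, τ.mem (X.tblBase + l) = X.tbl l) ∧
      ∀ a, X.tblBase + numCodes X.q X.k j ≤ a → τ.mem a = 0) (X.q ^ X.k) ?_ hσ ?_ h9) ?_ ?_
    (N := X.q ^ X.k * (1 + (10 * (X.k + 1) + (3 + 1)) + 1) + 1)
  · rintro j hj ρ hρ ⟨ha, hjk, h8, hm, ht, h0⟩ h9
    have bρ := hb.of_agree ha
    have hnum := numCodes_eq hj
    have hanti := numCodes_anti X.q X.k (Nat.zero_le j)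
    rw [← hB] at hanti
    refine Ends.seq (Ends.instr (Q := fun τ => τ = ρ.setReg 9 j) hρ (by simp)
      fun _ => by simp [bρ.r4, h9]) ?_
    rintro ρ₁ hρ₁ rfl
    have a₁ : ρ.Agree 9 (ρ.setReg 9 j) := by
      intro x hx
      have : x ≠ 9 := by omega
      simp [this]
    refine Ends.seq (ends_codeTest hρ₁ (bρ.of_agree (a₁.mono (by norm_num))) hj (by simp)) ?_
    rintro φ hφ ⟨fa, fm, f15⟩
    have fa' : ρ.Agree 9 φ := a₁.trans (fa.mono (by norm_num))
    have bφ := bρ.of_agree (fa'.mono (by norm_num))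
    have f8 : φ.reg 8 = numCodes X.q X.k (j + 1) := (fa' 8 (by norm_num)).trans h8
    have f9 : φ.reg 9 = j := (fa 9 (by norm_num)).trans (by simp)
    have fm' : φ.mem = ρ.mem := fm
    refine Ends.ite hφ (fun h => ?_) fun h => ?_
    · have hcode : IsCode X.q X.k j := by by_contra hcode; simp [f15, hcode] at h
      rw [if_pos hcode] at hnum
      have hstore : ∀ a, (exec [add 14 7 8, store 14 9, add 8 8 4] φ).mem a
          = if a = X.tblBase + numCodes X.q X.k (j + 1) then j else ρ.mem a := fun a => by
        simp [bφ.r7, f8, f9, fm']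
      refine Ends.block hφ ?_ fun _ =>
        ⟨⟨?_, by omega, ?_, fun a h => ?_, fun l hl => ?_, fun a h => ?_⟩, ?_⟩
      · simp [bφ.r4, bφ.r7, f8]; omega
      · intro x hx
        have : x ≠ 8 ∧ x ≠ 14 := by omega
        simp [this, fa' x (by omega), ha x hx]
      · simp [bφ.r4, f8, hnum]
      · rw [hstore, if_neg (by omega), hm a h]
      · rw [hstore]
        rw [hnum] at hl
        rcases Nat.eq_or_lt_of_le (Nat.le_of_lt_succ hl) with rfl | hl
        · rw [if_pos rfl, htbl j hj hcode]
        · rw [if_neg (by omega), ht l hl]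
      · rw [hstore, if_neg (by omega), h0 a (by omega)]
      · simp [f9]
    · have hcode : ¬ IsCode X.q X.k j := fun hcode => by simp [f15, hcode] at h
      rw [if_neg hcode] at hnum
      refine Ends.mono (Ends.instr hφ (by simp) fun _ => ⟨⟨?_, by omega, ?_, ?_, ?_, ?_⟩, ?_⟩)
        (by norm_num) fun _ _ h => h
      · intro x hx
        have : x ≠ 20 := by omega
        simp [this, fa' x (by omega), ha x hx]
      · simp [f8, hnum]
      · simpa [fm'] using hm
      · simpa [fm', hnum] using ht
      · simpa [fm', hnum] using h0
      · simp [f9]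
  · have hQ : numCodes X.q X.k (X.q ^ X.k) = 0 := by simp [numCodes]
    refine ⟨RamState.Agree.refl _ _, le_rfl, by rw [h8, hQ], fun a _ => by rw [hm],
      fun l hl => by omega, fun a h => ?_⟩
    rw [hm, hz a (by omega)]
  · nlinarith [Nat.zero_le (X.k * X.q ^ X.k)]
  · rintro τ hτ ⟨⟨ha, -, h8, hm, ht, h0⟩, -⟩
    rw [← hB] at h8 ht h0
    exact ⟨ha, h8, hm, ht, h0⟩

/-- The summand `1` in the modulus covers `B = 0` and `m = 0`, where `B ^ m = 1` although `B ^ n`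
may vanish. -/
theorem pow_le_M (X : CountSetup) {m : ℕ} (hm : m ≤ X.n) : X.B ^ m ≤ X.M := by
  rcases Nat.eq_zero_or_pos X.B with hB | hB
  · rw [hB, M]
    exact (pow_le_one₀ (Nat.zero_le _) (by norm_num)).trans (Nat.le_add_left _ _)
  · exact (Nat.pow_le_pow_right hB hm).trans (Nat.le_succ _)

theorem ends_powerLoop {S : Finset (Fin X.n)}
    (hS : ∀ v : Fin X.n, X.inp (X.n * X.n + v) = 1 ↔ v ∈ S) (hσ : X.Within σ) (hb : X.Base σ)
    (h8 : σ.reg 8 = X.B) (h10 : σ.reg 10 = 1) (h11 : σ.reg 11 = 1) (h13 : σ.reg 13 = X.n)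
    (hm : ∀ a < X.lo, σ.mem a = X.inp a) :
    X.Ends powerLoop σ (8 * (X.n + 1)) fun τ => σ.Agree 10 τ ∧ τ.mem = σ.mem ∧
      τ.reg 10 = X.B ^ X.n ∧ τ.reg 11 = X.B ^ S.card ∧ τ.reg 12 = σ.reg 12 := by
  have hlo := X.lo_eq
  have hhi := X.hi_eq
  have hU := X.hi_lt_U
  have hM := X.two_mul_M_lt_U
  have hpow : ∀ m ≤ X.n, X.B ^ m < X.U := fun m hm => by have := X.pow_le_M hm; omega
  have hcard : ∀ p : Fin X.n → Prop, ∀ _ : DecidablePred p, (S.filter p).card ≤ X.n :=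
    fun p _ => by simpa using (S.filter p).card_le_univ
  refine Ends.mono (Ends.loop
    (fun j τ => σ.Agree 10 τ ∧ τ.mem = σ.mem ∧ j ≤ X.n ∧ τ.reg 10 = X.B ^ (X.n - j) ∧
      τ.reg 11 = X.B ^ (S.filter fun u => j ≤ u.1).card ∧ τ.reg 12 = σ.reg 12) X.n ?_ hσ ?_ h13)
      ?_ ?_ (N := X.n * (4 + (1 + 1) + 1) + 1)
  · rintro j hj ρ hρ ⟨ha, gm, hjn, g10, g11, g12⟩ g13
    have bρ := hb.of_agree (ha.mono (by norm_num))
    have g8 : ρ.reg 8 = X.B := (ha 8 (by norm_num)).trans h8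
    have hins : ρ.mem (X.n * X.n + j) = X.inp (X.n * X.n + j) := by
      rw [gm]; exact hm _ (by omega)
    have e : X.n - j = X.n - (j + 1) + 1 := by omega
    have h10U := hpow (X.n - j) (by omega)
    rw [e, pow_succ] at h10U
    have hfil := Fin.filter_le_eq_insert hj S
    have hle := X.inp_le (X.n * X.n + j)
    have hSj := hS ⟨j, hj⟩
    simp only at hSj
    refine Ends.block_seq hρ ?_ fun hθ => Ends.ite hθ (fun h => ?_) fun h => ?_
    · simp [bρ.r4, bρ.r6, g8, g10, g13]; omega
    · have hjS : (⟨j, hj⟩ : Fin X.n) ∈ S := by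
        simp [bρ.r4, bρ.r6, g13, hins] at h
        exact hSj.1 (by omega)
      rw [if_pos hjS] at hfil
      have hpw : X.B ^ (S.filter fun u => j ≤ u.1).card
          = X.B ^ (S.filter fun u => j + 1 ≤ u.1).card * X.B := by
        rw [hfil, Finset.card_insert_of_notMem (by simp), pow_succ]
      refine Ends.instr hθ ?_ fun _ => ⟨⟨?_, by simp [gm], by omega, ?_, ?_, by simp [g12]⟩, ?_⟩
      · have hpU := hpow _ (hcard (fun u => j ≤ u.1) inferInstance)
        rw [hpw] at hpU
        simpa [g8, g11] using hpU
      · intro x hx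
        have : x ≠ 10 ∧ x ≠ 11 ∧ x ≠ 13 ∧ x ≠ 14 := by omega
        simp [this, ha x hx]
      · simp [g8, g10, e, pow_succ]
      · rw [hpw]
        simp [g8, g11]
      · simp [g13, bρ.r4]
    · have hjS : (⟨j, hj⟩ : Fin X.n) ∉ S := fun hjS => by
        have := hSj.2 hjS
        simp [bρ.r4, bρ.r6, g13, hins, this] at h
      rw [if_neg hjS] at hfil
      refine Ends.instr hθ (by simp) fun _ =>
        ⟨⟨?_, by simp [gm], by omega, ?_, ?_, by simp [g12]⟩, ?_⟩
      · intro x hx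
        have : x ≠ 10 ∧ x ≠ 20 ∧ x ≠ 13 ∧ x ≠ 14 := by omega
        simp [this, ha x hx]
      · simp [g8, g10, e, pow_succ]
      · rw [hfil]
        simp [g11]
      · simp [g13, bρ.r4]
  · refine ⟨RamState.Agree.refl _ _, rfl, le_rfl, by simp [h10], ?_, rfl⟩
    have : S.filter (fun u => X.n ≤ u.1) = ∅ :=
      Finset.filter_eq_empty_iff.2 fun u _ => by omega
    simp [h11, this]
  · omega
  · rintro τ hτ ⟨⟨ha, gm, -, g10, g11, g12⟩, -⟩
    exact ⟨ha, gm, by simpa using g10, by simpa using g11, g12⟩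

theorem ends_setupPhase {S : Finset (Fin X.n)}
    (hS : ∀ v : Fin X.n, X.inp (X.n * X.n + v) = 1 ↔ v ∈ S) (hB : X.B = numCodes X.q X.k 0)
    (htbl : ∀ x < X.q ^ X.k, IsCode X.q X.k x → X.tbl (numCodes X.q X.k (x + 1)) = x)
    (hσ : X.Within σ) (hm : σ.mem = X.inp) (hz : ∀ a, X.lo ≤ a → X.inp a = 0)
    (r0 : σ.reg 0 = X.q) (r1 : σ.reg 1 = X.k) (r2 : σ.reg 2 = X.i) (r3 : σ.reg 3 = X.n)
    (r8 : σ.reg 8 = 0) :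
    X.Ends setupPhase σ (50 * ((X.k + 1) * (X.q ^ X.k + 1) * (X.n + 1))) fun τ => X.Cfg τ ∧
      X.WtLe τ ∧ τ.reg 12 = 0 ∧ τ.reg 11 = X.B ^ S.card := by
  have hlo := X.lo_eq
  have hhi := X.hi_eq
  have hU := X.hi_lt_U
  have hM := X.two_mul_M_lt_U
  have hQ : X.q ^ X.k < X.U := X.pow_lt
  have hM1 := X.M_pos
  have hwb : X.wtBase = X.tblBase + X.B := rfl
  have htb : X.tblBase = X.n * X.n + X.n + X.n := rfl
  have hqpow : ∀ m ≤ X.k, X.q ^ m < X.U := fun m hm => by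
    rcases Nat.eq_zero_or_pos X.q with hq | hq
    · rw [hq]
      exact (pow_le_one₀ (Nat.zero_le _) (by norm_num)).trans_lt (by omega)
    · exact (Nat.pow_le_pow_right hq hm).trans_lt hQ
  refine Ends.mono (Ends.block_seq hσ ?_ fun hτ => Ends.seq (Ends.loop
    (fun j τ => X.Base τ ∧ τ.mem = σ.mem ∧ j ≤ X.k ∧ τ.reg 9 = X.q ^ (X.k - j) ∧ τ.reg 8 = 0) X.k ?_ hτ ?_ ?_) ?_) ?_ (fun _ _ h => h)
    (N := 6 + ((X.k * (2 + 1) + 1) + (16 * (X.k + 1) * (X.q ^ X.k + 1) +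
      (5 + (8 * (X.n + 1) + 1)))))
  · simp [r3]; omega
  · rintro j hj ρ hρ ⟨bρ, gm, hjk, g9, g8⟩ g13
    have e : X.k - j = X.k - (j + 1) + 1 := by omega
    have h9U := hqpow (X.k - j) (by omega)
    rw [e, pow_succ] at h9U
    refine Ends.block hρ ?_ fun _ => ⟨⟨bρ.of_agree ?_, by simp [gm], by omega, ?_, by simp [g8]⟩,
      by simp [g13, bρ.r4]⟩
    · simpa [g9, bρ.r0] using h9U
    · intro x hx
      have : x ≠ 9 ∧ x ≠ 13 := by omega
      simp [this]
    · simp [g9, bρ.r0, e, pow_succ]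
  · refine ⟨⟨?_, ?_, ?_, ?_, ?_, ?_, ?_, ?_⟩, by simp, le_rfl, by simp, by simp [r8]⟩ <;>
       simp [r0, r1, r2, r3, htb]
  · simp [r1]
  · rintro ρ₁ hρ₁ ⟨⟨b₁, m₁, -, g9, g8⟩, -⟩
    refine Ends.seq (ends_tableLoop hB htbl hρ₁ b₁ (m₁.trans hm) hz g8 (by simpa using g9)) ?_
    rintro ρ₂ hρ₂ ⟨a₂, t8, tm, tt, t0⟩
    have b₂ := b₁.of_agree a₂
    refine Ends.block_seq hρ₂ ?_ fun hρ₃ => ?_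
    · simp [b₂.r7, t8]; omega
    · set ρ₃ := exec [add 9 7 8, const 10 1, const 11 1, const 12 0, div 13 3 4] ρ₂ with hd
      have a₃ : ρ₂.Agree 9 ρ₃ := by
        intro x hx
        have : x ≠ 9 ∧ x ≠ 10 ∧ x ≠ 11 ∧ x ≠ 12 ∧ x ≠ 13 := by omega
        simp [hd, this]
      have m₃ : ρ₃.mem = ρ₂.mem := by simp [hd]
      have b₃ := b₂.of_agree (a₃.mono (by norm_num))
      have g8 : ρ₃.reg 8 = X.B := (a₃ 8 (by norm_num)).trans t8
      refine Ends.seq (ends_powerLoop hS hρ₃ b₃ g8 (by simp [hd]) (by simp [hd])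
        (by simp [hd, b₂.r3, b₂.r4]) fun a h => by rw [m₃]; exact tm a (by omega)) ?_
      rintro ρ₄ hρ₄ ⟨a₄, m₄, p10, p11, p12⟩
      have b₄ := b₃.of_agree (a₄.mono (by norm_num))
      have m₄' : ρ₄.mem = ρ₂.mem := m₄.trans m₃
      refine Ends.instr hρ₄ ?_ fun _ => ⟨⟨?_, ?_, ?_, ?_, ?_, ?_, ?_, ?_, ?_, ?_, ?_, ?_, ?_⟩,
        ?_, ?_, ?_⟩
      · have : X.B ^ X.n + 1 < X.U := by rw [← M]; omega
        simpa [p10, b₄.r4] using this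
      · simp [b₄.r0]
      · simp [b₄.r1]
      · simp [b₄.r2]
      · simp [b₄.r3]
      · simp [b₄.r4]
      · simp [b₄.r5]
      · simp [b₄.r6]
      · simp [b₄.r7]
      · simp [a₄ 8 (by norm_num), g8]
      · have : ρ₄.reg 9 = X.wtBase := by
          rw [a₄ 9 (by norm_num)]
          simp [hd, b₂.r7, t8, hwb]
        simp [this]
      · simp [p10, b₄.r4, M]
      · intro a h
        simpa [m₄'] using tm a (by omega)
      · intro j h
        simpa [m₄'] using tt j h
      · intro a h
        simp [m₄', t0 a h]
      · simp [p12, hd]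
      · simp [p11]
  · have h₁ : 1 ≤ (X.k + 1) * (X.q ^ X.k + 1) := Nat.one_le_iff_ne_zero.2 (by positivity)
    have h₂ : X.k ≤ (X.k + 1) * (X.q ^ X.k + 1) := by nlinarith [Nat.zero_le (X.q ^ X.k)]
    rw [mul_assoc 16]
    generalize (X.k + 1) * (X.q ^ X.k + 1) = K at h₁ h₂
    nlinarith [Nat.mul_le_mul_right X.n h₁]

end CountSetup

/-! ### Codes of color sets -/

theorem finFunctionFinEquiv_symm_val {q k : ℕ} (x : Fin (q ^ k)) (j : Fin k) :
    ((finFunctionFinEquiv.symm x j : Fin q) : ℕ) = x / q ^ (j : ℕ) % q := rfl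

theorem isCode_iff {q k : ℕ} (x : Fin (q ^ k)) :
    IsCode q k x ↔ StrictMono (finFunctionFinEquiv.symm x : Fin k → Fin q) := by
  rcases k with _ | k
  · exact ⟨fun _ i => i.elim0, fun _ j hj => absurd hj (by omega)⟩
  · rw [Fin.strictMono_iff_lt_succ]
    simp only [Fin.lt_def, finFunctionFinEquiv_symm_val, IsCode, Fin.val_castSucc, Fin.val_succ]
    exact ⟨fun h i => h i i.2, fun h j hj => h ⟨j, by omega⟩⟩

/-- The code of a color set: its elements in increasing order are the digits. -/
def ColorSet.code {q k : ℕ} (C : ColorSet q k) : Fin (q ^ k) :=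
  finFunctionFinEquiv fun j => C.1.orderEmbOfFin C.2 j

theorem ColorSet.digit_code {q k : ℕ} (C : ColorSet q k) (j : Fin k) :
    (C.code : ℕ) / q ^ (j : ℕ) % q = C.1.orderEmbOfFin C.2 j := by
  rw [← finFunctionFinEquiv_symm_val, ColorSet.code, Equiv.symm_apply_apply]

theorem ColorSet.isCode_code {q k : ℕ} (C : ColorSet q k) : IsCode q k C.code := by
  rw [isCode_iff, ColorSet.code, Equiv.symm_apply_apply]
  exact (C.1.orderEmbOfFin C.2).strictMono

theorem ColorSet.code_injective {q k : ℕ} : Function.Injective (ColorSet.code (q := q) (k := k)) := by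
  intro C D h
  have h' := finFunctionFinEquiv.injective h
  apply Subtype.ext
  apply Finset.coe_injective
  rw [← Finset.range_orderEmbOfFin C.1 C.2, ← Finset.range_orderEmbOfFin D.1 D.2]
  exact congrArg Set.range h'

/-- Strictly increasing digits are the increasing enumeration of the set of their values. -/
theorem ColorSet.exists_code_eq {q k : ℕ} (x : Fin (q ^ k)) (hx : IsCode q k x) :
    ∃ C : ColorSet q k, C.code = x := by
  rw [isCode_iff] at hx
  refine ⟨⟨Finset.univ.image (finFunctionFinEquiv.symm x), ?_⟩, ?_⟩
  · rw [Finset.card_image_of_injective _ hx.injective, Finset.card_univ, Fintype.card_fin]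
  · rw [ColorSet.code, ← Equiv.eq_symm_apply]
    exact (Finset.orderEmbOfFin_unique _ (fun j => Finset.mem_image_of_mem _ (Finset.mem_univ j))
      hx).symm

/-- The digits of a code list each element of the color set once, so every common color gives
exactly one pair of equal digits. -/
theorem ColorSet.commonDigits_code {q k : ℕ} (C D : ColorSet q k) :
    commonDigits q k C.code D.code = (C.1 ∩ D.1).card := by
  have hsum : ∀ (E : ColorSet q k) (f : Fin q → ℕ),
      ∑ x ∈ E.1, f x = ∑ j : Fin k, f (E.1.orderEmbOfFin E.2 j) := by
    intro E f
    conv_lhs => rw [← Finset.map_orderEmbOfFin_univ E.1 E.2, Finset.sum_map]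
    rfl
  rw [commonDigits, Finset.sum_range]
  have h : (C.1 ∩ D.1).card = ∑ x ∈ C.1, ∑ y ∈ D.1, if x = y then 1 else 0 := by
    simp
  rw [h, hsum]
  refine Finset.sum_congr rfl fun j _ => ?_
  rw [hsum, Finset.sum_range]
  refine Finset.sum_congr rfl fun l _ => if_congr ?_ rfl rfl
  rw [ColorSet.digit_code, ColorSet.digit_code, Fin.ext_iff]

theorem numCodes_succ_lt {q k x : ℕ} (hx : x < q ^ k) (hc : IsCode q k x) {y : ℕ} (hy : y ≤ x) :
    numCodes q k (x + 1) < numCodes q k y := by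
  have h := numCodes_eq hx
  rw [if_pos hc] at h
  have := numCodes_anti q k hy
  omega

/-- The position of a color set in the list of the machine. -/
def ColorSet.position {q k : ℕ} (C : ColorSet q k) : Fin (numCodes q k 0) :=
  ⟨numCodes q k (C.code + 1), numCodes_succ_lt C.code.2 C.isCode_code (Nat.zero_le _)⟩

/-- The number of larger codes strictly drops from one code to the next larger one. -/
theorem ColorSet.position_injective {q k : ℕ} :
    Function.Injective (ColorSet.position (q := q) (k := k)) := by
  intro C D h
  have h' : numCodes q k (C.code + 1) = numCodes q k (D.code + 1) := congrArg Fin.val h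
  apply ColorSet.code_injective
  rcases lt_trichotomy C.code D.code with hlt | heq | hlt
  · have := numCodes_succ_lt D.code.2 D.isCode_code (y := C.code + 1) hlt
    omega
  · exact heq
  · have := numCodes_succ_lt C.code.2 C.isCode_code (y := D.code + 1) hlt
    omega

theorem card_colorSet (q k : ℕ) : Fintype.card (ColorSet q k) = q.choose k := by
  simp [ColorSet]

theorem numCodes_zero (q k : ℕ) : numCodes q k 0 = q.choose k := by
  rw [← card_colorSet]
  refine (Finset.card_bij (s := Finset.univ) (fun (C : ColorSet q k) _ => (C.code : ℕ)) ?_ ?_ ?_).symm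
  · intro C _
    simp [C.isCode_code]
  · intro C _ D _ h
    exact ColorSet.code_injective (Fin.ext h)
  · intro x hx
    simp only [Finset.mem_filter, Finset.mem_Ico] at hx
    obtain ⟨C, hC⟩ := ColorSet.exists_code_eq ⟨x, hx.1.2⟩ hx.2
    exact ⟨C, Finset.mem_univ _, by rw [hC]⟩

/-- The list of codes in decreasing order. -/
noncomputable def codeList (q k : ℕ) : ℕ → ℕ :=
  Function.extend (fun C : ColorSet q k => (C.position : ℕ)) (fun C => (C.code : ℕ)) 0

theorem codeList_position {q k : ℕ} (C : ColorSet q k) : codeList q k C.position = C.code :=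
  (Fin.val_injective.comp ColorSet.position_injective).extend_apply _ _ C

theorem codeList_numCodes {q k x : ℕ} (hx : x < q ^ k) (hc : IsCode q k x) :
    codeList q k (numCodes q k (x + 1)) = x := by
  obtain ⟨C, hC⟩ := ColorSet.exists_code_eq ⟨x, hx⟩ hc
  have : codeList q k (numCodes q k ((C.code : ℕ) + 1)) = C.code := codeList_position C
  rwa [hC] at this

/-- Color sets correspond to positions in the list. -/
noncomputable def positionEquiv (q k : ℕ) : ColorSet q k ≃ Fin (numCodes q k 0) :=
  Equiv.ofBijective ColorSet.position <|
    (Fintype.bijective_iff_injective_and_card _).2 ⟨ColorSet.position_injective, by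
      rw [Fintype.card_fin, numCodes_zero, card_colorSet]⟩

/-- This puts the answer below the modulus, so that its residue determines it. -/
theorem numProperColorings_le {n : ℕ} (G : SimpleGraph (Fin n)) (q k i : ℕ) :
    numProperColorings G q k i ≤ q.choose k ^ n := by
  refine (Finite.card_subtype_le _).trans (le_of_eq ?_)
  rw [Nat.card_eq_fintype_card, Fintype.card_fun, card_colorSet, Fintype.card_fin]

namespace CountSetup

variable {X : CountSetup} {G : SimpleGraph (Fin X.n)}

open Classical in
theorem numProperColorings_eq (hB : X.B = numCodes X.q X.k 0) (htbl : X.tbl = codeList X.q X.k) :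
    numProperColorings G X.q X.k X.i
      = (Finset.univ.filter fun h : Fin X.n → Fin X.B =>
        ∀ u ∈ Finset.univ, ∀ w ∈ Finset.univ, G.Adj u w → X.Rel (h u) (h w)).card := by
  let e : ColorSet X.q X.k ≃ Fin X.B := (positionEquiv X.q X.k).trans (finCongr hB.symm)
  have he : ∀ C, X.tbl (e C) = C.code := fun C => by
    rw [htbl]
    exact codeList_position C
  rw [← Fintype.card_subtype, ← Nat.card_eq_fintype_card, numProperColorings]
  refine Nat.card_congr (Equiv.subtypeEquiv (Equiv.arrowCongr (Equiv.refl _) e) fun h => ?_)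
  simp only [IsProperColoring, Finset.mem_univ, true_imp_iff]
  refine forall₃_congr fun u w _ => ?_
  change _ ↔ commonDigits X.q X.k (X.tbl (e (h u))) (X.tbl (e (h w))) ≤ X.i
  rw [he, he, ColorSet.commonDigits_code]

/-- After exchanging the sums, each coloring agrees on `S` with the prescription of exactly one `x`
and is counted once. -/
theorem sum_colorSum_pinWeight (S : Finset (Fin X.n)) (hB : X.B = numCodes X.q X.k 0)
    (htbl : X.tbl = codeList X.q X.k) :
    (∑ x ∈ Finset.range (X.B ^ S.card),
      colorSum G X.Rel Finset.univ fun v c => (X.pinWeight S x v c : ZMod X.M))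
      = (numProperColorings G X.q X.k X.i : ZMod X.M) := by
  classical
  rw [numProperColorings_eq hB htbl, ← Finset.sum_boole]
  simp only [colorSum]
  rw [Finset.sum_comm]
  refine Finset.sum_congr rfl fun h _ => ?_
  rw [← Finset.sum_mul]
  have hpin : ∑ x ∈ Finset.range (X.B ^ S.card),
      ∏ v, (X.pinWeight S x v (h v) : ZMod X.M) = 1 := by
    rw [← sum_prod_digit_eq_one h S]
    refine Finset.sum_congr rfl fun x _ => ?_
    rw [← Finset.prod_subset (Finset.subset_univ S)]
    · refine Finset.prod_congr rfl fun v hv => ?_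
      rw [pinWeight, if_pos hv, Nat.cast_ite, Nat.cast_one, Nat.cast_zero]
      rfl
    · intro v _ hv
      simp [pinWeight, hv]
  rw [hpin, one_mul]
  congr

end CountSetup

/-! ### The resources of the counting program -/

/-- Bound for the lengths of all numbers in a run. -/
def runLength (q k i n : ℕ) : ℕ :=
  -- As `B ≤ 2 ^ (q.size * k)`, the first term accommodates the square of the modulus; together with
  -- `2 * n.size` it also covers the addresses.
  2 * (q.size * k * (n + 1)) + 2 * n.size + q.size + i.size + k.size + 10

/-! ### The input and the bounds of its run -/

theorem countingInput_mem_adj {n : ℕ} (q k i : ℕ) (G : SimpleGraph (Fin n)) (S : Finset (Fin n))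
    (u v : Fin n) : (countingInput q k i G S).mem (u * n + v) = 1 ↔ G.Adj u v := by
  have hlt : ∀ u v : Fin n, (u : ℕ) * n + v < n * n := fun u v => by
    have := Nat.mul_le_mul_right n (Nat.succ_le_of_lt u.2)
    rw [Nat.succ_mul] at this
    omega
  have hinj : ∀ u v u' v' : Fin n, (u : ℕ) * n + v = u' * n + v' → u = u' ∧ v = v' := by
    intro u v u' v' h
    have hn : 0 < n := (Nat.zero_le _).trans_lt u.2
    have h₁ := congrArg (· / n) h
    have h₂ := congrArg (· % n) h
    simp only [mul_comm _ n, Nat.mul_add_div hn, Nat.div_eq_of_lt (Fin.is_lt _), add_zero,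
      Nat.mul_add_mod, Nat.mod_eq_of_lt (Fin.is_lt _)] at h₁ h₂
    exact ⟨Fin.ext h₁, Fin.ext h₂⟩
  simp only [countingInput]
  constructor
  · intro h
    split_ifs at h with hc
    rcases hc with ⟨u', v', ha, he⟩ | ⟨v', -, he⟩
    · obtain ⟨rfl, rfl⟩ := hinj _ _ _ _ he
      exact ha
    · have := hlt u v
      omega
  · intro h
    rw [if_pos (Or.inl ⟨u, v, h, rfl⟩)]

theorem countingInput_mem_mark {n : ℕ} (q k i : ℕ) (G : SimpleGraph (Fin n)) (S : Finset (Fin n))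
    (v : Fin n) : (countingInput q k i G S).mem (n * n + v) = 1 ↔ v ∈ S := by
  simp only [countingInput]
  constructor
  · intro h
    split_ifs at h with hc
    rcases hc with ⟨u', v', -, he⟩ | ⟨v', hv, he⟩
    · have := Nat.mul_le_mul_right n (Nat.succ_le_of_lt u'.2)
      rw [Nat.succ_mul] at this
      omega
    · have : v = v' := Fin.ext (by omega)
      rwa [this]
  · intro h
    rw [if_pos (Or.inr ⟨v, h, rfl⟩)]

theorem countingInput_mem_le {n : ℕ} (q k i : ℕ) (G : SimpleGraph (Fin n)) (S : Finset (Fin n))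
    (a : ℕ) : (countingInput q k i G S).mem a ≤ 1 := by
  simp only [countingInput]
  split_ifs <;> simp

theorem countingInput_mem_eq_zero {n : ℕ} (q k i : ℕ) (G : SimpleGraph (Fin n))
    (S : Finset (Fin n)) {a : ℕ} (ha : n * n + n ≤ a) : (countingInput q k i G S).mem a = 0 := by
  simp only [countingInput]
  rw [if_neg]
  rintro (⟨u, v, -, he⟩ | ⟨v, -, he⟩)
  · have := Nat.mul_le_mul_right n (Nat.succ_le_of_lt u.2)
    rw [Nat.succ_mul] at this
    omega
  · omega

theorem add_four_lt_two_pow {m L : ℕ} (h : m.size + 3 < L) : m + 4 < 2 ^ L := by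
  have h₁ := Nat.lt_size_self m
  have h₂ : 2 ^ (m.size + 3) < 2 ^ L := Nat.pow_lt_pow_right (by norm_num) h
  rw [pow_add] at h₂
  omega

theorem choose_lt_two_pow (q k : ℕ) : q.choose k ≤ 2 ^ (q.size * k) :=
  (Nat.choose_le_pow q k).trans (by
    rw [pow_mul]
    exact Nat.pow_le_pow_left (Nat.lt_size_self q).le k)

/-- The data of the run on a given input. -/
noncomputable def inputSetup (q k i : ℕ) {n : ℕ} (G : SimpleGraph (Fin n)) (S : Finset (Fin n)) :
    CountSetup where
  w := Nat.size (n + q)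
  L := runLength q k i n
  lo := n * n + n
  hi := n * n + n + n + q.choose k + n * q.choose k
  two_le := by unfold runLength; omega
  lo_le := by omega
  q := q
  k := k
  i := i
  n := n
  B := q.choose k
  tbl := codeList q k
  inp := (countingInput q k i G S).mem
  lo_eq := rfl
  hi_eq := rfl
  hi_lt := by
    have hn := Nat.lt_size_self n
    have hB := choose_lt_two_pow q k
    generalize q.choose k = B at hB
    have h₁ : n * n + n + n + B + n * B + n + 4 ≤ (n + 2) * (n + 2) * (B + 1) := by
      nlinarith [Nat.zero_le (n * n * B), Nat.zero_le (n * B)]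
    have h₂ : n + 2 ≤ 2 ^ (n.size + 1) := by rw [pow_succ]; omega
    have h₃ : B + 1 ≤ 2 ^ (q.size * k + 1) := by
      have := Nat.one_le_two_pow (n := q.size * k)
      rw [pow_succ]; omega
    refine h₁.trans_lt ((Nat.mul_le_mul (Nat.mul_le_mul h₂ h₂) h₃).trans_lt ?_)
    rw [← pow_add, ← pow_add]
    refine Nat.pow_lt_pow_right (by norm_num) ?_
    have : q.size * k ≤ q.size * k * (n + 1) := Nat.le_mul_of_pos_right _ (Nat.succ_pos n)
    unfold runLength
    omega
  i_lt := add_four_lt_two_pow (by unfold runLength; omega)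
  q_lt := add_four_lt_two_pow (by unfold runLength; omega)
  k_lt := (Nat.lt_size_self k).trans_le
    (Nat.pow_le_pow_right (by norm_num) (by unfold runLength; omega))
  pow_lt := by
    have h : q ^ k ≤ 2 ^ (q.size * k) := by
      rw [pow_mul]
      exact Nat.pow_le_pow_left (Nat.lt_size_self q).le k
    refine h.trans_lt (Nat.pow_lt_pow_right (by norm_num) ?_)
    have : q.size * k ≤ q.size * k * (n + 1) := Nat.le_mul_of_pos_right _ (Nat.succ_pos n)
    unfold runLength
    omega
  sq_lt := by
    have hB : q.choose k ^ n ≤ 2 ^ (q.size * k * n) := by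
      rw [pow_mul]
      exact Nat.pow_le_pow_left (choose_lt_two_pow q k) n
    have h₁ : q.choose k ^ n + 1 ≤ 2 ^ (q.size * k * n + 1) := by
      have := Nat.one_le_two_pow (n := q.size * k * n)
      rw [pow_succ]; omega
    have h₂ : 4 = 2 ^ 2 := rfl
    refine (Nat.mul_le_mul_left 4 (Nat.mul_le_mul h₁ h₁)).trans_lt ?_
    rw [h₂, ← pow_add, ← pow_add]
    refine Nat.pow_lt_pow_right (by norm_num) ?_
    unfold runLength
    rw [mul_add]
    omega
  inp_le := countingInput_mem_le q k i G S

theorem within_countingInput (q k i : ℕ) {n : ℕ} (G : SimpleGraph (Fin n)) (S : Finset (Fin n)) :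
    (inputSetup q k i G S).Within (countingInput q k i G S) where
  reg_zero x hx := by
    have : x ≠ 0 ∧ x ≠ 1 ∧ x ≠ 2 ∧ x ≠ 3 := by omega
    simp [countingInput, this]
  reg_lt x := by
    have h₀ : 0 < (inputSetup q k i G S).U := Nat.two_pow_pos _
    have h₁ : q + 4 < (inputSetup q k i G S).U := (inputSetup q k i G S).q_lt
    have h₂ : k < (inputSetup q k i G S).U := (inputSetup q k i G S).k_lt
    have h₃ : i + 4 < (inputSetup q k i G S).U := (inputSetup q k i G S).i_lt
    have h₄ : n + 4 < (inputSetup q k i G S).U :=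
      lt_of_le_of_lt (by rw [Nat.add_assoc]; exact Nat.le_add_left _ _)
        (inputSetup q k i G S).hi_lt
    simp only [countingInput]
    split_ifs <;> omega
  mem_le a _ := countingInput_mem_le q k i G S a
  mem_lt a := (countingInput_mem_le q k i G S a).trans_lt
    (by have := (inputSetup q k i G S).four_le_U; omega)
  mem_zero a ha := countingInput_mem_eq_zero q k i G S ((inputSetup q k i G S).lo_le.trans ha)

theorem ends_countProg (q k i : ℕ) {n : ℕ} (G : SimpleGraph (Fin n)) (S : Finset (Fin n))
    (hS : IsFeedbackVertexSet G S) :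
    (inputSetup q k i G S).Ends countProg (countingInput q k i G S)
      (50 * ((k + 1) * (q ^ k + 1) * (n + 1)) + (q.choose k ^ S.card *
        (240 * ((k + 1) ^ 2 * (q.choose k + 1) ^ 2) * (n + 1) ^ 3) + 1 + 1))
      fun τ => τ.reg 0 = numProperColorings G q k i := by
  set X := inputSetup q k i G S with hX
  have hin : X.IsInput G := countingInput_mem_adj q k i G S
  have hmark : ∀ v : Fin X.n, X.inp (X.n * X.n + v) = 1 ↔ v ∈ S :=
    countingInput_mem_mark q k i G S
  have hB : X.B = numCodes X.q X.k 0 := (numCodes_zero q k).symm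
  refine Ends.seq (CountSetup.ends_setupPhase (S := S) hmark hB
    (fun x hx hc => codeList_numCodes hx hc) (within_countingInput q k i G S) rfl
    (fun a ha => countingInput_mem_eq_zero q k i G S ha) (by simp [countingInput, hX, inputSetup])
    (by simp [countingInput, hX, inputSetup]) (by simp [countingInput, hX, inputSetup])
    (by simp [countingInput, hX, inputSetup]) (by simp [countingInput])) ?_
  rintro ρ hρ ⟨hc, hw, h12, h11⟩
  refine Ends.seq (CountSetup.ends_countPhase (G := G) (S := S) hin hmark hS hρ hc hw h12 h11) ?_
  rintro φ hφ ⟨f4, f12, hsum⟩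
  refine Ends.instr hφ (by simp) fun _ => ?_
  have key := hsum.trans (CountSetup.sum_colorSum_pinWeight (X := X) (G := G) S hB rfl)
  have hlt : numProperColorings G q k i < X.M :=
    Nat.lt_succ_of_le (numProperColorings_le G q k i)
  -- Both sides are below the modulus, so the congruence is an equality.
  have key' := (ZMod.natCast_eq_natCast_iff' _ _ _).1 key
  rw [Nat.mod_eq_of_lt f12] at key'
  have hres : φ.reg 12 = numProperColorings G q k i := key'.trans (Nat.mod_eq_of_lt hlt)
  simpa [f4] using hres

/-! ### Asymptotic estimates -/

theorem pow_le_mul_choose {q k : ℕ} (hk : k ≤ q) : q ^ k ≤ k ^ k * k.factorial * q.choose k := by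
  rcases Nat.eq_zero_or_pos k with rfl | hk'
  · simp
  -- With `q = k + m` this says `(k - 1) * m ≥ 0`. It bounds `q ^ k` by a multiple of the `k`-th
  -- power of the smallest factor of `q (q - 1) ⋯ (q + 1 - k)`.
  · have h₁ : q ≤ k * (q + 1 - k) := by
      obtain ⟨m, rfl⟩ := Nat.exists_eq_add_of_le hk
      obtain ⟨l, rfl⟩ := Nat.exists_eq_add_of_le hk'
      have : 1 + l + m + 1 - (1 + l) = m + 1 := by omega
      rw [this]
      nlinarith [Nat.zero_le (l * m)]
    calc q ^ k ≤ (k * (q + 1 - k)) ^ k := Nat.pow_le_pow_left h₁ k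
      _ = k ^ k * (q + 1 - k) ^ k := mul_pow _ _ _
      _ ≤ k ^ k * (k.factorial * q.choose k) := by
        refine Nat.mul_le_mul_left _ ?_
        rw [← Nat.descFactorial_eq_factorial_mul_choose]
        exact Nat.pow_sub_le_descFactorial q k
      _ = _ := (mul_assoc _ _ _).symm

/-- The sizes of `q` and `n` are at most the word length, and that of `i` at most that of `k`. So a
number fills `O_k(n)` words, and the charge is the square of this. -/
theorem unit_le {q k i n : ℕ} (G : SimpleGraph (Fin n)) (S : Finset (Fin n)) (hi : i ≤ k)
    (hn : 1 ≤ n) :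
    (inputSetup q k i G S).unit ≤ (3 * (4 * k + 2 * k.size + 13) + 1) ^ 2 * n ^ 2 := by
  set w := Nat.size (n + q) with hw
  have hz : q.size ≤ w := Nat.size_le_size (Nat.le_add_left _ _)
  have hy : n.size ≤ w := Nat.size_le_size (Nat.le_add_right _ _)
  have hi' : i.size ≤ k.size := Nat.size_le_size hi
  have hw1 : 1 ≤ w := (Nat.size_pos.2 hn).trans_le hy
  have hwn : w ≤ w * n := Nat.le_mul_of_pos_right _ hn
  have h₁ : q.size * k * (n + 1) ≤ w * n * (2 * k) := by
    calc q.size * k * (n + 1) ≤ w * k * (2 * n) := by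
          refine Nat.mul_le_mul (Nat.mul_le_mul_right _ hz) (by omega)
      _ = w * n * (2 * k) := by ring
  have h₂ : k.size ≤ w * n * k.size := Nat.le_mul_of_pos_left _ (by omega)
  have hL : runLength q k i n ≤ w * (n * (4 * k + 2 * k.size + 13)) := by
    have : w * (n * (4 * k + 2 * k.size + 13))
        = 2 * (w * n * (2 * k)) + 2 * (w * n * k.size) + 13 * (w * n) := by ring
    unfold runLength
    omega
  have hdiv : 3 * runLength q k i n / w ≤ 3 * (n * (4 * k + 2 * k.size + 13)) := by
    refine Nat.div_le_of_le_mul ?_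
    calc _ ≤ 3 * (w * (n * (4 * k + 2 * k.size + 13))) := Nat.mul_le_mul_left 3 hL
      _ = _ := by ring
  calc (inputSetup q k i G S).unit = (3 * runLength q k i n / w + 1) ^ 2 := rfl
    _ ≤ ((3 * (4 * k + 2 * k.size + 13) + 1) * n) ^ 2 := by
      refine Nat.pow_le_pow_left ?_ 2
      calc _ ≤ 3 * (n * (4 * k + 2 * k.size + 13)) + n := Nat.add_le_add hdiv hn
        _ = _ := by ring
    _ = _ := mul_pow _ _ _

/-- The constants come from `B + 1 ≤ 2 * B` and `n + 1 ≤ 2 * n`, with `7680 = 240 * 4 * 8`; setup is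
linear in `q ^ k`, hence in `B`. -/
theorem steps_le {q k n s : ℕ} (hk : k ≤ q) (hn : 1 ≤ n) :
    50 * ((k + 1) * (q ^ k + 1) * (n + 1)) + (q.choose k ^ s *
        (240 * ((k + 1) ^ 2 * (q.choose k + 1) ^ 2) * (n + 1) ^ 3) + 1 + 1)
      ≤ (100 * ((k + 1) * (k ^ k * k.factorial + 1)) + 7680 * (k + 1) ^ 2 + 2)
        * (q.choose k ^ (s + 2) * n ^ 3) := by
  have hB : 1 ≤ q.choose k := Nat.choose_pos hk
  have hQ := pow_le_mul_choose hk
  generalize q.choose k = B at hB hQ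
  generalize hc : k ^ k * k.factorial = c at hQ
  set Z := B ^ (s + 2) * n ^ 3 with hZ
  have hZ1 : 1 ≤ Z := Nat.one_le_iff_ne_zero.2 (by positivity)
  have hBn : B * n ≤ Z := Nat.mul_le_mul (Nat.le_self_pow (by omega) B) (Nat.le_self_pow (by omega) n)
  have h₁ : 50 * ((k + 1) * (q ^ k + 1) * (n + 1)) ≤ 100 * ((k + 1) * (c + 1)) * Z := by
    calc 50 * ((k + 1) * (q ^ k + 1) * (n + 1))
        ≤ 50 * ((k + 1) * ((c + 1) * B) * (2 * n)) := by
          refine Nat.mul_le_mul_left _ (Nat.mul_le_mul (Nat.mul_le_mul_left _ ?_) (by omega))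
          rw [add_mul, one_mul]
          omega
      _ = 100 * ((k + 1) * (c + 1)) * (B * n) := by ring
      _ ≤ _ := Nat.mul_le_mul_left _ hBn
  have h₂ : B ^ s * (240 * ((k + 1) ^ 2 * (B + 1) ^ 2) * (n + 1) ^ 3)
      ≤ 7680 * (k + 1) ^ 2 * Z := by
    calc _ ≤ B ^ s * (240 * ((k + 1) ^ 2 * (2 * B) ^ 2) * (2 * n) ^ 3) := by gcongr <;> omega
      _ = 7680 * (k + 1) ^ 2 * Z := by rw [hZ]; ring
  calc _ ≤ 100 * ((k + 1) * (c + 1)) * Z + (7680 * (k + 1) ^ 2 * Z + Z + Z) := by omega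
    _ = _ := by ring

/-- The size is at most `log q / log 2 + 1 ≤ 2 * log q / log 2`, and `2 / log 2 < 3`. -/
theorem size_le_log {q : ℕ} (hq : 2 ≤ q) : (q.size : ℝ) ≤ 3 * Real.log q := by
  have hpos : 0 < q.size := Nat.size_pos.2 (by omega)
  have h₁ : 2 ^ (q.size - 1) ≤ q := by
    by_contra h
    have := Nat.size_le.2 (not_le.1 h)
    omega
  have h₂ : ((q.size - 1 : ℕ) : ℝ) * Real.log 2 ≤ Real.log q := by
    rw [← Real.log_pow]
    exact Real.log_le_log (by positivity) (by exact_mod_cast h₁)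
  have h₃ : Real.log 2 ≤ Real.log q := Real.log_le_log (by norm_num) (by exact_mod_cast hq)
  have h₄ := Real.log_two_gt_d9
  rw [Nat.cast_sub hpos, Nat.cast_one] at h₂
  have h₅ : (q.size : ℝ) * 0.6931 ≤ q.size * Real.log 2 :=
    mul_le_mul_of_nonneg_left (by linarith) (Nat.cast_nonneg _)
  nlinarith

/-- A number takes `C * n * log q` bits. The `40` registers and the `n + B + n * B ≤ 3 * n * B`
working cells give the factor `43`; the input bits give the `8`. -/
theorem space_le {q k i n : ℕ} (G : SimpleGraph (Fin n)) (S : Finset (Fin n)) (hi : i ≤ k)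
    (hk : k ≤ q) (hn : 1 ≤ n) (hq : 2 ≤ q) :
    ((inputSetup q k i G S).space : ℝ)
      ≤ (43 * (12 * k + 4 * k.size + 29) + 8 : ℕ) * q.choose k * (n : ℝ) ^ 2 * Real.log q := by
  have hz := size_le_log hq
  have hl : (1 : ℝ) ≤ 2 * Real.log q := by
    have h₃ : Real.log 2 ≤ Real.log q := Real.log_le_log (by norm_num) (by exact_mod_cast hq)
    have h₄ := Real.log_two_gt_d9
    linarith
  have hB : (1 : ℝ) ≤ q.choose k := by exact_mod_cast Nat.choose_pos hk
  have hn' : (1 : ℝ) ≤ n := by exact_mod_cast hn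
  have hy : n.size ≤ n := Nat.size_le.2 Nat.lt_two_pow_self
  have hi' : i.size ≤ k.size := Nat.size_le_size hi
  have hspace : (inputSetup q k i G S).space = 40 * (runLength q k i n + 1) +
      (2 * (n * n + n) + (n + q.choose k + n * q.choose k) * (runLength q k i n + 1)) := by
    have : n * n + n + n + q.choose k + n * q.choose k - (n * n + n)
        = n + q.choose k + n * q.choose k := by omega
    rw [← this]
    rfl
  have hL : runLength q k i n + 1 ≤ n * (4 * k * q.size + q.size + (2 * k.size + 13)) := by
    unfold runLength
    have h₁ : q.size * k * (n + 1) ≤ q.size * k * (2 * n) := Nat.mul_le_mul_left _ (by omega)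
    have h₂ : q.size ≤ n * q.size := Nat.le_mul_of_pos_left _ hn
    have h₃ : k.size ≤ n * k.size := Nat.le_mul_of_pos_left _ hn
    have h₄ : n * (4 * k * q.size + q.size + (2 * k.size + 13))
        = 2 * (q.size * k * (2 * n)) + n * q.size + 2 * (n * k.size) + 13 * n := by ring
    omega
  set l := Real.log q with hl'
  set B : ℝ := (q.choose k : ℝ) with hB'
  set C : ℝ := 12 * k + 4 * k.size + 29 with hC
  have hCpos : 0 ≤ C := by positivity
  have hLR : ((runLength q k i n + 1 : ℕ) : ℝ) ≤ C * (n * l) := by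
    calc ((runLength q k i n + 1 : ℕ) : ℝ)
        ≤ n * (4 * k * q.size + q.size + (2 * k.size + 13)) := by exact_mod_cast hL
      _ ≤ n * (4 * k * (3 * l) + 3 * l + (2 * k.size + 13) * (2 * l)) := by
        gcongr
        exact le_mul_of_one_le_right (by positivity) hl
      _ = C * (n * l) := by rw [hC]; ring
  have hl0 : 0 ≤ l := by linarith
  rw [hspace]
  push_cast
  have hcast : ((43 * (12 * k + 4 * k.size + 29) + 8 : ℕ) : ℝ) = 43 * C + 8 := by
    push_cast; rfl
  push_cast at hcast hLR
  have hnB : (n : ℝ) + B + n * B ≤ 3 * (n * B) := by nlinarith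
  have hnn : (n : ℝ) ≤ B * n ^ 2 := by nlinarith [mul_self_nonneg ((n : ℝ) - 1)]
  have h₁ : 40 * ((runLength q k i n : ℝ) + 1) ≤ 40 * C * (B * n ^ 2 * l) := by
    calc 40 * ((runLength q k i n : ℝ) + 1) ≤ 40 * (C * (n * l)) := by gcongr
      _ = 40 * C * (n * l) := by ring
      _ ≤ _ := by gcongr
  have h₂ : 2 * ((n : ℝ) * n + n) ≤ 8 * (B * n ^ 2 * l) := by
    have : (n : ℝ) ^ 2 ≤ B * n ^ 2 := le_mul_of_one_le_left (by positivity) hB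
    have h : B * (n : ℝ) ^ 2 ≤ B * n ^ 2 * (2 * l) := le_mul_of_one_le_right (by positivity) hl
    nlinarith
  have h₃ : ((n : ℝ) + B + n * B) * (runLength q k i n + 1) ≤ 3 * C * (B * n ^ 2 * l) := by
    calc _ ≤ 3 * (n * B) * (C * (n * l)) := by gcongr
      _ = _ := by ring
  rw [hcast]
  calc _ ≤ 40 * C * (B * n ^ 2 * l) + (8 * (B * n ^ 2 * l) + 3 * C * (B * n ^ 2 * l)) := by
        gcongr
    _ = _ := by ring

theorem mainTheorem5 :
    ∃ (P : RamProg) (d : ℕ), ∀ k : ℕ, ∃ c : ℕ,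
      ∀ (q i n : ℕ) (G : SimpleGraph (Fin n)) (S : Finset (Fin n)), IsFeedbackVertexSet G S →
        ∃ (t s : ℕ) (τ : RamState),
          Runs (Nat.size (n + q)) s P (countingInput q k i G S) t τ ∧
          τ.reg 0 = numProperColorings G q k i ∧
          (i ≤ k → k ≤ q → 1 ≤ n →
            t ≤ c * q.choose k ^ (S.card + 2) * n ^ d ∧
            (2 ≤ q → (s : ℝ) ≤ c * q.choose k * (n : ℝ) ^ 2 * Real.log q)) := by
  -- The exponent is `3` from the number of instructions plus `2` from the cost of one.
  refine ⟨countProg, 5, fun k => ?_⟩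
  set a := (3 * (4 * k + 2 * k.size + 13) + 1) ^ 2 with ha
  set b := 100 * ((k + 1) * (k ^ k * k.factorial + 1)) + 7680 * (k + 1) ^ 2 + 2 with hb
  set e := 43 * (12 * k + 4 * k.size + 29) + 8 with he
  refine ⟨a * b + e, fun q i n G S hS => ?_⟩
  obtain ⟨t, τ, hrun, ht, -, hτ⟩ := ends_countProg q k i G S hS
  refine ⟨t, _, τ, hrun, hτ, fun hi hk hn => ⟨?_, fun hq => ?_⟩⟩
  · calc t ≤ a * n ^ 2 * (b * (q.choose k ^ (S.card + 2) * n ^ 3)) :=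
          ht.trans (Nat.mul_le_mul (unit_le G S hi hn) (steps_le hk hn))
      _ = a * b * q.choose k ^ (S.card + 2) * n ^ 5 := by ring
      _ ≤ (a * b + e) * q.choose k ^ (S.card + 2) * n ^ 5 := by
        gcongr
        exact Nat.le_add_right _ _
  · refine (space_le G S hi hk hn hq).trans ?_
    have : 0 ≤ Real.log q := Real.log_natCast_nonneg q
    rw [← he]
    clear_value e
    gcongr
    exact Nat.le_add_left _ _
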